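/- **Setting.** Let $p\in(0,1]$, $q\in[0,1)$, $p^2+q^2=1$, $\alpha,\beta,\gamma\in\mathbf R$, and let $$C_0=e^{i\gamma/2}\begin{pmatrix}pe^{i(\alpha-\gamma/2)}&qe^{i(\beta-\gamma/2)}\\-qe^{-i(\beta-\gamma/2)}&pe^{-i(\alpha-\gamma/2)}\end{pmatrix}\in U(2),\qquad U_0=SC_0,\quad (S\psi)(x)=\begin{pmatrix}\psi^{(0)}(x+1)\\\psi^{(1)}(x-1)\end{pmatrix},\ x\in\mathbf Z,$$ acting on functions $\mathbf Z\to\mathbf C^2$, with formal adjoint $(U_0^*u)(x)=C_0^*\,{}^t(u^{(0)}(x-1),u^{(1)}(x+1))$. With $r_{-1}=0$, $r_j=2^j$, the spaces $\mathcal B(\mathbf Z)$, $\mathcal B^*(\mathbf Z)$ of functions $\mathbf Z\to\mathbf C^2$ are given by $$\|f\|_{\mathcal B}=\sum_{j\ge0}r_j^{1/2}\Big(\sum_{r_{j-1}\le|x|<r_j}|f(x)|^2\Big)^{1/2}<\infty,\qquad \|u\|_{\mathcal B^*}^2=\sup_{R>1}\frac1R\sum_{|x|<R}|u(x)|^2<\infty,$$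 and $(u,f)=\sum_x(u(x),f(x))_{\mathbf C^2}$ (linear in $u$, conjugate linear in $f$). For $z\in\mathbf C\setminus\mathbf R$ the resolvent $R_0(z)=(U_0-e^{iz})^{-1}$ exists on $\ell^2(\mathbf Z;\mathbf C^2)$. Write $\widehat u(\xi)=(\mathcal Uu)(\xi)=(2\pi)^{-1/2}\sum_xe^{-ix\xi}u(x)$, a distribution on $\mathbf T=\mathbf R/2\pi\mathbf Z$ if $u\in\mathcal B^*(\mathbf Z)$, and let $\widehat U_0(\xi)=\mathrm{diag}(e^{i\xi},e^{-i\xi})C_0$. Put $a(\xi)=\arccos(p\cos(\xi+\alpha-\gamma/2))$. The eigenvalues of $\widehat U_0(\xi)$ are $\lambda_1=e^{i(\gamma/2+a(\xi))}$ and $\lambda_2=e^{i(\gamma/2-a(\xi))}$; $P_j(\xi)$ is the orthogonal projection onto the eigenspace of $\lambda_j(\xi)$. Call $\xi$ regular if $\lambda_1(\xi)\ne\lambda_2(\xi)$ (every $\xi$ is regular if $p<1$). Let $$J_{\gamma,1}=[\arccos p+\tfrac\gamma2,\ \pi-\arccos p+\tfrac\gamma2],\qquad J_{\gamma,2}=[\pi+\arccos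 p+\tfrac\gamma2,\ 2\pi-\arccos p+\tfrac\gamma2],$$ let $J_\gamma=J_{\gamma,1}\cup J_{\gamma,2}$, let $J_{\gamma,\mathcal T}$ be the set of the end points of these two intervals, and let $M(\theta)=\{\xi\in\mathbf T:\det(\widehat U_0(\xi)-e^{i\theta})=0\}$, a finite set consisting of regular points if $\theta\in J_\gamma\setminus J_{\gamma,\mathcal T}$. For $\xi\in M(\theta)$ let $\sigma(\xi)=\operatorname{sgn}\sin(\xi+\alpha-\gamma/2)$, the sign of $a'(\xi)$, and let $$\frac{d\xi}{d\theta}(\theta)=\frac{|\sin(\theta-\gamma/2)|}{\sqrt{p^2-\cos^2(\theta-\gamma/2)}}>0 .$$ A distribution $v$ on $\mathbf R$ is in $\mathcal B_0^*(\mathbf R)$ if its Fourier transform $\widetilde v(s)=(2\pi)^{-1/2}\int e^{-is\xi}v(\xi)\,d\xi$ satisfies $\sup_{R>1}\frac1R\int_{|s|<R}|\widetilde v|^2ds<\infty$ and $\frac1R\int_{|s|<R}|\widetilde v|^2ds\to0$ as $R\to\infty$. A cut-off near $\xi_0$ is a smooth function supported in $[\xi_0-\delta,\xi_0+\delta]$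 for some $\delta<\pi$. For $A=1,P_1,P_2$ we say $(\xi_0,\omega)\notin WF^*(A\widehat u)$, $\omega=\pm1$, if there is a cut-off $\psi$ near $\xi_0$ with $\psi(\xi_0)=1$ and $\psi A$ smooth such that $\frac1R\int_{|s|<R,\ \operatorname{sgn}s=\omega}|\widetilde{\psi A\widehat u}(s)|^2ds\to0$ as $R\to\infty$. Let $\mathbf h(\theta)$ be the space of pairs $\phi=(\phi_1,\phi_2)$ of functions on $M(\theta)$ with $\phi_j(\xi)\in\operatorname{Ran}P_j(\xi)$, with inner product $(\phi,\psi)_{\mathbf h(\theta)}=\sum_{j}\sum_{\xi\in M(\theta)}(\phi_j(\xi),\psi_j(\xi))_{\mathbf C^2}\frac{d\xi}{d\theta}(\theta)$, and for $f\in\mathcal B(\mathbf Z)$ let $\mathcal F_0(\theta)f=(\mathcal F_{0,1}(\theta)f,\mathcal F_{0,2}(\theta)f)$, where $\mathcal F_{0,j}(\theta)f=P_j\widehat f|_{M(\theta)}$ if $\theta\in J_{\gamma,j}$ and $\mathcal F_{0,j}(\theta)f=0$ otherwise. **Theorem.** There are linear maps $R_0(\theta\pm i0):\mathcal B(\mathbf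 Z)\to\mathcal B^*(\mathbf Z)$, $\theta\in J_\gamma\setminus J_{\gamma,\mathcal T}$, such that the following hold. (1) For $\theta\in J_\gamma\setminus J_{\gamma,\mathcal T}$ and $f,g\in\mathcal B(\mathbf Z)$, $(R_0(\theta-i\log(1\mp\epsilon))f,g)\to(R_0(\theta\pm i0)f,g)$ as $\epsilon\downarrow0$. (2) For every compact interval $I\subset J_\gamma\setminus J_{\gamma,\mathcal T}$ there is $\kappa>0$ with $\|R_0(\theta\pm i0)f\|_{\mathcal B^*}\le\kappa\|f\|_{\mathcal B}$ for all $\theta\in I$ and $f\in\mathcal B(\mathbf Z)$. (3) For $f,g\in\mathcal B(\mathbf Z)$ the map $J_\gamma\setminus J_{\gamma,\mathcal T}\ni\theta\mapsto(R_0(\theta\pm i0)f,g)$ is continuous. (4) Let $\theta\in J_\gamma\setminus J_{\gamma,\mathcal T}$ and $f\in\mathcal B(\mathbf Z)$. Then $u_\pm=R_0(\theta\pm i0)f$ is the unique $u\in\mathcal B^*(\mathbf Z)$ with $(U_0-e^{i\theta})u=f$ and, over regular points, $$WF^*(P_1\mathcal Uu)\subset\{(\xi,\mp\sigma(\xi)):\xi\in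 M(\theta)\},\qquad WF^*(P_2\mathcal Uu)\subset\{(\xi,\pm\sigma(\xi)):\xi\in M(\theta)\}$$ (that is, the directions are $\mp1$ and $\pm1$ when measured in the local variable $\eta=a(\xi)+\mathrm{const}$ instead of $\xi$). More precisely, over regular points $WF^*(P_j\mathcal Uu_\pm)$ consists of the points of the respective set for which $P_j(\xi)\widehat f(\xi)\ne0$ if $\theta\in J_{\gamma,j}$, and is empty if $\theta\notin J_{\gamma,j}$. Moreover, for $\xi_0\in M(\theta)$ and every cut-off $\chi$ near $\xi_0$ whose support consists of regular points and contains no point of $M(\theta)$ other than $\xi_0$, $$\chi P_1\mathcal Uu_\pm-\chi\,\frac{e^{-i\gamma/2}e^{-ia(\xi)}}{i(a(\xi)-\theta+\gamma/2)\pm0}\,(P_1\widehat f)(\xi_0)\in\mathcal B_0^*(\mathbf R),$$ $$\chi P_2\mathcal Uu_\pm+\chi\,\frac{e^{-i\gamma/2}e^{ia(\xi)}}{i(a(\xi)-2\pi+\theta-\gamma/2)\mp0}\,(P_2\widehat f)(\xi_0)\in\mathcal B_0^*(\mathbf R),$$ where $\pm0$ denotes the limit of $\pm\epsilon$ as $\epsilon\downarrow0$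 in the sense of distributions, which exists; and $\chi\,\mathcal Uu_\pm\in\mathcal B_0^*(\mathbf R)$ for every cut-off $\chi$ whose support does not meet $M(\theta)$. (5) For $\theta\in J_\gamma\setminus J_{\gamma,\mathcal T}$ and $f,g\in\mathcal B(\mathbf Z)$, $(R_0(\theta+i0)f-R_0(\theta-i0)f,g)=2\pi e^{-i\theta}(\mathcal F_0(\theta)f,\mathcal F_0(\theta)g)_{\mathbf h(\theta)}$. (6) For $\theta\in J_\gamma\setminus J_{\gamma,\mathcal T}$, $\mathcal F_0(\theta):\mathcal B(\mathbf Z)\to\mathbf h(\theta)$ is bounded and has a bounded adjoint $\mathcal F_0(\theta)^*:\mathbf h(\theta)\to\mathcal B^*(\mathbf Z)$, given by $(\mathcal F_0(\theta)f,\phi)_{\mathbf h(\theta)}=(f,\mathcal F_0(\theta)^*\phi)$ with $(f,u):=\overline{(u,f)}$. For every $\phi\in\mathbf h(\theta)$, $(U_0-e^{i\theta})\mathcal F_0(\theta)^*\phi=0$ and $(U_0^*-e^{-i\theta})\mathcal F_0(\theta)^*\phi=0$. -/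

import Mathlib

open Complex Filter Topology MeasureTheory Set
open scoped ContDiff

noncomputable section

namespace QW

/-- The internal (spin) space `ℂ²` with its standard inner product. -/
abbrev E : Type := EuclideanSpace ℂ (Fin 2)

/-- The state space `ℓ²(ℤ; ℂ²)`. -/
abbrev H : Type := lp (fun _ : ℤ => E) 2

/-! ### The spaces `𝓑(ℤ)`, `𝓑*(ℤ)` -/

/-- The integers `x` with `|x| < R`. -/
def ball (R : ℝ) : Finset ℤ := Finset.Ioo (-⌈R⌉) ⌈R⌉

lemma mem_ball {R : ℝ} {x : ℤ} : x ∈ ball R ↔ |(x : ℝ)| < R := by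
  rw [ball, Finset.mem_Ioo, abs_lt]
  have h1 : x < ⌈R⌉ ↔ (x : ℝ) < R := Int.lt_ceil
  have h2 : -x < ⌈R⌉ ↔ ((-x : ℤ) : ℝ) < R := Int.lt_ceil
  push_cast at h2
  constructor
  · rintro ⟨h3, h4⟩
    have := h2.1 (by omega)
    exact ⟨by linarith, h1.1 h4⟩
  · rintro ⟨h3, h4⟩
    have := h2.2 (by linarith)
    exact ⟨by omega, h1.2 h4⟩

/-- The radii, with the index shifted by one: `radius 0 = r₋₁ = 0`,
`radius (j + 1) = r_j = 2 ^ j`. -/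
def radius : ℕ → ℝ
  | 0 => 0
  | j + 1 => 2 ^ j

/-- The dyadic shell `r_{j-1} ≤ |x| < r_j` in `ℤ`. -/
def shell (j : ℕ) : Finset ℤ :=
  (ball (radius (j + 1))).filter fun x => radius j ≤ |(x : ℝ)|

/-- The `j`-th term `r_j^{1/2} (∑_{r_{j-1} ≤ |x| < r_j} |f(x)|²)^{1/2}` of the `𝓑(ℤ)` norm. -/
def Bterm (f : ℤ → E) (j : ℕ) : ℝ :=
  √(radius (j + 1)) * √(∑ x ∈ shell j, ‖f x‖ ^ 2)

/-- The `𝓑(ℤ)` norm. -/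
def Bnorm (f : ℤ → E) : ℝ := ∑' j, Bterm f j

lemma Bterm_nonneg (f : ℤ → E) (j : ℕ) : 0 ≤ Bterm f j := by
  unfold Bterm; positivity

lemma Bterm_add_le (f g : ℤ → E) (j : ℕ) :
    Bterm (f + g) j ≤ √2 * (Bterm f j + Bterm g j) := by
  unfold Bterm
  have h : ∑ x ∈ shell j, ‖(f + g) x‖ ^ 2
      ≤ 2 * ((∑ x ∈ shell j, ‖f x‖ ^ 2) + ∑ x ∈ shell j, ‖g x‖ ^ 2) := by
    rw [← Finset.sum_add_distrib, Finset.mul_sum]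
    refine Finset.sum_le_sum fun x _ => ?_
    have h1 : ‖(f + g) x‖ ≤ ‖f x‖ + ‖g x‖ := norm_add_le _ _
    have h2 := norm_nonneg ((f + g) x)
    nlinarith [sq_nonneg (‖f x‖ - ‖g x‖), norm_nonneg (f x), norm_nonneg (g x)]
  have h2 : √(∑ x ∈ shell j, ‖(f + g) x‖ ^ 2)
      ≤ √2 * (√(∑ x ∈ shell j, ‖f x‖ ^ 2) + √(∑ x ∈ shell j, ‖g x‖ ^ 2)) := by
    refine (Real.sqrt_le_sqrt h).trans ?_
    rw [Real.sqrt_mul (by norm_num)]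
    refine mul_le_mul_of_nonneg_left ?_ (Real.sqrt_nonneg _)
    rw [Real.sqrt_le_left (by positivity)]
    have a := Real.sq_sqrt (show 0 ≤ ∑ x ∈ shell j, ‖f x‖ ^ 2 by positivity)
    have b := Real.sq_sqrt (show 0 ≤ ∑ x ∈ shell j, ‖g x‖ ^ 2 by positivity)
    nlinarith [mul_nonneg (Real.sqrt_nonneg (∑ x ∈ shell j, ‖f x‖ ^ 2))
      (Real.sqrt_nonneg (∑ x ∈ shell j, ‖g x‖ ^ 2))]
  calc _ ≤ √(radius (j + 1)) * (√2 * (√(∑ x ∈ shell j, ‖f x‖ ^ 2)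
        + √(∑ x ∈ shell j, ‖g x‖ ^ 2))) :=
        mul_le_mul_of_nonneg_left h2 (Real.sqrt_nonneg _)
    _ = _ := by ring

lemma Bterm_smul (c : ℂ) (f : ℤ → E) (j : ℕ) : Bterm (c • f) j = ‖c‖ * Bterm f j := by
  unfold Bterm
  have : ∑ x ∈ shell j, ‖(c • f) x‖ ^ 2 = ‖c‖ ^ 2 * ∑ x ∈ shell j, ‖f x‖ ^ 2 := by
    rw [Finset.mul_sum]
    refine Finset.sum_congr rfl fun x _ => ?_
    rw [Pi.smul_apply, norm_smul, mul_pow]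
  rw [this, Real.sqrt_mul (by positivity), Real.sqrt_sq (norm_nonneg c)]
  ring

/-- The space `𝓑(ℤ)` of all `f : ℤ → ℂ²` with finite `𝓑(ℤ)` norm. -/
def BZ : Submodule ℂ (ℤ → E) where
  carrier := {f | Summable (Bterm f)}
  zero_mem' := by
    have : Bterm (0 : ℤ → E) = 0 := by
      funext j; simp [Bterm]
    simp only [Set.mem_ofPred_eq, this]
    exact summable_zero
  add_mem' := fun {f g} hf hg =>
    Summable.of_nonneg_of_le (Bterm_nonneg _) (Bterm_add_le f g)
      ((Summable.add hf hg).mul_left (√2))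
  smul_mem' := fun c f hf => by
    have : Bterm (c • f) = fun j => ‖c‖ * Bterm f j := funext (Bterm_smul c f)
    simp only [Set.mem_ofPred_eq, this]
    exact Summable.mul_left _ hf

/-- The mean `R⁻¹ ∑_{|x| < R} |u(x)|²`. -/
def mean (u : ℤ → E) (R : ℝ) : ℝ := R⁻¹ * ∑ x ∈ ball R, ‖u x‖ ^ 2

/-- The `𝓑*(ℤ)` norm: `‖u‖² = sup_{R > 1} R⁻¹ ∑_{|x| < R} |u(x)|²`. -/
def BstarNorm (u : ℤ → E) : ℝ := √(⨆ R : Set.Ioi (1 : ℝ), mean u R)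

/-- The space `𝓑*(ℤ)` of all `u : ℤ → ℂ²` with finite `𝓑*(ℤ)` norm. -/
def BstarZ : Submodule ℂ (ℤ → E) where
  carrier := {u | ∃ K : ℝ, ∀ R : ℝ, 1 < R → mean u R ≤ K}
  zero_mem' := ⟨0, fun R _ => by simp [mean]⟩
  add_mem' := by
    rintro u v ⟨K, hK⟩ ⟨L, hL⟩
    refine ⟨2 * (K + L), fun R hR => ?_⟩
    have h : mean (u + v) R ≤ 2 * (mean u R + mean v R) := by
      unfold mean
      rw [← mul_add, ← Finset.sum_add_distrib, mul_left_comm]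
      refine mul_le_mul_of_nonneg_left ?_ (by positivity)
      rw [Finset.mul_sum]
      refine Finset.sum_le_sum fun x _ => ?_
      have h1 : ‖(u + v) x‖ ≤ ‖u x‖ + ‖v x‖ := norm_add_le _ _
      have h2 := norm_nonneg ((u + v) x)
      nlinarith [sq_nonneg (‖u x‖ - ‖v x‖), norm_nonneg (u x), norm_nonneg (v x)]
    linarith [hK R hR, hL R hR]
  smul_mem' := by
    rintro c u ⟨K, hK⟩
    refine ⟨‖c‖ ^ 2 * K, fun R hR => ?_⟩
    have : mean (c • u) R = ‖c‖ ^ 2 * mean u R := by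
      unfold mean
      rw [mul_left_comm, Finset.mul_sum (a := ‖c‖ ^ 2)]
      congr 1
      refine Finset.sum_congr rfl fun x _ => ?_
      rw [Pi.smul_apply, norm_smul, mul_pow]
    rw [this]
    exact mul_le_mul_of_nonneg_left (hK R hR) (by positivity)

/-- The coupling `(u, f) = ∑_x (u(x), f(x))_{ℂ²}`, linear in `u` and conjugate linear in `f`. -/
def pair (u f : ℤ → E) : ℂ := ∑' x, inner ℂ (f x) (u x)

lemma exists_shell (x : ℤ) : ∃ j, x ∈ shell j := by
  classical
  have hex : ∃ n : ℕ, |(x : ℝ)| < radius (n + 1) := by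
    obtain ⟨n, hn⟩ := pow_unbounded_of_one_lt |(x : ℝ)| (one_lt_two)
    exact ⟨n, hn⟩
  refine ⟨Nat.find hex, ?_⟩
  rw [shell, Finset.mem_filter, mem_ball]
  refine ⟨Nat.find_spec hex, ?_⟩
  rcases hn : Nat.find hex with _ | m
  · simp [radius]
  · exact not_lt.1 (Nat.find_min hex (m := m) (by omega))

lemma shell_card_le (j : ℕ) : ((shell j).card : ℝ) ≤ 2 * radius (j + 1) := by
  have h1 : (shell j).card ≤ (ball (radius (j + 1))).card := Finset.card_filter_le _ _
  have h2 : (ball (radius (j + 1))).card ≤ 2 * 2 ^ j := by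
    have : ⌈radius (j + 1)⌉ = (2 : ℤ) ^ j := by
      have : radius (j + 1) = (((2 : ℤ) ^ j : ℤ) : ℝ) := by simp [radius]
      rw [this, Int.ceil_intCast]
    rw [ball, this, Int.card_Ioo]
    have : (0 : ℤ) < 2 ^ j := by positivity
    zify
    omega
  calc ((shell j).card : ℝ) ≤ ((2 * 2 ^ j : ℕ) : ℝ) := by exact_mod_cast h1.trans h2
    _ = 2 * radius (j + 1) := by simp [radius]

/-- `𝓑(ℤ) ⊂ ℓ¹(ℤ)`. -/
lemma summable_norm_of_mem_BZ {f : ℤ → E} (hf : f ∈ BZ) : Summable fun x => ‖f x‖ := by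
  classical
  have hf' : Summable (Bterm f) := hf
  have hsh : ∀ j, ∑ x ∈ shell j, ‖f x‖ ≤ √2 * Bterm f j := by
    intro j
    have hr : (0 : ℝ) ≤ radius (j + 1) := by simp [radius]
    have hcs := sq_sum_le_card_mul_sum_sq (s := shell j) (f := fun x => ‖f x‖)
    have hS : (0 : ℝ) ≤ ∑ x ∈ shell j, ‖f x‖ ^ 2 := by positivity
    unfold Bterm
    rw [← mul_assoc, ← Real.sqrt_mul (by norm_num), ← Real.sqrt_mul (by positivity)]
    refine Real.le_sqrt_of_sq_le (hcs.trans ?_)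
    exact mul_le_mul_of_nonneg_right (shell_card_le j) hS
  refine summable_of_sum_le (c := √2 * ∑' j, Bterm f j) (fun _ => norm_nonneg _) fun s => ?_
  choose k hk using exists_shell
  calc ∑ x ∈ s, ‖f x‖
      = ∑ j ∈ s.image k, ∑ x ∈ s with k x = j, ‖f x‖ :=
        (Finset.sum_fiberwise_of_maps_to (fun x hx => Finset.mem_image_of_mem k hx) _).symm
    _ ≤ ∑ j ∈ s.image k, ∑ x ∈ shell j, ‖f x‖ := by
        refine Finset.sum_le_sum fun j _ => ?_
        refine Finset.sum_le_sum_of_subset_of_nonneg ?_ fun _ _ _ => norm_nonneg _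
        intro x hx
        rw [← (Finset.mem_filter.1 hx).2]
        exact hk x
    _ ≤ ∑ j ∈ s.image k, √2 * Bterm f j := Finset.sum_le_sum fun j _ => hsh j
    _ = √2 * ∑ j ∈ s.image k, Bterm f j := by rw [Finset.mul_sum]
    _ ≤ √2 * ∑' j, Bterm f j :=
        mul_le_mul_of_nonneg_left
          (Summable.sum_le_tsum _ (fun j _ => Bterm_nonneg f j) hf') (Real.sqrt_nonneg _)

/-- `𝓑(ℤ) ⊂ ℓ²(ℤ)`. -/
lemma memlp_of_mem_BZ {f : ℤ → E} (hf : f ∈ BZ) : Memℓp f 2 := by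
  have h1 : Memℓp f 1 := memℓp_gen (by simpa using summable_norm_of_mem_BZ hf)
  exact h1.of_exponent_ge (by norm_num)

/-- The inclusion `𝓑(ℤ) ⊂ ℓ²(ℤ; ℂ²)`. -/
def BZ.toH (f : BZ) : H := ⟨(f : ℤ → E), memlp_of_mem_BZ f.2⟩

/-! ### The position-independent quantum walk -/

/-- The parameters of the constant coin `C₀ ∈ U(2)`; real representatives are used for the
angles `α, β, γ ∈ ℝ / 2πℤ`. -/
structure Coin where
  p : ℝ
  q : ℝ
  α : ℝ
  β : ℝ
  γ : ℝ
  p_pos : 0 < p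
  p_le_one : p ≤ 1
  q_nonneg : 0 ≤ q
  q_lt_one : q < 1
  sq_add_sq : p ^ 2 + q ^ 2 = 1

namespace Coin

variable (c : Coin)

/-- The coin matrix `C₀`. -/
def C0 : Matrix (Fin 2) (Fin 2) ℂ :=
  cexp (I * (c.γ / 2)) •
    !![c.p * cexp (I * (c.α - c.γ / 2)), c.q * cexp (I * (c.β - c.γ / 2));
      -c.q * cexp (-I * (c.β - c.γ / 2)), c.p * cexp (-I * (c.α - c.γ / 2))]

/-- The first row of `C₀`, completed by a zero row. -/
def C1 : Matrix (Fin 2) (Fin 2) ℂ := !![c.C0 0 0, c.C0 0 1; 0, 0]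

/-- The second row of `C₀`, completed by a zero row. -/
def C2 : Matrix (Fin 2) (Fin 2) ℂ := !![0, 0; c.C0 1 0, c.C0 1 1]

/-- A `2 × 2` matrix as a bounded operator on `ℂ²`. -/
abbrev _root_.QW.op (A : Matrix (Fin 2) (Fin 2) ℂ) : E →L[ℂ] E :=
  Matrix.toEuclideanCLM (n := Fin 2) (𝕜 := ℂ) A

/-- The walk `(U₀ u)(x) = C₁ u(x + 1) + C₂ u(x - 1)` on arbitrary functions `ℤ → ℂ²`,
that is, `U₀ = S C₀` with the shift `(S ψ)(x) = (ψ⁽⁰⁾(x + 1), ψ⁽¹⁾(x - 1))`. -/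
def U0 : (ℤ → E) →ₗ[ℂ] (ℤ → E) where
  toFun u x := op c.C1 (u (x + 1)) + op c.C2 (u (x - 1))
  map_add' u v := by
    funext x
    simp only [Pi.add_apply, map_add]
    abel
  map_smul' a u := by
    funext x
    simp only [Pi.smul_apply, map_smul, RingHom.id_apply, smul_add]

/-- The formal adjoint `(U₀* u)(x) = C₀* (u⁽⁰⁾(x - 1), u⁽¹⁾(x + 1))` on functions `ℤ → ℂ²`. -/
def U0star (u : ℤ → E) (x : ℤ) : E :=
  op c.C0.conjTranspose (!₂[u (x - 1) 0, u (x + 1) 1] : E)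

lemma _root_.QW.memlp_op_shift (A : E →L[ℂ] E) (e : ℤ ≃ ℤ) {u : ℤ → E} (hu : Memℓp u 2) :
    Memℓp (fun x => A (u (e x))) 2 := by
  have h1 : Summable fun x => ‖u x‖ ^ (2 : ℝ) := by simpa using hu.summable (by norm_num)
  refine memℓp_gen ?_
  have h2 : Summable fun x => ‖A‖ ^ (2 : ℝ) * ‖u (e x)‖ ^ (2 : ℝ) :=
    ((e.summable_iff (f := fun x => ‖u x‖ ^ (2 : ℝ))).2 h1).mul_left _
  refine Summable.of_nonneg_of_le (fun x => by positivity) (fun x => ?_) h2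
  rw [← Real.mul_rpow (norm_nonneg _) (norm_nonneg _)]
  exact Real.rpow_le_rpow (norm_nonneg _) (A.le_opNorm _) (by norm_num)

/-- On `ℓ²(ℤ; ℂ²)`: the operator `u ↦ A (u ∘ e)` for a permutation `e` of `ℤ`. -/
def _root_.QW.opShift (A : E →L[ℂ] E) (e : ℤ ≃ ℤ) : H →L[ℂ] H :=
  LinearMap.mkContinuous
    { toFun := fun u => ⟨fun x => A ((u : ℤ → E) (e x)), memlp_op_shift A e u.2⟩
      map_add' := fun u v => by
        apply lp.ext; funext x; exact map_add A _ _
      map_smul' := fun a u => by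
        apply lp.ext; funext x; exact map_smul A a _ }
    ‖A‖
    (fun u => by
      refine lp.norm_le_of_forall_sum_le (by norm_num) (by positivity) fun s => ?_
      have hs := lp.sum_rpow_le_norm_rpow (p := 2) (by norm_num) u (s.map e.toEmbedding)
      rw [Finset.sum_map] at hs
      rw [Real.mul_rpow (norm_nonneg _) (norm_nonneg _)]
      refine le_trans ?_ (mul_le_mul_of_nonneg_left hs (by positivity))
      rw [Finset.mul_sum]
      refine Finset.sum_le_sum fun x _ => ?_
      rw [← Real.mul_rpow (norm_nonneg _) (norm_nonneg _)]
      exact Real.rpow_le_rpow (norm_nonneg _) (A.le_opNorm _) (by norm_num))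

/-- The walk `U₀` as a bounded operator on `ℓ²(ℤ; ℂ²)`. -/
def U0H : H →L[ℂ] H :=
  opShift (op c.C1) (Equiv.addRight 1) + opShift (op c.C2) (Equiv.subRight 1)

lemma coe_U0H (u : H) : ((c.U0H u : H) : ℤ → E) = c.U0 (u : ℤ → E) := rfl

/-- The resolvent `R₀(z) = (U₀ - e^{iz})⁻¹` on `ℓ²(ℤ; ℂ²)`. -/
def R0 (z : ℂ) : H →L[ℂ] H :=
  Ring.inverse (c.U0H - cexp (I * z) • (1 : H →L[ℂ] H))

/-! ### Fourier multiplier, energy bands and thresholds -/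

/-- The multiplier matrix `Û₀(ξ)`. -/
def Uhat (ξ : ℝ) : Matrix (Fin 2) (Fin 2) ℂ :=
  cexp (I * (c.γ / 2)) •
    !![c.p * cexp (I * (c.α - c.γ / 2)) * cexp (I * ξ),
        c.q * cexp (I * (c.β - c.γ / 2)) * cexp (I * ξ);
      -c.q * cexp (-I * (c.β - c.γ / 2)) * cexp (-I * ξ),
        c.p * cexp (-I * (c.α - c.γ / 2)) * cexp (-I * ξ)]

/-- `arccos (p cos (ξ + α - γ/2))`. -/
def acs (ξ : ℝ) : ℝ := Real.arccos (c.p * Real.cos (ξ + c.α - c.γ / 2))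

/-- The eigenvalues of `Û₀(ξ)`: `λ₁ = e^{iθ(ξ)}` (index `0`) and `λ₂ = e^{i(γ - θ(ξ))}`
(index `1`), where `θ(ξ) = γ/2 + arccos (p cos (ξ + α - γ/2))`. -/
def lam : Fin 2 → ℝ → ℂ
  | 0, ξ => cexp (I * (c.γ / 2 + c.acs ξ))
  | 1, ξ => cexp (I * (c.γ - (c.γ / 2 + c.acs ξ)))

/-- The bands `J_{γ,1}` (index `0`) and `J_{γ,2}` (index `1`). -/
def band : Fin 2 → Set ℝ
  | 0 => Icc (Real.arccos c.p + c.γ / 2) (Real.pi - Real.arccos c.p + c.γ / 2)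
  | 1 => Icc (Real.pi + Real.arccos c.p + c.γ / 2) (2 * Real.pi - Real.arccos c.p + c.γ / 2)

/-- The thresholds `J_{γ,𝒯}`. -/
def thresholds : Set ℝ :=
  {Real.arccos c.p + c.γ / 2, Real.pi - Real.arccos c.p + c.γ / 2,
    Real.pi + Real.arccos c.p + c.γ / 2, 2 * Real.pi - Real.arccos c.p + c.γ / 2}

/-- `J_γ ∖ J_{γ,𝒯}`, where `J_γ = J_{γ,1} ∪ J_{γ,2}`. -/
def J : Set ℝ := (c.band 0 ∪ c.band 1) \ c.thresholds

/-- The set `{ξ : det (Û₀(ξ) - e^{iθ}) = 0}`, as a `2π`-periodic subset of `ℝ`. -/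
def fermi (θ : ℝ) : Set ℝ :=
  {ξ | (c.Uhat ξ - cexp (I * θ) • (1 : Matrix (Fin 2) (Fin 2) ℂ)).det = 0}

/-- `M(θ) ⊂ 𝕋 = ℝ / 2πℤ`, with `𝕋` represented by the fundamental domain `[0, 2π)`. -/
def M (θ : ℝ) : Set ℝ := c.fermi θ ∩ Ico 0 (2 * Real.pi)

/-- `dξ/dθ (θ) > 0`, the same number at all points of `M(θ)`; it is the absolute value of the
derivative of the local inverse of `ξ ↦ θ(ξ)`, respectively of `ξ ↦ 2π + γ - θ(ξ)`. -/
def dxi (θ : ℝ) : ℝ :=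
  |Real.sin (θ - c.γ / 2)| / √(c.p ^ 2 - Real.cos (θ - c.γ / 2) ^ 2)

/-- The eigenspace of `Û₀(ξ)` for `λ_j(ξ)`. -/
abbrev eig (j : Fin 2) (ξ : ℝ) : Submodule ℂ E :=
  Module.End.eigenspace (op (c.Uhat ξ)).toLinearMap (c.lam j ξ)

/-- The orthogonal projection `P_j(ξ)` onto the eigenspace. -/
def P (j : Fin 2) (ξ : ℝ) : E →L[ℂ] E := (c.eig j ξ).starProjection

/-- The points where `λ₁(ξ) ≠ λ₂(ξ)`, so that `P₁, P₂` are smooth there. This is all of `ℝ` if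
`p < 1`; if `p = 1`, the points `ξ + α - γ/2 ∈ πℤ` are left out. -/
def regular : Set ℝ := {ξ | c.lam 0 ξ ≠ c.lam 1 ξ}

/-- The sign of the derivative of `ξ ↦ arccos (p cos (ξ + α - γ/2))`. -/
def slope (ξ : ℝ) : ℝ := Real.sign (Real.sin (ξ + c.α - c.γ / 2))

end Coin

/-! ### Fourier series, local Fourier transforms and wave front sets -/

/-- The Fourier series `f̂(ξ) = (2π)^{-1/2} ∑_x e^{-ixξ} f(x)`. -/
def fhat (f : ℤ → E) (ξ : ℝ) : E :=
  ((√(2 * Real.pi))⁻¹ : ℂ) • ∑' x : ℤ, cexp (-I * x * ξ) • f x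

/-- For `u ∈ 𝓑*(ℤ)` the series `û = 𝒰u = (2π)^{-1/2} ∑_x e^{-ixξ} u(x)` is a distribution on the
torus, i.e. a `2π`-periodic distribution on `ℝ`. This is its pairing `∫_ℝ A(ξ) û(ξ) dξ` with a
smooth compactly supported operator-valued test function `A`. -/
def distPair (u : ℤ → E) (A : ℝ → E →L[ℂ] E) : E :=
  ∑' x : ℤ, (((√(2 * Real.pi))⁻¹ : ℂ) • ∫ ξ : ℝ, cexp (-I * x * ξ) • A ξ) (u x)

/-- The Fourier transform `s ↦ (2π)^{-1/2} ∫_ℝ e^{-isξ} A(ξ) û(ξ) dξ` of the compactly supported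
distribution `A û` on `ℝ`, where `û = 𝒰u` and `A` is smooth with compact support. -/
def locFT (A : ℝ → E →L[ℂ] E) (u : ℤ → E) (s : ℝ) : E :=
  ((√(2 * Real.pi))⁻¹ : ℂ) • distPair u fun ξ => cexp (-I * s * ξ) • A ξ

/-- A distribution on `ℝ` with Fourier transform `F` belongs to `𝓑₀*(ℝ)`. -/
def IsB0star (F : ℝ → E) : Prop :=
  (⨆ R : Ioi (1 : ℝ), ENNReal.ofReal (R : ℝ)⁻¹ * ∫⁻ s in {s : ℝ | |s| < R}, ‖F s‖ₑ ^ 2) < ⊤ ∧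
  Tendsto (fun R : ℝ => ENNReal.ofReal R⁻¹ * ∫⁻ s in {s : ℝ | |s| < R}, ‖F s‖ₑ ^ 2) atTop (𝓝 0)

/-- Smooth cut-off functions on the torus with small support about `ξ₀`, lifted to `ℝ`. -/
def IsCutoff (ξ₀ : ℝ) (χ : ℝ → ℂ) : Prop :=
  ContDiff ℝ ∞ χ ∧ ∃ δ < Real.pi, tsupport χ ⊆ Icc (ξ₀ - δ) (ξ₀ + δ)

/-- The wave front set `WF*(A û)`, `û = 𝒰u`, as a subset of `ℝ × {±1}` that is `2π`-periodic in
the first variable: `(ξ₀, ω)` is not in it if there is a cut-off `ψ` near `ξ₀` with `ψ(ξ₀) = 1`,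
with `ψ A` smooth, such that
`R⁻¹ ∫_{|s| < R, sgn s = ω} |(ψ A û)~(s)|² ds → 0` as `R → ∞`. -/
def WFstar (A : ℝ → E →L[ℂ] E) (u : ℤ → E) : Set (ℝ × ℤˣ) :=
  {w | ¬ ∃ ψ : ℝ → ℂ, IsCutoff w.1 ψ ∧ ContDiff ℝ ∞ (fun ξ => ψ ξ • A ξ) ∧ ψ w.1 = 1 ∧
    Tendsto (fun R : ℝ => ENNReal.ofReal R⁻¹ *
      ∫⁻ s in {s : ℝ | |s| < R ∧ 0 < ((w.2 : ℤ) : ℝ) * s},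
        ‖locFT (fun ξ => ψ ξ • A ξ) u s‖ₑ ^ 2) atTop (𝓝 0)}

namespace Coin

variable (c : Coin)

/-- The radiation condition (`τ = ±1`): over the points where `P₁, P₂` are smooth,
`WF*(P₁ 𝒰u) ⊂ {(ξ(θ), ∓σ)}` and `WF*(P₂ 𝒰u) ⊂ {(ξ(θ), ±σ)}`, where `ξ(θ)` runs over the zeros of
`det (Û₀(ξ) - e^{iθ})` and `σ` is the sign of the derivative at `ξ(θ)` of the local variable
`η = arccos (p cos (ξ + α - γ/2)) + const`. In other words, the direction is `∓1`, respectively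
`±1`, when it is measured in the variable `η`. -/
def Radiation (τ : ℤˣ) (θ : ℝ) (u : ℤ → E) : Prop :=
  ∀ ξ ∈ c.regular, ∀ d : ℤˣ,
    ((ξ, d) ∈ WFstar (c.P 0) u →
      ξ ∈ c.fermi θ ∧ ((d : ℤ) : ℝ) = -((τ : ℤ) : ℝ) * c.slope ξ) ∧
    ((ξ, d) ∈ WFstar (c.P 1) u →
      ξ ∈ c.fermi θ ∧ ((d : ℤ) : ℝ) = ((τ : ℤ) : ℝ) * c.slope ξ)

/-- The scalar functions whose limits as `ε ↓ 0` are the singular leading terms, for the sign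
`τ = ±1`:
`e^{-iγ/2} e^{-i a(ξ)} / (i (a(ξ) - θ + γ/2) ± ε)` for `j = 1` (index `0`) and
`- e^{-iγ/2} e^{i a(ξ)} / (i (a(ξ) - 2π + θ - γ/2) ∓ ε)` for `j = 2` (index `1`),
where `a(ξ) = arccos (p cos (ξ + α - γ/2))`. -/
def leading (τ : ℤˣ) (θ ε : ℝ) : Fin 2 → ℝ → ℂ
  | 0, ξ => cexp (-I * (c.γ / 2)) * cexp (-I * c.acs ξ) /
      (I * (c.acs ξ - θ + c.γ / 2) + ((τ : ℤ) : ℂ) * ε)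
  | 1, ξ => -(cexp (-I * (c.γ / 2)) * cexp (I * c.acs ξ) /
      (I * (c.acs ξ - 2 * Real.pi + θ - c.γ / 2) - ((τ : ℤ) : ℂ) * ε))

/-- `S` is the Fourier transform of `χ` times the distribution `lim_{ε ↓ 0} leading τ θ ε j`. -/
def IsLeadingFT (τ : ℤˣ) (θ : ℝ) (j : Fin 2) (χ : ℝ → ℂ) (S : ℝ → ℂ) : Prop :=
  ∀ s : ℝ, Tendsto (fun ε : ℝ => ((√(2 * Real.pi))⁻¹ : ℂ) *
    ∫ ξ : ℝ, cexp (-I * s * ξ) * χ ξ * c.leading τ θ ε j ξ) (𝓝[>] 0) (𝓝 (S s))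

/-! ### The spaces `𝐡(θ)` and the operators `𝓕₀(θ)` -/

lemma p_ne_zero : (c.p : ℂ) ≠ 0 := by exact_mod_cast c.p_pos.ne'

open Polynomial in
lemma finite_M (θ : ℝ) : (c.M θ).Finite := by
  classical
  set μ : ℂ := cexp (I * θ) with hμ
  set κ : ℂ := cexp (I * (c.γ / 2)) with hκ
  set a : ℂ := cexp (I * (c.α - c.γ / 2)) with ha
  set a' : ℂ := cexp (-I * (c.α - c.γ / 2)) with ha'
  set b : ℂ := cexp (I * (c.β - c.γ / 2)) with hb
  set b' : ℂ := cexp (-I * (c.β - c.γ / 2)) with hb'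
  have haa : a * a' = 1 := by rw [ha, ha', ← Complex.exp_add]; ring_nf; simp
  have hbb : b * b' = 1 := by rw [hb, hb', ← Complex.exp_add]; ring_nf; simp
  let Q : ℂ[X] := C (μ * κ * c.p * a) * X ^ 2 + C (-(μ ^ 2 + κ ^ 2)) * X + C (μ * κ * c.p * a')
  have hlead : μ * κ * c.p * a ≠ 0 := by
    refine mul_ne_zero (mul_ne_zero (mul_ne_zero ?_ ?_) c.p_ne_zero) ?_ <;>
      exact Complex.exp_ne_zero _
  have hQ : Q ≠ 0 := fun h => by
    have h2 : Q.leadingCoeff = _ := leadingCoeff_quadratic hlead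
    rw [h, leadingCoeff_zero] at h2
    exact hlead h2.symm
  refine Set.Finite.of_injOn (f := fun ξ : ℝ => cexp (I * ξ)) (t := {w | Q.IsRoot w}) ?_ ?_ ?_
  · rintro ξ ⟨hξ, -⟩
    have hww : cexp (I * ξ) * cexp (-I * ξ) = 1 := by rw [← Complex.exp_add]; ring_nf; simp
    have hpq : (c.p : ℂ) ^ 2 + (c.q : ℂ) ^ 2 = 1 := by exact_mod_cast c.sq_add_sq
    simp only [fermi, Set.mem_ofPred_eq, Uhat, Matrix.det_fin_two, Matrix.sub_apply,
      Matrix.smul_apply, Matrix.of_apply, Matrix.cons_val', Matrix.cons_val_zero,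
      Matrix.cons_val_one, smul_eq_mul, Matrix.one_apply_eq, Matrix.cons_val_fin_one] at hξ
    simp only [ne_eq, zero_ne_one, one_ne_zero, not_false_eq_true, Matrix.one_apply_ne, mul_zero,
      sub_zero, mul_one] at hξ
    rw [← hκ, ← ha, ← ha', ← hb, ← hb', ← hμ] at hξ
    simp only [Set.mem_ofPred_eq, IsRoot.def, Q, eval_add, eval_mul, eval_C, eval_pow, eval_X]
    set w := cexp (I * ξ)
    set w' := cexp (-I * ξ)
    linear_combination (-w) * hξ + (κ ^ 2 * c.p ^ 2 * w * w * w' ) * haa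
      + (κ ^ 2 * c.q ^ 2 * w * w * w') * hbb
      + (κ ^ 2 * w * w * w') * hpq + (κ ^ 2 * w - μ * κ * c.p * a') * hww
  · intro x hx y hy hxy
    have h := Complex.exp_eq_exp_iff_exists_int.1 hxy
    obtain ⟨n, hn⟩ := h
    have hn' : x = y + n * (2 * Real.pi) := by
      have h2 : I * (x : ℂ) = I * ((y + n * (2 * Real.pi) : ℝ) : ℂ) := by
        rw [hn]; push_cast; ring
      exact_mod_cast mul_left_cancel₀ I_ne_zero h2
    have hπ := Real.pi_pos
    have h1 := hx.2; have h2 := hy.2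
    rw [Set.mem_Ico] at h1 h2
    have h3 : (n : ℝ) < 1 := by nlinarith
    have h4 : (-1 : ℝ) < n := by nlinarith
    have h5 : n = 0 := by
      have : n < 1 := by exact_mod_cast h3
      have : -1 < n := by exact_mod_cast h4
      omega
    simp [hn', h5]
  · exact (Q.roots.toFinset.finite_toSet).subset fun w hw => by
      simpa [hQ] using hw

instance (θ : ℝ) : Fintype (c.M θ) := (c.finite_M θ).fintype

/-- The space `𝐡(θ) = ⊕_{j=1,2} {φ_j a_j : φ_j : M(θ) → ℂ}`, `a_j(ξ)` a normalized eigenvector of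
`Û₀(ξ)` for `λ_j(ξ)`: its elements are the families of vectors `φ_j(ξ) a_j(ξ)` in the
eigenspaces. -/
abbrev hSpace (θ : ℝ) : Type := (j : Fin 2) → (ξ : c.M θ) → c.eig j ξ

/-- The inner product `∑_j ∑_{ξ ∈ M(θ)} φ_j(ξ) conj(ψ_j(ξ)) dξ/dθ` of `𝐡(θ)`. -/
def hInner {θ : ℝ} (φ ψ : c.hSpace θ) : ℂ :=
  ∑ j : Fin 2, ∑ ξ : c.M θ, (c.dxi θ : ℂ) * inner ℂ (ψ j ξ : E) (φ j ξ : E)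

/-- The norm of `𝐡(θ)`. -/
def hNorm {θ : ℝ} (φ : c.hSpace θ) : ℝ :=
  √(∑ j : Fin 2, ∑ ξ : c.M θ, c.dxi θ * ‖(φ j ξ : E)‖ ^ 2)

/-- The Fourier series on `𝓑(ℤ)`, evaluated at `ξ`. -/
def _root_.QW.fhatB (ξ : ℝ) : BZ →ₗ[ℂ] E where
  toFun f := fhat (f : ℤ → E) ξ
  map_add' f g := by
    have h : ∀ f : BZ, Summable fun x : ℤ => cexp (-I * x * ξ) • (f : ℤ → E) x := fun f =>
      Summable.of_norm_bounded (summable_norm_of_mem_BZ f.2) fun x => by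
        rw [norm_smul, show -I * (x : ℂ) * ξ = ((-(x * ξ) : ℝ) : ℂ) * I by push_cast; ring,
          Complex.norm_exp_ofReal_mul_I, one_mul]
    simp only [fhat, Submodule.coe_add, Pi.add_apply, smul_add]
    rw [(h f).tsum_add (h g), smul_add]
  map_smul' a f := by
    simp only [fhat, Submodule.coe_smul, Pi.smul_apply, RingHom.id_apply]
    rw [smul_comm a, ← tsum_const_smul'' a]
    simp only [smul_comm a]

open Classical in
/-- `𝓕₀(θ) f = (𝓕_{0,1}(θ) f, 𝓕_{0,2}(θ) f)`, where `𝓕_{0,j}(θ) f = P_j f̂` on `M(θ)` if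
`θ ∈ J_{γ,j}`, and `0` otherwise. -/
def F0 (θ : ℝ) : BZ →ₗ[ℂ] c.hSpace θ :=
  LinearMap.pi fun j => LinearMap.pi fun ξ =>
    if θ ∈ c.band j then
      ((c.eig j ξ).orthogonalProjectionOnto : E →ₗ[ℂ] c.eig j ξ) ∘ₗ fhatB ξ
    else 0

end Coin

end QW

end

/-!
The multiplier `Û₀(ξ)` is unitary with determinant `e^{iγ}` and trace
`2 e^{iγ/2} p cos (ξ + α - γ/2)`. By Cayley–Hamilton, `U₀ + e^{iγ} U₀*` is therefore a scalar
Jacobi operator with constant coefficients (`Coin.U0_add_U0star`), so that `(U₀ - μ) u = f` has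
the solution `u = N (e^{iγ} U₀* - μ) (k * f)`, where `k(n) = w^{|n|} e^{-i(α - γ/2)n}` is the
scalar Green's function, `w` is a root of `w + w⁻¹ = (e^{iγ} + μ²) / (μ e^{iγ/2} p)`, and `N` is
a constant (`Coin.resolv`, `Coin.resolv_eq`). For `|w| < 1` this is the resolvent. As
`μ = e^{iz}` tends to a point `e^{iθ}` of the interior of a band, `w` tends to `e^{± ik(θ)}` with
`p cos k(θ) = cos (θ - γ/2)`, and the sign is determined by the side from which `e^{iθ}` is
approached (`Coin.InBand.exists_root`). The kernels remain bounded and `𝓑(ℤ) ⊂ ℓ¹`, so the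
boundary values `R₀(θ ± i0)` exist, map `ℓ¹` to `ℓ^∞ ⊂ 𝓑*(ℤ)`, and depend continuously on `θ`,
all by dominated convergence.

Everything else follows from the explicit kernel with `|w| = 1`. At each end of `ℤ`, the function
`R₀(θ ± i0) f` is asymptotic to one of the two plane waves that solve `U₀ u = e^{iθ} u`, with
amplitude `± √(2π) (dξ/dθ) e^{-iθ} P_j f̂` (`Coin.InBand.tendsto_Rb`). A local Fourier transform
`s ↦ (A û)~(s)` is the convolution of `u` with a rapidly decreasing kernel at `-s`; hence its
asymptotics at one end of `ℝ` depend only on those of `u` at the opposite end of `ℤ`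
(`tendsto_locFT_sub_sum`), and for plane waves it is computed by Poisson summation (`locFT_pw`).
Thus the direction of a wave front is opposite to the end of `ℤ` where the plane wave is present
(`Coin.InBand.mem_WFstar_iff`), which gives the wave front sets of `R₀(θ ± i0) f`. A difference
of two solutions is a sum of two plane waves (`Coin.InBand.eq_sum_pw`), each present at both
ends, and the radiation condition excludes one of the two directions; this is uniqueness
(`Coin.InBand.eq_Rb`).

For the leading term, `1/z` is compared with `1/(1 - e^{-z})`: the difference is regular near the
origin, and at the relevant points the second function is the scalar resolvent `(λ_j - e^{iz})⁻¹`
up to the factor `λ_j` (`Coin.InBand.leading_eq_add`). The Fourier transform of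
`χ (λ_j - e^{iz})⁻¹` is the trace of the local Fourier transform of the resolvent kernel
(`Coin.sum_locFT_resolv`), since `P_j` has rank one; its limit and asymptotics are therefore
known from the resolvent applied to point masses, and the regular remainder vanishes at infinity
by the Riemann–Lebesgue lemma (`Coin.InBand.isB0star_leading`).

Finally, the kernels of the two boundary values differ by a sum of two characters
(`Coin.InBand.Rb_sub`). Its coupling with `g` evaluates `ĝ` at the points of `M(θ)`, which is the
Parseval formula, and the adjoint of `𝓕₀(θ)` is a superposition of the same plane waves
(`Coin.eigenWave`).
-/

noncomputable section
namespace QW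

/-! ### Norms of sequences -/

/-- `𝓑(ℤ)` is continuously embedded in `ℓ¹`: apply the Cauchy–Schwarz inequality on every dyadic
shell, which has at most `2 r_j` points. -/
lemma sum_norm_le_Bnorm {f : ℤ → E} (hf : f ∈ BZ) : ∑' x, ‖f x‖ ≤ √2 * Bnorm f := by
  classical
  have hf' : Summable (Bterm f) := hf
  have hsh : ∀ j, ∑ x ∈ shell j, ‖f x‖ ≤ √2 * Bterm f j := by
    intro j
    have hr : (0 : ℝ) ≤ radius (j + 1) := by simp [radius]
    have hcs := sq_sum_le_card_mul_sum_sq (s := shell j) (f := fun x => ‖f x‖)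
    have hS : (0 : ℝ) ≤ ∑ x ∈ shell j, ‖f x‖ ^ 2 := by positivity
    unfold Bterm
    rw [← mul_assoc, ← Real.sqrt_mul (by norm_num), ← Real.sqrt_mul (by positivity)]
    exact Real.le_sqrt_of_sq_le (hcs.trans (mul_le_mul_of_nonneg_right (shell_card_le j) hS))
  refine (summable_norm_of_mem_BZ hf).tsum_le_of_sum_le fun s => ?_
  choose k hk using exists_shell
  calc ∑ x ∈ s, ‖f x‖
      = ∑ j ∈ s.image k, ∑ x ∈ s with k x = j, ‖f x‖ :=
        (Finset.sum_fiberwise_of_maps_to (fun x hx => Finset.mem_image_of_mem k hx) _).symm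
    _ ≤ ∑ j ∈ s.image k, ∑ x ∈ shell j, ‖f x‖ := by
        refine Finset.sum_le_sum fun j _ =>
          Finset.sum_le_sum_of_subset_of_nonneg ?_ fun _ _ _ => norm_nonneg _
        intro x hx
        rw [← (Finset.mem_filter.1 hx).2]
        exact hk x
    _ ≤ ∑ j ∈ s.image k, √2 * Bterm f j := Finset.sum_le_sum fun j _ => hsh j
    _ = √2 * ∑ j ∈ s.image k, Bterm f j := by rw [Finset.mul_sum]
    _ ≤ √2 * Bnorm f :=
        mul_le_mul_of_nonneg_left
          (Summable.sum_le_tsum _ (fun j _ => Bterm_nonneg f j) hf') (Real.sqrt_nonneg _)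

lemma Bnorm_nonneg (f : ℤ → E) : 0 ≤ Bnorm f := tsum_nonneg (Bterm_nonneg f)

/-- The ball `|x| < R` contains `2⌈R⌉ - 1 ≤ 3R` integers if `R > 1`, whence the constant. -/
lemma mean_le_of_bounded {u : ℤ → E} {B : ℝ} (hu : ∀ x, ‖u x‖ ≤ B) {R : ℝ} (hR : 1 < R) :
    mean u R ≤ 3 * B ^ 2 := by
  have h1 : ∑ x ∈ ball R, ‖u x‖ ^ 2 ≤ (ball R).card * B ^ 2 := by
    rw [← nsmul_eq_mul]
    exact Finset.sum_le_card_nsmul _ _ _ fun x _ => pow_le_pow_left₀ (norm_nonneg _) (hu x) 2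
  have h2 : ((ball R).card : ℝ) ≤ 3 * R := by
    have h3 : ((ball R).card : ℤ) = 2 * ⌈R⌉ - 1 := by
      have : (1 : ℤ) ≤ ⌈R⌉ := Int.one_le_ceil_iff.2 (by linarith)
      rw [ball, Int.card_Ioo]
      omega
    have h4 : ((ball R).card : ℝ) = 2 * ⌈R⌉ - 1 := by exact_mod_cast h3
    have h5 := Int.ceil_lt_add_one R
    rw [h4]; linarith
  unfold mean
  rw [inv_mul_le_iff₀ (by linarith)]
  calc _ ≤ (ball R).card * B ^ 2 := h1
    _ ≤ 3 * R * B ^ 2 := mul_le_mul_of_nonneg_right h2 (sq_nonneg B)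
    _ = _ := by ring

lemma mem_BstarZ_of_bounded {u : ℤ → E} {B : ℝ} (hu : ∀ x, ‖u x‖ ≤ B) : u ∈ BstarZ :=
  ⟨3 * B ^ 2, fun _ hR => mean_le_of_bounded hu hR⟩

/-- `ℓ^∞` is continuously embedded in `𝓑*(ℤ)`. -/
lemma BstarNorm_le_of_bounded {u : ℤ → E} {B : ℝ} (hu : ∀ x, ‖u x‖ ≤ B) :
    BstarNorm u ≤ √3 * B := by
  have hB : 0 ≤ B := (norm_nonneg (u 0)).trans (hu 0)
  have : Nonempty (Set.Ioi (1 : ℝ)) := ⟨⟨2, by norm_num⟩⟩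
  have h : (⨆ R : Set.Ioi (1 : ℝ), mean u R) ≤ 3 * B ^ 2 :=
    ciSup_le fun R => mean_le_of_bounded hu R.2
  calc BstarNorm u ≤ √(3 * B ^ 2) := Real.sqrt_le_sqrt h
    _ = √3 * B := by rw [Real.sqrt_mul (by norm_num), Real.sqrt_sq hB]

/-- The space `𝓑(ℤ)` contains the point masses. -/
lemma single_mem_BZ (e : E) : (Pi.single 0 e : ℤ → E) ∈ BZ := by
  refine summable_of_ne_finset_zero (s := {0}) fun j hj => ?_
  have hj' : j ≠ 0 := by simpa using hj
  obtain ⟨m, rfl⟩ := Nat.exists_eq_succ_of_ne_zero hj'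
  have : ∑ x ∈ shell (m + 1), ‖(Pi.single 0 e : ℤ → E) x‖ ^ 2 = 0 := by
    refine Finset.sum_eq_zero fun x hx => ?_
    have h1 : radius (m + 1) ≤ |(x : ℝ)| := (Finset.mem_filter.1 hx).2
    have hx0 : x ≠ 0 := by
      rintro rfl
      have : (0 : ℝ) < 2 ^ m := by positivity
      simp [radius] at h1
      linarith
    simp [Pi.single_eq_of_ne hx0]
  simp [Bterm, this]

lemma pair_summable {u g : ℤ → E} {B : ℝ} (hu : ∀ x, ‖u x‖ ≤ B) (hg : Summable fun x => ‖g x‖) :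
    Summable fun x => (inner ℂ (g x) (u x) : ℂ) := by
  refine Summable.of_norm_bounded (hg.mul_right B) fun x => ?_
  exact (norm_inner_le_norm _ _).trans (mul_le_mul_of_nonneg_left (hu x) (norm_nonneg _))

/-- Uniformly bounded pointwise convergence implies weak convergence against `ℓ¹`. -/
lemma tendsto_pair {ι : Type*} {l : Filter ι} {u : ι → ℤ → E} {u₀ g : ℤ → E} {B : ℝ}
    (hg : Summable fun x => ‖g x‖) (hB : ∀ᶠ i in l, ∀ x, ‖u i x‖ ≤ B)
    (hu : ∀ x, Tendsto (fun i => u i x) l (𝓝 (u₀ x))) :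
    Tendsto (fun i => pair (u i) g) l (𝓝 (pair u₀ g)) := by
  refine tendsto_tsum_of_dominated_convergence (bound := fun x => ‖g x‖ * B) (hg.mul_right B)
    (fun x => (tendsto_const_nhds.inner (hu x))) ?_
  filter_upwards [hB] with i hi x
  exact (norm_inner_le_norm _ _).trans (mul_le_mul_of_nonneg_left (hi x) (norm_nonneg _))

/-! ### The walk and its inverse -/

namespace Coin

variable (c : Coin)

/-- The phase `e^{iγ/2}`, a square root of `det C₀`. -/
def ph : ℂ := cexp (I * (c.γ / 2))

/-- The shift `α - γ/2` of the quasi-momentum. -/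
def sh : ℝ := c.α - c.γ / 2

/-- The phase `e^{i(α - γ/2)}`. -/
def ea : ℂ := cexp (I * c.sh)

/-- The phase `e^{-i(α - γ/2)}`. -/
def ea' : ℂ := cexp (-I * c.sh)

lemma ea_mul_ea' : c.ea * c.ea' = 1 := by
  rw [ea, ea', ← Complex.exp_add]; ring_nf; simp

lemma ph_ne_zero : c.ph ≠ 0 := Complex.exp_ne_zero _

lemma conj_exp_I_mul (x : ℝ) : (starRingEnd ℂ) (cexp (I * x)) = cexp (-I * x) := by
  rw [← Complex.exp_conj]; simp

lemma conj_exp_neg_I_mul (x : ℝ) : (starRingEnd ℂ) (cexp (-I * x)) = cexp (I * x) := by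
  rw [← Complex.exp_conj]; simp

lemma C0_unitary_left : c.C0.conjTranspose * c.C0 = 1 := by
  have h1 : (starRingEnd ℂ) (cexp (I * (c.γ / 2))) = cexp (-I * (c.γ / 2)) := by
    have := conj_exp_I_mul (c.γ / 2); push_cast at this; exact this
  have h2 : (starRingEnd ℂ) (cexp (I * (c.α - c.γ / 2))) = cexp (-I * (c.α - c.γ / 2)) := by
    have := conj_exp_I_mul (c.α - c.γ / 2); push_cast at this; exact this
  have h3 : (starRingEnd ℂ) (cexp (I * (c.β - c.γ / 2))) = cexp (-I * (c.β - c.γ / 2)) := by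
    have := conj_exp_I_mul (c.β - c.γ / 2); push_cast at this; exact this
  have h2' : (starRingEnd ℂ) (cexp (-I * (c.α - c.γ / 2))) = cexp (I * (c.α - c.γ / 2)) := by
    rw [← h2, Complex.conj_conj]
  have h3' : (starRingEnd ℂ) (cexp (-I * (c.β - c.γ / 2))) = cexp (I * (c.β - c.γ / 2)) := by
    rw [← h3, Complex.conj_conj]
  have e1 : cexp (I * (c.γ / 2)) * cexp (-I * (c.γ / 2)) = 1 := by
    rw [← Complex.exp_add]; ring_nf; simp
  have e2 : cexp (I * (c.α - c.γ / 2)) * cexp (-I * (c.α - c.γ / 2)) = 1 := by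
    rw [← Complex.exp_add]; ring_nf; simp
  have e3 : cexp (I * (c.β - c.γ / 2)) * cexp (-I * (c.β - c.γ / 2)) = 1 := by
    rw [← Complex.exp_add]; ring_nf; simp
  have hpq : (c.p : ℂ) ^ 2 + (c.q : ℂ) ^ 2 = 1 := by exact_mod_cast c.sq_add_sq
  ext i j
  fin_cases i <;> fin_cases j <;>
    simp only [C0, Matrix.mul_apply, Fin.sum_univ_two, Matrix.conjTranspose_apply,
      Matrix.smul_apply, Matrix.of_apply, Matrix.cons_val', Matrix.cons_val_zero,
      Matrix.cons_val_one, Matrix.cons_val_fin_one, smul_eq_mul, Matrix.one_apply,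
      RCLike.star_def, map_mul, map_neg, Complex.conj_ofReal, h1, h2, h3, h2', h3',
      Fin.zero_eta, Fin.mk_one, Fin.isValue, if_true, zero_ne_one, one_ne_zero, if_false]
  · linear_combination (c.p ^ 2 * (cexp (I * (c.α - c.γ / 2)) * cexp (-I * (c.α - c.γ / 2)))
      + c.q ^ 2 * (cexp (I * (c.β - c.γ / 2)) * cexp (-I * (c.β - c.γ / 2)))) * e1
      + c.p ^ 2 * e2 + c.q ^ 2 * e3 + hpq
  · ring
  · ring
  · linear_combination (c.p ^ 2 * (cexp (I * (c.α - c.γ / 2)) * cexp (-I * (c.α - c.γ / 2)))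
      + c.q ^ 2 * (cexp (I * (c.β - c.γ / 2)) * cexp (-I * (c.β - c.γ / 2)))) * e1
      + c.p ^ 2 * e2 + c.q ^ 2 * e3 + hpq

lemma C0_unitary_right : c.C0 * c.C0.conjTranspose = 1 :=
  mul_eq_one_comm.1 c.C0_unitary_left

lemma C1_eq : c.C1 = !![1, 0; 0, 0] * c.C0 := by
  ext i j; fin_cases i <;> fin_cases j <;> simp [C1, Matrix.mul_apply, Fin.sum_univ_two]

lemma C2_eq : c.C2 = !![0, 0; 0, 1] * c.C0 := by
  ext i j; fin_cases i <;> fin_cases j <;> simp [C2, Matrix.mul_apply, Fin.sum_univ_two]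

lemma C1_mul_C1_conj : c.C1 * c.C1.conjTranspose = !![1, 0; 0, 0] := by
  rw [C1_eq, Matrix.conjTranspose_mul, Matrix.mul_assoc, ← Matrix.mul_assoc c.C0,
    C0_unitary_right, Matrix.one_mul]
  ext i j; fin_cases i <;> fin_cases j <;> simp [Matrix.mul_apply, Fin.sum_univ_two]

lemma C2_mul_C2_conj : c.C2 * c.C2.conjTranspose = !![0, 0; 0, 1] := by
  rw [C2_eq, Matrix.conjTranspose_mul, Matrix.mul_assoc, ← Matrix.mul_assoc c.C0,
    C0_unitary_right, Matrix.one_mul]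
  ext i j; fin_cases i <;> fin_cases j <;> simp [Matrix.mul_apply, Fin.sum_univ_two]

lemma C1_mul_C2_conj : c.C1 * c.C2.conjTranspose = 0 := by
  rw [C1_eq, C2_eq, Matrix.conjTranspose_mul, Matrix.mul_assoc, ← Matrix.mul_assoc c.C0,
    C0_unitary_right, Matrix.one_mul]
  ext i j; fin_cases i <;> fin_cases j <;> simp [Matrix.mul_apply, Fin.sum_univ_two]

lemma C2_mul_C1_conj : c.C2 * c.C1.conjTranspose = 0 := by
  rw [C1_eq, C2_eq, Matrix.conjTranspose_mul, Matrix.mul_assoc, ← Matrix.mul_assoc c.C0,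
    C0_unitary_right, Matrix.one_mul]
  ext i j; fin_cases i <;> fin_cases j <;> simp [Matrix.mul_apply, Fin.sum_univ_two]

lemma C1_conj_mul_C2 : c.C1.conjTranspose * c.C2 = 0 := by
  rw [C1_eq, C2_eq, Matrix.conjTranspose_mul, Matrix.mul_assoc, ← Matrix.mul_assoc _ _ c.C0]
  have : (!![1, 0; 0, 0] : Matrix (Fin 2) (Fin 2) ℂ).conjTranspose * !![0, 0; 0, 1] = 0 := by
    ext i j; fin_cases i <;> fin_cases j <;> simp [Matrix.mul_apply, Fin.sum_univ_two]
  rw [this]; simp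

lemma C2_conj_mul_C1 : c.C2.conjTranspose * c.C1 = 0 := by
  have := congrArg Matrix.conjTranspose c.C1_conj_mul_C2
  simpa [Matrix.conjTranspose_mul] using this

lemma C_conj_mul_add : c.C1.conjTranspose * c.C1 + c.C2.conjTranspose * c.C2 = 1 := by
  have : (!![1, 0; 0, 0] : Matrix (Fin 2) (Fin 2) ℂ).conjTranspose * !![1, 0; 0, 0]
      + (!![0, 0; 0, 1] : Matrix (Fin 2) (Fin 2) ℂ).conjTranspose * !![0, 0; 0, 1] = 1 := by
    ext i j; fin_cases i <;> fin_cases j <;> simp [Matrix.mul_apply, Fin.sum_univ_two]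
  calc _ = c.C0.conjTranspose * ((!![1, 0; 0, 0] : Matrix (Fin 2) (Fin 2) ℂ).conjTranspose
      * !![1, 0; 0, 0] + (!![0, 0; 0, 1] : Matrix (Fin 2) (Fin 2) ℂ).conjTranspose
      * !![0, 0; 0, 1]) * c.C0 := by
        rw [C1_eq, C2_eq, Matrix.conjTranspose_mul, Matrix.conjTranspose_mul]
        noncomm_ring
    _ = 1 := by rw [this, Matrix.mul_one, C0_unitary_left]

lemma C_mul_conj_add : c.C1 * c.C1.conjTranspose + c.C2 * c.C2.conjTranspose = 1 := by
  rw [C1_mul_C1_conj, C2_mul_C2_conj]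
  ext i j; fin_cases i <;> fin_cases j <;> simp

lemma U0_apply (u : ℤ → E) (x : ℤ) : c.U0 u x = op c.C1 (u (x + 1)) + op c.C2 (u (x - 1)) := rfl

lemma U0star_apply (u : ℤ → E) (x : ℤ) :
    c.U0star u x = op c.C1.conjTranspose (u (x - 1)) + op c.C2.conjTranspose (u (x + 1)) := by
  ext i
  fin_cases i <;>
  simp [U0star, op, C1, C2, Matrix.mulVec, dotProduct, Fin.sum_univ_two]

lemma op_mul_apply (A B : Matrix (Fin 2) (Fin 2) ℂ) (v : E) : op A (op B v) = op (A * B) v := by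
  rw [op, op, op, map_mul]; rfl

lemma U0_U0star (u : ℤ → E) : c.U0 (c.U0star u) = u := by
  funext x
  simp only [U0_apply, U0star_apply, map_add, op_mul_apply, C1_mul_C2_conj, C2_mul_C1_conj,
    map_zero, _root_.zero_apply, add_zero, zero_add, add_sub_cancel_right,
    sub_add_cancel]
  rw [← _root_.add_apply, ← map_add, C_mul_conj_add, map_one]; rfl

lemma U0star_U0 (u : ℤ → E) : c.U0star (c.U0 u) = u := by
  funext x
  simp only [U0_apply, U0star_apply, map_add, op_mul_apply, C1_conj_mul_C2, C2_conj_mul_C1,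
    map_zero, _root_.zero_apply, add_zero, zero_add, add_sub_cancel_right,
    sub_add_cancel]
  rw [← _root_.add_apply, ← map_add, C_conj_mul_add, map_one]; rfl

lemma U0star_add (u v : ℤ → E) : c.U0star (u + v) = c.U0star u + c.U0star v := by
  funext x; simp only [U0star_apply, Pi.add_apply, map_add]; abel

lemma U0star_smul (a : ℂ) (u : ℤ → E) : c.U0star (a • u) = a • c.U0star u := by
  funext x; simp only [U0star_apply, Pi.smul_apply, map_smul, smul_add]

lemma conj_ph : (starRingEnd ℂ) c.ph = c.ph⁻¹ := by
  have := conj_exp_I_mul (c.γ / 2)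
  push_cast at this
  rw [ph, this, ← Complex.exp_neg, neg_mul]

/-- The coefficient of `u(x + 1)` in `U₀ u + e^{iγ} U₀* u` is scalar, since the cofactor matrix of
`C₀` is `e^{iγ} C₀*`. -/
lemma C1_add : c.C1 + c.ph ^ 2 • c.C2.conjTranspose = (c.ph * c.p * c.ea) • 1 := by
  have h0 := c.ph_ne_zero
  have h3 := conj_exp_neg_I_mul (c.β - c.γ / 2)
  have h2 := conj_exp_neg_I_mul (c.α - c.γ / 2)
  have hph : cexp (I * (c.γ / 2)) = c.ph := rfl
  have hea : c.ea = cexp (I * (c.α - c.γ / 2)) := by simp [ea, sh]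
  have hc := c.conj_ph
  push_cast at h2 h3
  rw [hea]
  ext i j
  fin_cases i <;> fin_cases j <;>
    simp only [C1, C2, C0, hph, Matrix.add_apply, Matrix.conjTranspose_apply,
      Matrix.smul_apply, Matrix.of_apply, Matrix.cons_val', Matrix.cons_val_zero,
      Matrix.cons_val_one, Matrix.cons_val_fin_one, smul_eq_mul, Matrix.one_apply,
      RCLike.star_def, map_mul, map_neg, map_zero, Complex.conj_ofReal, h2, h3, hc,
      Fin.zero_eta, Fin.mk_one, Fin.isValue, if_true, zero_ne_one, one_ne_zero, if_false] <;>
    field_simp <;> ring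

lemma C2_add : c.C2 + c.ph ^ 2 • c.C1.conjTranspose = (c.ph * c.p * c.ea') • 1 := by
  have h0 := c.ph_ne_zero
  have h3 := conj_exp_I_mul (c.β - c.γ / 2)
  have h2 := conj_exp_I_mul (c.α - c.γ / 2)
  have hph : cexp (I * (c.γ / 2)) = c.ph := rfl
  have hea : c.ea' = cexp (-I * (c.α - c.γ / 2)) := by simp [ea', sh]
  have hc := c.conj_ph
  push_cast at h2 h3
  rw [hea]
  ext i j
  fin_cases i <;> fin_cases j <;>
    simp only [C1, C2, C0, hph, Matrix.add_apply, Matrix.conjTranspose_apply,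
      Matrix.smul_apply, Matrix.of_apply, Matrix.cons_val', Matrix.cons_val_zero,
      Matrix.cons_val_one, Matrix.cons_val_fin_one, smul_eq_mul, Matrix.one_apply,
      RCLike.star_def, map_mul, map_zero, Complex.conj_ofReal, h2, h3, hc,
      Fin.zero_eta, Fin.mk_one, Fin.isValue, if_true, zero_ne_one, one_ne_zero, if_false] <;>
    field_simp <;> ring

lemma op_smul_one (a : ℂ) (v : E) : op (a • 1) v = a • v := by
  rw [op, map_smul, map_one]; rfl

/-- Cayley–Hamilton for the unitary multiplier `Û₀(ξ)`, written in the position variable: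
`U₀ + e^{iγ} U₀*` is a scalar Jacobi operator. -/
lemma U0_add_U0star (u : ℤ → E) (x : ℤ) :
    c.U0 u x + c.ph ^ 2 • c.U0star u x
      = (c.ph * c.p) • (c.ea • u (x + 1) + c.ea' • u (x - 1)) := by
  have h1 : ∀ v, op c.C1 v + c.ph ^ 2 • op c.C2.conjTranspose v = (c.ph * c.p * c.ea) • v := by
    intro v
    rw [← op_smul_one (c.ph * c.p * c.ea), ← C1_add, op, op, op, map_add, map_smul]; rfl
  have h2 : ∀ v, op c.C2 v + c.ph ^ 2 • op c.C1.conjTranspose v = (c.ph * c.p * c.ea') • v := by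
    intro v
    rw [← op_smul_one (c.ph * c.p * c.ea'), ← C2_add, op, op, op, map_add, map_smul]; rfl
  rw [U0_apply, U0star_apply, smul_add, smul_add, smul_smul, smul_smul, ← h1, ← h2]
  abel

end Coin

/-! ### Unitarity and the resolvent set -/

lemma opShift_apply (A : E →L[ℂ] E) (e : ℤ ≃ ℤ) (u : H) (x : ℤ) :
    (opShift A e u : ℤ → E) x = A ((u : ℤ → E) (e x)) := rfl

lemma adjoint_opShift (A : E →L[ℂ] E) (e : ℤ ≃ ℤ) :
    ContinuousLinearMap.adjoint (opShift A e)
      = opShift (ContinuousLinearMap.adjoint A) e.symm := by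
  symm
  rw [ContinuousLinearMap.eq_adjoint_iff]
  intro u v
  rw [lp.inner_eq_tsum, lp.inner_eq_tsum, ← e.tsum_eq]
  refine tsum_congr fun x => ?_
  rw [opShift_apply, opShift_apply, Equiv.symm_apply_apply,
    ContinuousLinearMap.adjoint_inner_left]

namespace Coin

variable (c : Coin)

/-- On `ℓ²` the Hilbert space adjoint is the formal adjoint. -/
lemma coe_star_U0H (u : H) : ((star c.U0H u : H) : ℤ → E) = c.U0star (u : ℤ → E) := by
  have h : star c.U0H = opShift (op c.C1.conjTranspose) (Equiv.addRight 1).symm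
      + opShift (op c.C2.conjTranspose) (Equiv.subRight 1).symm := by
    rw [ContinuousLinearMap.star_eq_adjoint, U0H, map_add, adjoint_opShift, adjoint_opShift,
      ← ContinuousLinearMap.star_eq_adjoint, ← ContinuousLinearMap.star_eq_adjoint]
    rw [← Matrix.star_eq_conjTranspose, ← Matrix.star_eq_conjTranspose, op, op, op, op,
      map_star, map_star]
  funext x
  rw [h, U0star_apply]
  rfl

lemma U0H_mem_unitary : c.U0H ∈ unitary (H →L[ℂ] H) := by
  rw [Unitary.mem_iff]
  constructor
  · ext1 u
    apply lp.ext
    change ((star c.U0H (c.U0H u) : H) : ℤ → E) = u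
    rw [coe_star_U0H, coe_U0H, U0star_U0]
  · ext1 u
    apply lp.ext
    change ((c.U0H (star c.U0H u) : H) : ℤ → E) = u
    rw [coe_U0H, coe_star_U0H, U0_U0star]

lemma norm_exp_I_mul (z : ℂ) : ‖cexp (I * z)‖ = Real.exp (-z.im) := by
  rw [Complex.norm_exp]; simp

/-- `U₀` is unitary on `ℓ²`, so its spectrum lies on the unit circle, which `e^{iz}` avoids. -/
lemma isUnit_U0H_sub {z : ℂ} (hz : z.im ≠ 0) :
    IsUnit (c.U0H - cexp (I * z) • (1 : H →L[ℂ] H)) := by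
  by_contra h
  have h1 : cexp (I * z) ∈ spectrum ℂ c.U0H := by
    rw [spectrum.mem_iff, ← IsUnit.neg_iff, Algebra.algebraMap_eq_smul_one, neg_sub]
    exact h
  have h2 := spectrum.subset_circle_of_unitary c.U0H_mem_unitary h1
  rw [mem_sphere_zero_iff_norm, norm_exp_I_mul, Real.exp_eq_one_iff] at h2
  exact hz (by linarith)

lemma R0_apply_eq {z : ℂ} (hz : z.im ≠ 0) {f u : H}
    (h : c.U0 (u : ℤ → E) - cexp (I * z) • (u : ℤ → E) = f) : c.R0 z f = u := by
  have h1 : (c.U0H - cexp (I * z) • (1 : H →L[ℂ] H)) u = f := by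
    apply lp.ext; rw [← h]; rfl
  rw [← h1, R0, ← mul_apply_eq_comp,
    Ring.inverse_mul_cancel _ (c.isUnit_U0H_sub hz)]
  rfl

/-! ### Green's function -/

/-- The scalar kernel `w^{|n|} e^{-i(α - γ/2)n}`. -/
def hker (w : ℂ) (n : ℤ) : ℂ := w ^ n.natAbs * cexp (-I * c.sh * n)

/-- The convolution of `f` with the scalar kernel `hker w`. -/
def green (w : ℂ) (f : ℤ → E) (x : ℤ) : E := ∑' y, c.hker w (x - y) • f y

/-- The function `N · (e^{iγ} U₀* - μ) (hker w * f)` with `N = (μ e^{iγ/2} p (w⁻¹ - w))⁻¹`. If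
`w + w⁻¹ = (e^{iγ} + μ²) / (μ e^{iγ/2} p)`, it is a solution `u` of `(U₀ - μ) u = f`. -/
def resolv (μ w : ℂ) (f : ℤ → E) : ℤ → E :=
  (μ * c.ph * c.p * (w⁻¹ - w))⁻¹ • (c.ph ^ 2 • c.U0star (c.green w f) - μ • c.green w f)

lemma norm_exp_sh (n : ℤ) : ‖cexp (-I * c.sh * n)‖ = 1 := by
  rw [show -I * (c.sh : ℂ) * n = ((-(c.sh * n) : ℝ) : ℂ) * I by push_cast; ring,
    Complex.norm_exp_ofReal_mul_I]

lemma norm_hker (w : ℂ) (n : ℤ) : ‖c.hker w n‖ = ‖w‖ ^ n.natAbs := by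
  rw [hker, norm_mul, norm_exp_sh, mul_one, norm_pow]

lemma norm_hker_le {w : ℂ} (hw : ‖w‖ ≤ 1) (n : ℤ) : ‖c.hker w n‖ ≤ 1 := by
  rw [norm_hker]; exact pow_le_one₀ (norm_nonneg _) hw

lemma norm_hker_smul_le {w : ℂ} (hw : ‖w‖ ≤ 1) (n : ℤ) (v : E) : ‖c.hker w n • v‖ ≤ ‖v‖ := by
  rw [norm_smul]; exact mul_le_of_le_one_left (norm_nonneg _) (c.norm_hker_le hw n)

variable {c} {f : ℤ → E}

lemma summable_green {w : ℂ} (hw : ‖w‖ ≤ 1) (hf : Summable fun x => ‖f x‖) (x : ℤ) :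
    Summable fun y => c.hker w (x - y) • f y :=
  Summable.of_norm_bounded hf fun _ => c.norm_hker_smul_le hw _ _

lemma norm_green_le {w : ℂ} (hw : ‖w‖ ≤ 1) (hf : Summable fun x => ‖f x‖) (x : ℤ) :
    ‖c.green w f x‖ ≤ ∑' y, ‖f y‖ :=
  tsum_of_norm_bounded hf.hasSum fun _ => c.norm_hker_smul_le hw _ _

/-- Up to the factor `w⁻¹ - w`, the kernel `hker w` is the Green's function of the scalar
three-term recurrence of `U0_add_U0star`. -/
lemma hker_rec {w : ℂ} (hw : w ≠ 0) (n : ℤ) :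
    (w + w⁻¹) * c.hker w n - c.ea * c.hker w (n + 1) - c.ea' * c.hker w (n - 1)
      = if n = 0 then w⁻¹ - w else 0 := by
  have e1 : c.ea * cexp (-I * c.sh * ((n + 1 : ℤ) : ℂ)) = cexp (-I * c.sh * n) := by
    rw [ea, ← Complex.exp_add]; push_cast; ring_nf
  have e2 : c.ea' * cexp (-I * c.sh * ((n - 1 : ℤ) : ℂ)) = cexp (-I * c.sh * n) := by
    rw [ea', ← Complex.exp_add]; push_cast; ring_nf
  have h : (w + w⁻¹) * c.hker w n - c.ea * c.hker w (n + 1) - c.ea' * c.hker w (n - 1)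
      = ((w + w⁻¹) * w ^ n.natAbs - w ^ (n + 1).natAbs - w ^ (n - 1).natAbs)
        * cexp (-I * c.sh * n) := by
    unfold hker
    linear_combination -(w ^ (n + 1).natAbs) * e1 - (w ^ (n - 1).natAbs) * e2
  rw [h]
  rcases lt_trichotomy n 0 with hn | rfl | hn
  · obtain ⟨m, hm⟩ : ∃ m : ℕ, n = -((m : ℤ) + 1) := ⟨(-n - 1).toNat, by omega⟩
    have h1 : n.natAbs = m + 1 := by omega
    have h2 : (n + 1).natAbs = m := by omega
    have h3 : (n - 1).natAbs = m + 2 := by omega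
    rw [h1, h2, h3, if_neg hn.ne]
    field_simp; ring
  · simp
  · obtain ⟨m, hm⟩ : ∃ m : ℕ, n = (m : ℤ) + 1 := ⟨(n - 1).toNat, by omega⟩
    have h1 : n.natAbs = m + 1 := by omega
    have h2 : (n - 1).natAbs = m := by omega
    have h3 : (n + 1).natAbs = m + 2 := by omega
    rw [h1, h2, h3, if_neg hn.ne']
    field_simp; ring

lemma green_rec {w : ℂ} (hw0 : w ≠ 0) (hw : ‖w‖ ≤ 1) (hf : Summable fun x => ‖f x‖) (x : ℤ) :
    (w + w⁻¹) • c.green w f x - (c.ea • c.green w f (x + 1) + c.ea' • c.green w f (x - 1))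
      = (w⁻¹ - w) • f x := by
  have h0 := ((summable_green (c := c) hw hf x).hasSum.const_smul (w + w⁻¹))
  have h1 := ((summable_green (c := c) hw hf (x + 1)).hasSum.const_smul c.ea)
  have h2 := ((summable_green (c := c) hw hf (x - 1)).hasSum.const_smul c.ea')
  refine (h0.sub (h1.add h2)).unique ?_
  have h3 : (fun y => (w + w⁻¹) • c.hker w (x - y) • f y
      - (c.ea • c.hker w (x + 1 - y) • f y + c.ea' • c.hker w (x - 1 - y) • f y))
      = fun y => if y = x then (w⁻¹ - w) • f x else 0 := by
    funext y
    have := c.hker_rec hw0 (x - y)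
    rw [show x + 1 - y = x - y + 1 by ring, show x - 1 - y = x - y - 1 by ring]
    rw [smul_smul, smul_smul, smul_smul, ← add_smul, ← sub_smul, ← sub_sub, this]
    by_cases hy : y = x
    · simp [hy]
    · rw [if_neg hy, if_neg (by omega), zero_smul]
  rw [h3]
  exact hasSum_ite_eq x _

/-- `resolv μ w f` solves `(U₀ - μ) u = f`. With `G = hker w * f`,
`(U₀ - μ)(e^{iγ} U₀* - μ) G = (e^{iγ} + μ²) G - μ (U₀ + e^{iγ} U₀*) G` by unitarity, and the right
side is a multiple of `f` by `U0_add_U0star` and `green_rec`. -/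
lemma resolv_eq {μ w : ℂ} (hμ : μ ≠ 0) (hw0 : w ≠ 0) (hw : ‖w‖ ≤ 1) (hw1 : w⁻¹ - w ≠ 0)
    (hμw : (w + w⁻¹) * (μ * c.ph * c.p) = c.ph ^ 2 + μ ^ 2) (hf : Summable fun x => ‖f x‖) :
    c.U0 (c.resolv μ w f) - μ • c.resolv μ w f = f := by
  have hN : μ * c.ph * c.p * (w⁻¹ - w) ≠ 0 :=
    mul_ne_zero (mul_ne_zero (mul_ne_zero hμ c.ph_ne_zero) c.p_ne_zero) hw1
  set G := c.green w f with hG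
  funext x
  have h1 : c.U0 (c.resolv μ w f) x
      = (μ * c.ph * c.p * (w⁻¹ - w))⁻¹ • (c.ph ^ 2 • G x - μ • c.U0 G x) := by
    rw [resolv, map_smul, map_sub, map_smul, map_smul, U0_U0star]; rfl
  have h2 := c.U0_add_U0star G x
  have h3 := green_rec (c := c) hw0 hw hf x
  rw [← hG] at h3
  rw [Pi.sub_apply, Pi.smul_apply, h1, resolv]
  simp only [Pi.smul_apply, Pi.sub_apply, ← hG]
  have h4 : (μ * c.ph * c.p) • ((w + w⁻¹) • G x) = (c.ph ^ 2 + μ ^ 2) • G x := by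
    rw [smul_smul, mul_comm, hμw]
  rw [smul_comm μ, ← smul_sub, inv_smul_eq_iff₀ hN, mul_smul, ← h3, smul_sub _ ((w + w⁻¹) • G x),
    h4, mul_assoc, mul_smul μ (c.ph * c.p), ← h2]
  module

/-- The formal adjoint `U₀*` is bounded on `ℓ^∞`. -/
lemma norm_U0star_le {u : ℤ → E} {B : ℝ} (hu : ∀ x, ‖u x‖ ≤ B) (x : ℤ) :
    ‖c.U0star u x‖ ≤ (‖op c.C1.conjTranspose‖ + ‖op c.C2.conjTranspose‖) * B := by
  rw [U0star_apply, add_mul]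
  refine (norm_add_le _ _).trans (add_le_add ?_ ?_)
  · exact (ContinuousLinearMap.le_opNorm _ _).trans
      (mul_le_mul_of_nonneg_left (hu _) (norm_nonneg _))
  · exact (ContinuousLinearMap.le_opNorm _ _).trans
      (mul_le_mul_of_nonneg_left (hu _) (norm_nonneg _))

variable (c) in
/-- The constant in the bound of `resolv μ w f` by the `ℓ¹` norm of `f`. -/
def resolvBound (μ w : ℂ) : ℝ :=
  ‖(μ * c.ph * c.p * (w⁻¹ - w))⁻¹‖ *
    (‖c.ph ^ 2‖ * (‖op c.C1.conjTranspose‖ + ‖op c.C2.conjTranspose‖) + ‖μ‖)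

lemma norm_resolv_le {μ w : ℂ} (hw : ‖w‖ ≤ 1) (hf : Summable fun x => ‖f x‖) (x : ℤ) :
    ‖c.resolv μ w f x‖ ≤ c.resolvBound μ w * ∑' y, ‖f y‖ := by
  have hg := norm_green_le (c := c) hw hf
  rw [resolv, resolvBound]
  simp only [Pi.smul_apply, Pi.sub_apply]
  rw [norm_smul, mul_assoc ‖_‖, add_mul]
  refine mul_le_mul_of_nonneg_left ?_ (norm_nonneg _)
  refine (norm_sub_le _ _).trans (add_le_add ?_ ?_)
  · rw [norm_smul, mul_assoc]
    exact mul_le_mul_of_nonneg_left (norm_U0star_le hg x) (norm_nonneg _)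
  · rw [norm_smul]
    exact mul_le_mul_of_nonneg_left (hg x) (norm_nonneg _)

lemma green_add {w : ℂ} (hw : ‖w‖ ≤ 1) {f g : ℤ → E} (hf : Summable fun x => ‖f x‖)
    (hg : Summable fun x => ‖g x‖) : c.green w (f + g) = c.green w f + c.green w g := by
  funext x
  simp only [green, Pi.add_apply, smul_add]
  exact (summable_green hw hf x).tsum_add (summable_green hw hg x)

lemma green_smul {w : ℂ} (a : ℂ) (f : ℤ → E) : c.green w (a • f) = a • c.green w f := by
  funext x
  simp only [green, Pi.smul_apply]
  rw [← tsum_const_smul'' a]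
  simp only [smul_comm a]

lemma resolv_add {μ w : ℂ} (hw : ‖w‖ ≤ 1) {f g : ℤ → E} (hf : Summable fun x => ‖f x‖)
    (hg : Summable fun x => ‖g x‖) :
    c.resolv μ w (f + g) = c.resolv μ w f + c.resolv μ w g := by
  rw [resolv, resolv, resolv, green_add hw hf hg, U0star_add]
  module

lemma resolv_smul {μ w : ℂ} (a : ℂ) (f : ℤ → E) :
    c.resolv μ w (a • f) = a • c.resolv μ w f := by
  rw [resolv, resolv, green_smul, U0star_smul]
  module

/-- For `‖w‖ < 1` the kernel is summable, so that `resolv μ w` maps `ℓ¹` to itself. -/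
lemma summable_norm_green {w : ℂ} (hw : ‖w‖ < 1) (hf : Summable fun x => ‖f x‖) :
    Summable fun x => ‖c.green w f x‖ := by
  have hk : Summable fun n : ℤ => ‖w‖ ^ n.natAbs := by
    have hg := summable_geometric_of_lt_one (norm_nonneg w) hw
    refine Summable.of_nat_of_neg ?_ ?_ <;> simpa using hg
  have h1 : Summable fun q : ℤ × ℤ => ‖w‖ ^ q.1.natAbs * ‖f q.2‖ :=
    hk.mul_of_nonneg hf (fun _ => by positivity) fun _ => norm_nonneg _
  let e : ℤ × ℤ ≃ ℤ × ℤ :=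
    { toFun := fun q => (q.1 - q.2, q.2)
      invFun := fun q => (q.1 + q.2, q.2)
      left_inv := fun q => by simp
      right_inv := fun q => by simp }
  have h2 : Summable fun q : ℤ × ℤ => ‖w‖ ^ (q.1 - q.2).natAbs * ‖f q.2‖ :=
    (e.summable_iff (f := fun q : ℤ × ℤ => ‖w‖ ^ q.1.natAbs * ‖f q.2‖)).2 h1
  have h3 := h2.prod
  refine Summable.of_nonneg_of_le (fun _ => norm_nonneg _) (fun x => ?_) h3
  have h4 := h2.prod_factor x
  refine tsum_of_norm_bounded h4.hasSum fun y => ?_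
  rw [norm_smul, norm_hker]

lemma summable_norm_U0star {u : ℤ → E} (hu : Summable fun x => ‖u x‖) :
    Summable fun x => ‖c.U0star u x‖ := by
  have h1 : Summable fun x : ℤ => ‖u (x - 1)‖ :=
    ((Equiv.subRight (1 : ℤ)).summable_iff (f := fun x => ‖u x‖)).2 hu
  have h2 : Summable fun x : ℤ => ‖u (x + 1)‖ :=
    ((Equiv.addRight (1 : ℤ)).summable_iff (f := fun x => ‖u x‖)).2 hu
  refine Summable.of_nonneg_of_le (fun _ => norm_nonneg _) (fun x => ?_)
    ((h1.mul_left ‖op c.C1.conjTranspose‖).add (h2.mul_left ‖op c.C2.conjTranspose‖))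
  rw [U0star_apply]
  exact (norm_add_le _ _).trans
    (add_le_add (ContinuousLinearMap.le_opNorm _ _) (ContinuousLinearMap.le_opNorm _ _))

lemma summable_norm_resolv {μ w : ℂ} (hw : ‖w‖ < 1) (hf : Summable fun x => ‖f x‖) :
    Summable fun x => ‖c.resolv μ w f x‖ := by
  have hg := summable_norm_green (c := c) hw hf
  refine Summable.of_nonneg_of_le (fun _ => norm_nonneg _) (fun x => ?_)
    ((((summable_norm_U0star (c := c) hg).mul_left ‖c.ph ^ 2‖).add (hg.mul_left ‖μ‖)).mul_left
      ‖(μ * c.ph * c.p * (w⁻¹ - w))⁻¹‖)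
  rw [resolv]
  simp only [Pi.smul_apply, Pi.sub_apply]
  rw [norm_smul]
  refine mul_le_mul_of_nonneg_left ?_ (norm_nonneg _)
  exact (norm_sub_le _ _).trans (by rw [norm_smul, norm_smul])

/-- Off the real axis `resolv` is the resolvent. -/
lemma R0_toH {z w : ℂ} (hz : z.im ≠ 0) (hw0 : w ≠ 0) (hw : ‖w‖ < 1)
    (hμw : (w + w⁻¹) * (cexp (I * z) * c.ph * c.p) = c.ph ^ 2 + cexp (I * z) ^ 2) (f : BZ) :
    ((c.R0 z (BZ.toH f) : H) : ℤ → E) = c.resolv (cexp (I * z)) w f := by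
  have hf := summable_norm_of_mem_BZ f.2
  have hw1 : w⁻¹ - w ≠ 0 := by
    intro h
    have h1 : w * w = 1 := by
      field_simp at h
      linear_combination -h
    have h2 : ‖w‖ * ‖w‖ = 1 := by rw [← norm_mul, h1, norm_one]
    nlinarith [norm_nonneg w]
  have hu : Memℓp (c.resolv (cexp (I * z)) w f) 2 := by
    have h1 : Memℓp (c.resolv (cexp (I * z)) w f) 1 :=
      memℓp_gen (by simpa using summable_norm_resolv (c := c) hw hf)
    exact h1.of_exponent_ge (by norm_num)
  obtain ⟨u, hu'⟩ : ∃ u : H, (u : ℤ → E) = c.resolv (cexp (I * z)) w f := ⟨⟨_, hu⟩, rfl⟩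
  have hfc : ((BZ.toH f : H) : ℤ → E) = f := rfl
  have h := c.R0_apply_eq hz (f := BZ.toH f) (u := u) (by
    rw [hu', hfc]
    exact resolv_eq (Complex.exp_ne_zero _) hw0 hw.le hw1 hμw hf)
  rw [h, hu']

/-- Continuity of `resolv` in its parameters. -/
lemma tendsto_resolv {ι : Type*} {l : Filter ι} {μ w : ι → ℂ} {μ₀ w₀ : ℂ}
    (hμ : Tendsto μ l (𝓝 μ₀)) (hw : Tendsto w l (𝓝 w₀)) (hμ₀ : μ₀ ≠ 0) (hw₀ : w₀ ≠ 0)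
    (hw₁ : w₀⁻¹ - w₀ ≠ 0) (hle : ∀ᶠ i in l, ‖w i‖ ≤ 1) (hf : Summable fun x => ‖f x‖) (x : ℤ) :
    Tendsto (fun i => c.resolv (μ i) (w i) f x) l (𝓝 (c.resolv μ₀ w₀ f x)) := by
  have hg : ∀ x, Tendsto (fun i => c.green (w i) f x) l (𝓝 (c.green w₀ f x)) := by
    intro x
    refine tendsto_tsum_of_dominated_convergence hf (fun y => ?_) ?_
    · simp only [hker]
      exact Tendsto.smul_const ((hw.pow _).mul_const _) _
    · filter_upwards [hle] with i hi y
      exact c.norm_hker_smul_le hi _ _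
  have hs : Tendsto (fun i => c.U0star (c.green (w i) f) x) l
      (𝓝 (c.U0star (c.green w₀ f) x)) := by
    simp only [U0star_apply]
    exact (((op c.C1.conjTranspose).continuous.tendsto _).comp (hg _)).add
      (((op c.C2.conjTranspose).continuous.tendsto _).comp (hg _))
  have hN : μ₀ * c.ph * c.p * (w₀⁻¹ - w₀) ≠ 0 :=
    mul_ne_zero (mul_ne_zero (mul_ne_zero hμ₀ c.ph_ne_zero) c.p_ne_zero) hw₁
  have h1 : Tendsto (fun i => (μ i * c.ph * c.p * ((w i)⁻¹ - w i))⁻¹) l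
      (𝓝 (μ₀ * c.ph * c.p * (w₀⁻¹ - w₀))⁻¹) :=
    (((hμ.mul_const _).mul_const _).mul ((hw.inv₀ hw₀).sub hw)).inv₀ hN
  have h2 := h1.smul ((hs.const_smul (c.ph ^ 2)).sub (hμ.smul (hg x)))
  simpa only [resolv, Pi.smul_apply, Pi.sub_apply] using h2

lemma tendsto_resolvBound {ι : Type*} {l : Filter ι} {μ w : ι → ℂ} {μ₀ w₀ : ℂ}
    (hμ : Tendsto μ l (𝓝 μ₀)) (hw : Tendsto w l (𝓝 w₀)) (hμ₀ : μ₀ ≠ 0) (hw₀ : w₀ ≠ 0)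
    (hw₁ : w₀⁻¹ - w₀ ≠ 0) :
    Tendsto (fun i => c.resolvBound (μ i) (w i)) l (𝓝 (c.resolvBound μ₀ w₀)) := by
  have hN : μ₀ * c.ph * c.p * (w₀⁻¹ - w₀) ≠ 0 :=
    mul_ne_zero (mul_ne_zero (mul_ne_zero hμ₀ c.ph_ne_zero) c.p_ne_zero) hw₁
  have h1 : Tendsto (fun i => (μ i * c.ph * c.p * ((w i)⁻¹ - w i))⁻¹) l
      (𝓝 (μ₀ * c.ph * c.p * (w₀⁻¹ - w₀))⁻¹) :=
    (((hμ.mul_const _).mul_const _).mul ((hw.inv₀ hw₀).sub hw)).inv₀ hN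
  exact h1.norm.mul (tendsto_const_nhds.add hμ.norm)

/-- `resolv` is bounded uniformly along convergent families of parameters. -/
lemma eventually_norm_resolv_le {ι : Type*} {l : Filter ι} {μ w : ι → ℂ} {μ₀ w₀ : ℂ}
    (hμ : Tendsto μ l (𝓝 μ₀)) (hw : Tendsto w l (𝓝 w₀)) (hμ₀ : μ₀ ≠ 0) (hw₀ : w₀ ≠ 0)
    (hw₁ : w₀⁻¹ - w₀ ≠ 0) (hle : ∀ᶠ i in l, ‖w i‖ ≤ 1) (hf : Summable fun x => ‖f x‖) :
    ∀ᶠ i in l, ∀ x, ‖c.resolv (μ i) (w i) f x‖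
      ≤ (c.resolvBound μ₀ w₀ + 1) * ∑' y, ‖f y‖ := by
  filter_upwards [hle, (tendsto_resolvBound (c := c) hμ hw hμ₀ hw₀ hw₁).eventually
    (gt_mem_nhds (lt_add_one _))] with i hi hb x
  exact (norm_resolv_le hi hf x).trans
    (mul_le_mul_of_nonneg_right hb.le (tsum_nonneg fun _ => norm_nonneg _))

end Coin

/-! ### Spectral decomposition of the multiplier -/

namespace Coin

variable (c : Coin)

lemma Uhat_eq (ξ : ℝ) : c.Uhat ξ = cexp (I * ξ) • c.C1 + cexp (-I * ξ) • c.C2 := by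
  ext i j
  fin_cases i <;> fin_cases j <;> simp [Uhat, C1, C2, C0] <;> ring

lemma op_Uhat_eq (ξ : ℝ) :
    op (c.Uhat ξ) = cexp (I * ξ) • op c.C1 + cexp (-I * ξ) • op c.C2 := by
  rw [Uhat_eq, op, map_add, map_smul, map_smul]

lemma op_Uhat_apply (ξ : ℝ) (v : E) :
    op (c.Uhat ξ) v = cexp (I * ξ) • op c.C1 v + cexp (-I * ξ) • op c.C2 v := by
  rw [op_Uhat_eq]; rfl

lemma Uhat_conj (ξ : ℝ) : (c.Uhat ξ).conjTranspose
    = cexp (-I * ξ) • c.C1.conjTranspose + cexp (I * ξ) • c.C2.conjTranspose := by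
  rw [Uhat_eq, Matrix.conjTranspose_add, Matrix.conjTranspose_smul, Matrix.conjTranspose_smul,
    RCLike.star_def, conj_exp_I_mul, conj_exp_neg_I_mul]

lemma op_Uhat_conj_apply (ξ : ℝ) (v : E) : op (c.Uhat ξ).conjTranspose v
    = cexp (-I * ξ) • op c.C1.conjTranspose v + cexp (I * ξ) • op c.C2.conjTranspose v := by
  rw [Uhat_conj, op, map_add, map_smul, map_smul]; rfl

lemma exp_mul_exp_neg (ξ : ℝ) : cexp (I * ξ) * cexp (-I * ξ) = 1 := by
  rw [← Complex.exp_add]; ring_nf; simp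

lemma exp_neg_mul_exp (ξ : ℝ) : cexp (-I * ξ) * cexp (I * ξ) = 1 := by
  rw [← Complex.exp_add]; ring_nf; simp

lemma Uhat_conj_mul (ξ : ℝ) : (c.Uhat ξ).conjTranspose * c.Uhat ξ = 1 := by
  rw [Uhat_conj, Uhat_eq]
  simp only [Matrix.add_mul, Matrix.mul_add, Matrix.smul_mul, Matrix.mul_smul, C1_conj_mul_C2,
    C2_conj_mul_C1, smul_zero, add_zero, zero_add, smul_smul, exp_neg_mul_exp, exp_mul_exp_neg,
    one_smul, C_conj_mul_add]

lemma op_conj_op_Uhat (ξ : ℝ) (v : E) :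
    op (c.Uhat ξ).conjTranspose (op (c.Uhat ξ) v) = v := by
  rw [op_mul_apply, Uhat_conj_mul, op, map_one]; rfl

lemma inner_op_Uhat (ξ : ℝ) (v w : E) :
    inner ℂ (op (c.Uhat ξ) v) (op (c.Uhat ξ) w) = inner ℂ v w := by
  have h : op (c.Uhat ξ).conjTranspose = ContinuousLinearMap.adjoint (op (c.Uhat ξ)) := by
    rw [← ContinuousLinearMap.star_eq_adjoint, ← Matrix.star_eq_conjTranspose, op, op, map_star]
  conv_rhs => rw [← c.op_conj_op_Uhat ξ w, h, ContinuousLinearMap.adjoint_inner_right]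

lemma cos_acs (ξ : ℝ) : Real.cos (c.acs ξ) = c.p * Real.cos (ξ + c.sh) := by
  have h1 := Real.abs_cos_le_one (ξ + c.sh)
  have h2 : |c.p * Real.cos (ξ + c.sh)| ≤ 1 := by
    rw [abs_mul, abs_of_pos c.p_pos]
    nlinarith [c.p_pos, c.p_le_one, abs_nonneg (Real.cos (ξ + c.sh))]
  rw [abs_le] at h2
  rw [acs, show ξ + c.α - c.γ / 2 = ξ + c.sh by rw [sh]; ring]
  exact Real.cos_arccos h2.1 h2.2

lemma lam_zero (ξ : ℝ) : c.lam 0 ξ = c.ph * cexp (I * c.acs ξ) := by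
  rw [ph, ← Complex.exp_add, lam]; congr 1; ring

lemma lam_one (ξ : ℝ) : c.lam 1 ξ = c.ph * cexp (-I * c.acs ξ) := by
  rw [ph, ← Complex.exp_add, lam]; congr 1; ring

lemma lam_ne_zero (j : Fin 2) (ξ : ℝ) : c.lam j ξ ≠ 0 := by
  fin_cases j <;> exact Complex.exp_ne_zero _

lemma norm_lam (j : Fin 2) (ξ : ℝ) : ‖c.lam j ξ‖ = 1 := by
  fin_cases j
  · change ‖cexp (I * (c.γ / 2 + c.acs ξ))‖ = 1
    rw [show I * ((c.γ : ℂ) / 2 + c.acs ξ) = ((c.γ / 2 + c.acs ξ : ℝ) : ℂ) * I by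
      push_cast; ring, Complex.norm_exp_ofReal_mul_I]
  · change ‖cexp (I * (c.γ - (c.γ / 2 + c.acs ξ)))‖ = 1
    rw [show I * ((c.γ : ℂ) - (c.γ / 2 + c.acs ξ)) = ((c.γ - (c.γ / 2 + c.acs ξ) : ℝ) : ℂ) * I by
      push_cast; ring, Complex.norm_exp_ofReal_mul_I]

lemma exp_add_exp (x : ℝ) : cexp (I * x) + cexp (-I * x) = 2 * (Real.cos x : ℂ) := by
  rw [Complex.ofReal_cos, Complex.two_cos]; ring_nf

lemma exp_sub_exp (x : ℝ) : cexp (I * x) - cexp (-I * x) = 2 * I * (Real.sin x : ℂ) := by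
  have h := Complex.two_sin (x : ℂ)
  rw [Complex.ofReal_sin, mul_comm 2 I, mul_assoc, h]
  ring_nf
  simp [Complex.I_sq]
  ring

lemma trace_eq (ξ : ℝ) :
    c.ea * cexp (I * ξ) + c.ea' * cexp (-I * ξ) = 2 * (Real.cos (ξ + c.sh) : ℂ) := by
  rw [← exp_add_exp, ea, ea', ← Complex.exp_add, ← Complex.exp_add]
  push_cast; ring_nf

lemma lam_add (ξ : ℝ) : c.lam 0 ξ + c.lam 1 ξ = 2 * c.ph * c.p * Real.cos (ξ + c.sh) := by
  rw [lam_zero, lam_one, ← mul_add, exp_add_exp, cos_acs]; push_cast; ring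

lemma lam_mul (ξ : ℝ) : c.lam 0 ξ * c.lam 1 ξ = c.ph ^ 2 := by
  rw [lam_zero, lam_one]
  linear_combination c.ph ^ 2 * exp_mul_exp_neg (c.acs ξ)

lemma lam_sub (ξ : ℝ) : c.lam 0 ξ - c.lam 1 ξ = 2 * I * c.ph * Real.sin (c.acs ξ) := by
  rw [lam_zero, lam_one, ← mul_sub, exp_sub_exp]; ring

/-- `lam_add` for either order of the two eigenvalues: `j + 1` is the other index of `Fin 2`. -/
lemma lam_add' (j : Fin 2) (ξ : ℝ) :
    c.lam j ξ + c.lam (j + 1) ξ = 2 * c.ph * c.p * Real.cos (ξ + c.sh) := by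
  rw [← lam_add]; fin_cases j
  · rfl
  · exact add_comm _ _

lemma lam_mul' (j : Fin 2) (ξ : ℝ) : c.lam j ξ * c.lam (j + 1) ξ = c.ph ^ 2 := by
  rw [← c.lam_mul ξ]; fin_cases j
  · rfl
  · exact mul_comm _ _

/-- `Û₀(ξ) + e^{iγ} Û₀(ξ)* = tr Û₀(ξ)`, which is Cayley–Hamilton for a unitary matrix. -/
lemma ph_sq_op_conj (j : Fin 2) (ξ : ℝ) (v : E) :
    c.ph ^ 2 • op (c.Uhat ξ).conjTranspose v
      = (c.lam j ξ + c.lam (j + 1) ξ) • v - op (c.Uhat ξ) v := by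
  have h : c.Uhat ξ + c.ph ^ 2 • (c.Uhat ξ).conjTranspose
      = (c.lam j ξ + c.lam (j + 1) ξ) • 1 := by
    have h1 : c.lam j ξ + c.lam (j + 1) ξ
        = cexp (I * ξ) * (c.ph * c.p * c.ea) + cexp (-I * ξ) * (c.ph * c.p * c.ea') := by
      rw [lam_add']; linear_combination -(c.ph * c.p) * c.trace_eq ξ
    rw [h1, Uhat_conj, Uhat_eq, add_smul, mul_smul, mul_smul (cexp (-I * ξ)), ← C1_add, ← C2_add]
    module
  rw [eq_sub_iff_add_eq', ← op_smul_one (c.lam j ξ + c.lam (j + 1) ξ), ← h, op, op, op, map_add,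
    map_smul]
  rfl

lemma op_Uhat_sq (j : Fin 2) (ξ : ℝ) (v : E) :
    op (c.Uhat ξ) (op (c.Uhat ξ) v)
      = (c.lam j ξ + c.lam (j + 1) ξ) • op (c.Uhat ξ) v - (c.lam j ξ * c.lam (j + 1) ξ) • v := by
  have h := c.ph_sq_op_conj j ξ (op (c.Uhat ξ) v)
  rw [op_conj_op_Uhat] at h
  rw [lam_mul', h]; abel

lemma mem_eig {j : Fin 2} {ξ : ℝ} {v : E} :
    v ∈ c.eig j ξ ↔ op (c.Uhat ξ) v = c.lam j ξ • v := by
  rw [eig, Module.End.mem_eigenspace_iff]; rfl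

lemma lam_ne {j : Fin 2} {ξ : ℝ} (h : ξ ∈ c.regular) : c.lam j ξ ≠ c.lam (j + 1) ξ := by
  fin_cases j
  · exact h
  · exact fun h' => h h'.symm

lemma inner_eq_zero_of_eig {j : Fin 2} {ξ : ℝ} (hξ : ξ ∈ c.regular) {v w : E}
    (hv : op (c.Uhat ξ) v = c.lam (j + 1) ξ • v) (hw : op (c.Uhat ξ) w = c.lam j ξ • w) :
    (inner ℂ v w : ℂ) = 0 := by
  have h := c.inner_op_Uhat ξ v w
  rw [hv, hw, inner_smul_left, inner_smul_right] at h
  have h1 : c.lam (j + 1) ξ * (starRingEnd ℂ) (c.lam (j + 1) ξ) = 1 := by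
    rw [Complex.mul_conj, Complex.normSq_eq_norm_sq, norm_lam]; simp
  by_contra h0
  have h2 : (starRingEnd ℂ) (c.lam (j + 1) ξ) * c.lam j ξ = 1 := by
    apply mul_right_cancel₀ h0
    rw [mul_assoc, h, one_mul]
  apply c.lam_ne (j := j) hξ
  linear_combination c.lam (j + 1) ξ * h2 - c.lam j ξ * h1

/-- At a regular point the projection is a polynomial in `Û₀(ξ)`. -/
lemma P_apply (j : Fin 2) {ξ : ℝ} (hξ : ξ ∈ c.regular) (v : E) :
    c.P j ξ v
      = (c.lam j ξ - c.lam (j + 1) ξ)⁻¹ • (op (c.Uhat ξ) v - c.lam (j + 1) ξ • v) := by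
  have hne : c.lam j ξ - c.lam (j + 1) ξ ≠ 0 := sub_ne_zero.2 (c.lam_ne hξ)
  have hsq := c.op_Uhat_sq j ξ v
  refine Submodule.eq_starProjection_of_mem_of_inner_eq_zero ?_ fun w hw => ?_
  · rw [mem_eig, map_smul, map_sub, map_smul, hsq]
    module
  · refine c.inner_eq_zero_of_eig (j := j) hξ ?_ (c.mem_eig.1 hw)
    have h1 : v = (c.lam j ξ - c.lam (j + 1) ξ)⁻¹ • ((c.lam j ξ - c.lam (j + 1) ξ) • v) := by
      rw [inv_smul_smul₀ hne]
    have h2 : v - (c.lam j ξ - c.lam (j + 1) ξ)⁻¹ • (op (c.Uhat ξ) v - c.lam (j + 1) ξ • v)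
        = (c.lam j ξ - c.lam (j + 1) ξ)⁻¹ • (c.lam j ξ • v - op (c.Uhat ξ) v) := by
      nth_rw 1 [h1]
      module
    rw [h2, map_smul, map_sub, map_smul, hsq]
    module

lemma op_Uhat_P (j : Fin 2) (ξ : ℝ) (v : E) :
    op (c.Uhat ξ) (c.P j ξ v) = c.lam j ξ • c.P j ξ v :=
  c.mem_eig.1 (Submodule.starProjection_apply_mem _ v)

lemma P_op_Uhat (j : Fin 2) {ξ : ℝ} (hξ : ξ ∈ c.regular) (v : E) :
    c.P j ξ (op (c.Uhat ξ) v) = c.lam j ξ • c.P j ξ v := by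
  rw [← op_Uhat_P, P_apply c j hξ, P_apply c j hξ, map_smul, map_sub, map_smul]

lemma P_eq_self {j : Fin 2} {ξ : ℝ} {v : E} (hv : op (c.Uhat ξ) v = c.lam j ξ • v) :
    c.P j ξ v = v :=
  Submodule.starProjection_eq_self_iff.2 (c.mem_eig.2 hv)

lemma P_eq_zero {j : Fin 2} {ξ : ℝ} (hξ : ξ ∈ c.regular) {v : E}
    (hv : op (c.Uhat ξ) v = c.lam (j + 1) ξ • v) : c.P j ξ v = 0 := by
  rw [P_apply c j hξ, hv, sub_self, smul_zero]

lemma P_P (j : Fin 2) (ξ : ℝ) (v : E) : c.P j ξ (c.P j ξ v) = c.P j ξ v :=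
  c.P_eq_self (c.op_Uhat_P j ξ v)

lemma P_P_other {i j : Fin 2} (hij : i ≠ j) {ξ : ℝ} (hξ : ξ ∈ c.regular) (v : E) :
    c.P i ξ (c.P j ξ v) = 0 := by
  have : j = i + 1 := by omega
  subst this
  exact c.P_eq_zero hξ (c.op_Uhat_P _ ξ v)

/-- The projections have rank one. The trace turns the matrix-valued local Fourier transform of the
resolvent kernel into a scalar one. -/
lemma trace_P (j : Fin 2) {ξ : ℝ} (hξ : ξ ∈ c.regular) :
    ∑ i : Fin 2, c.P j ξ (EuclideanSpace.single i 1) i = 1 := by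
  have hne : c.lam j ξ - c.lam (j + 1) ξ ≠ 0 := sub_ne_zero.2 (c.lam_ne hξ)
  have h : ∀ i : Fin 2, c.P j ξ (EuclideanSpace.single i 1) i
      = (c.lam j ξ - c.lam (j + 1) ξ)⁻¹ * (c.Uhat ξ i i - c.lam (j + 1) ξ) := by
    intro i
    rw [P_apply c j hξ]
    fin_cases i <;> simp [op]
  have ht : c.Uhat ξ 0 0 + c.Uhat ξ 1 1 = c.lam j ξ + c.lam (j + 1) ξ := by
    rw [lam_add', mul_assoc (2 * c.ph), mul_comm 2, mul_assoc, mul_left_comm 2, ← trace_eq]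
    have e1 : c.ea = cexp (I * (c.α - c.γ / 2)) := by simp [ea, sh]
    have e2 : c.ea' = cexp (-I * (c.α - c.γ / 2)) := by simp [ea', sh]
    rw [e1, e2]
    simp [Uhat, ph]
    ring
  rw [Fin.sum_univ_two, h, h, ← mul_add, inv_mul_eq_one₀ hne]
  linear_combination -ht

/-! ### Periodicity and smoothness -/

lemma exp_I_add_two_pi (ξ : ℝ) (n : ℤ) :
    cexp (I * ((ξ + 2 * Real.pi * n : ℝ) : ℂ)) = cexp (I * ξ) := by
  rw [Complex.exp_eq_exp_iff_exists_int]
  exact ⟨n, by push_cast; ring⟩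

lemma exp_neg_I_add_two_pi (ξ : ℝ) (n : ℤ) :
    cexp (-I * ((ξ + 2 * Real.pi * n : ℝ) : ℂ)) = cexp (-I * ξ) := by
  rw [Complex.exp_eq_exp_iff_exists_int]
  exact ⟨-n, by push_cast; ring⟩

lemma Uhat_periodic (ξ : ℝ) (n : ℤ) : c.Uhat (ξ + 2 * Real.pi * n) = c.Uhat ξ := by
  rw [Uhat_eq, Uhat_eq, exp_I_add_two_pi, exp_neg_I_add_two_pi]

lemma acs_periodic (ξ : ℝ) (n : ℤ) : c.acs (ξ + 2 * Real.pi * n) = c.acs ξ := by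
  rw [acs, acs, show ξ + 2 * Real.pi * n + c.α - c.γ / 2
    = ξ + c.α - c.γ / 2 + n * (2 * Real.pi) by ring, Real.cos_add_int_mul_two_pi]

lemma lam_periodic (j : Fin 2) (ξ : ℝ) (n : ℤ) :
    c.lam j (ξ + 2 * Real.pi * n) = c.lam j ξ := by
  fin_cases j
  · exact (c.lam_zero _).trans (by rw [acs_periodic]; exact (c.lam_zero _).symm)
  · exact (c.lam_one _).trans (by rw [acs_periodic]; exact (c.lam_one _).symm)

lemma eig_periodic (j : Fin 2) (ξ : ℝ) (n : ℤ) :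
    c.eig j (ξ + 2 * Real.pi * n) = c.eig j ξ := by
  rw [eig, eig, Uhat_periodic, lam_periodic]

lemma P_periodic (j : Fin 2) (ξ : ℝ) (n : ℤ) : c.P j (ξ + 2 * Real.pi * n) = c.P j ξ := by
  unfold P
  congr 1
  exact c.eig_periodic j ξ n

lemma mem_regular_iff {ξ : ℝ} :
    ξ ∈ c.regular ↔ -1 < c.p * Real.cos (ξ + c.sh) ∧ c.p * Real.cos (ξ + c.sh) < 1 := by
  have h1 : ξ ∈ c.regular ↔ Real.sin (c.acs ξ) ≠ 0 := by
    change c.lam 0 ξ ≠ c.lam 1 ξ ↔ _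
    rw [← sub_ne_zero, lam_sub]
    simp [ph_ne_zero, -Complex.ofReal_sin]
  have h2 := Real.sin_sq_add_cos_sq (c.acs ξ)
  rw [cos_acs] at h2
  have h3 := Real.cos_le_one (c.acs ξ)
  have h4 := Real.neg_one_le_cos (c.acs ξ)
  rw [cos_acs] at h3 h4
  rw [h1]
  constructor
  · intro h
    have h5 : 0 < Real.sin (c.acs ξ) ^ 2 := by positivity
    constructor <;> nlinarith
  · rintro ⟨h5, h6⟩ h
    rw [h] at h2
    nlinarith

lemma isOpen_regular : IsOpen c.regular := by
  have h : c.regular = (fun ξ => c.p * Real.cos (ξ + c.sh)) ⁻¹' Ioo (-1) 1 := by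
    ext ξ; exact c.mem_regular_iff
  rw [h]
  exact isOpen_Ioo.preimage (by fun_prop)

lemma continuous_acs : Continuous c.acs := by
  unfold acs
  exact Real.continuous_arccos.comp (by fun_prop)

lemma contDiffAt_acs {ξ : ℝ} (hξ : ξ ∈ c.regular) : ContDiffAt ℝ ∞ c.acs ξ := by
  obtain ⟨h1, h2⟩ := c.mem_regular_iff.1 hξ
  have h3 : c.acs = Real.arccos ∘ fun ξ => c.p * Real.cos (ξ + c.sh) := by
    funext x; simp only [acs, sh, Function.comp]; ring_nf
  rw [h3]
  exact ContDiffAt.comp _ (Real.contDiffAt_arccos h1.ne' h2.ne)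
    (contDiffAt_const.mul (Real.contDiff_cos.contDiffAt.comp _
      (contDiffAt_id.add contDiffAt_const)))

lemma contDiffAt_lam (j : Fin 2) {ξ : ℝ} (hξ : ξ ∈ c.regular) :
    ContDiffAt ℝ ∞ (c.lam j) ξ := by
  have h := (Complex.ofRealCLM.contDiff.contDiffAt (x := c.acs ξ) (n := ∞)).comp ξ
    (c.contDiffAt_acs hξ)
  have h' : ContDiffAt ℝ ∞ (fun x => (c.acs x : ℂ)) ξ := h
  fin_cases j
  · exact (contDiffAt_const.mul (contDiffAt_const.add h')).cexp
  · exact (contDiffAt_const.mul (contDiffAt_const.sub (contDiffAt_const.add h'))).cexp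

lemma contDiff_op_Uhat : ContDiff ℝ ∞ fun ξ => op (c.Uhat ξ) := by
  have h : ContDiff ℝ ∞ fun x : ℝ => (x : ℂ) := Complex.ofRealCLM.contDiff
  simp only [op_Uhat_eq]
  exact ((contDiff_const.mul h).cexp.smul contDiff_const).add
    ((contDiff_const.mul h).cexp.smul contDiff_const)

lemma contDiffAt_P (j : Fin 2) {ξ : ℝ} (hξ : ξ ∈ c.regular) : ContDiffAt ℝ ∞ (c.P j) ξ := by
  have hne : c.lam j ξ - c.lam (j + 1) ξ ≠ 0 := sub_ne_zero.2 (c.lam_ne hξ)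
  have h1 := c.contDiffAt_lam j hξ
  have h2 := c.contDiffAt_lam (j + 1) hξ
  have h : ContDiffAt ℝ ∞ (fun x => (c.lam j x - c.lam (j + 1) x)⁻¹ •
      (op (c.Uhat x) - c.lam (j + 1) x • (1 : E →L[ℂ] E))) ξ :=
    ((h1.sub h2).inv hne).smul ((c.contDiff_op_Uhat.contDiffAt).sub (h2.smul contDiffAt_const))
  refine h.congr_of_eventuallyEq ?_
  filter_upwards [c.isOpen_regular.mem_nhds hξ] with x hx
  ext1 v
  rw [P_apply c j hx]; rfl

/-- A cut-off supported in the regular set makes the projections smooth. -/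
lemma contDiff_smul_P (j : Fin 2) {χ : ℝ → ℂ} (hχ : ContDiff ℝ ∞ χ)
    (hs : tsupport χ ⊆ c.regular) : ContDiff ℝ ∞ fun ξ => χ ξ • c.P j ξ := by
  rw [contDiff_iff_contDiffAt]
  intro ξ
  by_cases hξ : ξ ∈ tsupport χ
  · exact hχ.contDiffAt.smul (c.contDiffAt_P j (hs hξ))
  · have h : (fun x => χ x • c.P j x) =ᶠ[𝓝 ξ] fun _ => 0 := by
      filter_upwards [(isClosed_tsupport χ).isOpen_compl.mem_nhds hξ] with x hx
      rw [image_eq_zero_of_notMem_tsupport hx]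
      exact zero_smul ℂ (c.P j x)
    exact contDiffAt_const.congr_of_eventuallyEq h

end Coin

/-! ### Energies in the bands -/

namespace Coin

variable (c : Coin)

/-- The sign of `sin (θ - γ/2)` on a band. -/
def bsgn : Fin 2 → ℤˣ
  | 0 => 1
  | 1 => -1

/-- The quasi-momentum `k(θ) ∈ [0, π]` with `p cos k(θ) = cos (θ - γ/2)`. -/
def kk (θ : ℝ) : ℝ := Real.arccos (Real.cos (θ - c.γ / 2) / c.p)

/-- The points `± k(θ) - (α - γ/2)`, which represent the set `M(θ)` modulo `2π`. -/
def kap (ρ : ℤˣ) (θ : ℝ) : ℝ := ((ρ : ℤ) : ℝ) * c.kk θ - c.sh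

/-- The energy `θ` lies in the interior of the band with index `j`. -/
structure InBand (j : Fin 2) (θ : ℝ) : Prop where
  mem : θ ∈ c.band j
  lower : -c.p < Real.cos (θ - c.γ / 2)
  upper : Real.cos (θ - c.γ / 2) < c.p
  sin_pos : 0 < ((bsgn j : ℤ) : ℝ) * Real.sin (θ - c.γ / 2)

lemma units_cases (ρ : ℤˣ) : ((ρ : ℤ) : ℝ) = 1 ∨ ((ρ : ℤ) : ℝ) = -1 := by
  rcases Int.units_eq_one_or ρ with rfl | rfl <;> simp

lemma units_sq (ρ : ℤˣ) : ((ρ : ℤ) : ℝ) * ((ρ : ℤ) : ℝ) = 1 := by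
  rcases units_cases ρ with h | h <;> rw [h] <;> norm_num

lemma units_cast_injective {ρ σ : ℤˣ} (h : ((ρ : ℤ) : ℝ) = ((σ : ℤ) : ℝ)) : ρ = σ :=
  Units.ext (by exact_mod_cast h)

/-- Inside the first band, shifted by `γ/2`, one has `|cos| < p` and `sin > 0`. -/
lemma cos_strict {x : ℝ} (h1 : Real.arccos c.p < x) (h2 : x < Real.pi - Real.arccos c.p) :
    -c.p < Real.cos x ∧ Real.cos x < c.p ∧ 0 < Real.sin x := by
  have h0 := Real.arccos_nonneg c.p
  have hp : Real.cos (Real.arccos c.p) = c.p :=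
    Real.cos_arccos (by linarith [c.p_pos]) c.p_le_one
  refine ⟨?_, ?_, Real.sin_pos_of_pos_of_lt_pi (by linarith) (by linarith)⟩
  · have := Real.strictAntiOn_cos ⟨by linarith, by linarith⟩ ⟨by linarith, by linarith⟩ h2
    rwa [Real.cos_pi_sub, hp] at this
  · have := Real.strictAntiOn_cos ⟨by linarith, by linarith⟩ ⟨by linarith, by linarith⟩ h1
    rwa [hp] at this

lemma exists_inBand {θ : ℝ} (hθ : θ ∈ c.J) : ∃ j, c.InBand j θ := by
  obtain ⟨hb, ht⟩ := hθ
  simp only [thresholds, mem_insert_iff, mem_singleton_iff, not_or] at ht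
  obtain ⟨t1, t2, t3, t4⟩ := ht
  rcases hb with hb | hb
  · have h1 : Real.arccos c.p < θ - c.γ / 2 := by
      have := lt_of_le_of_ne hb.1 (Ne.symm t1); linarith
    have h2 : θ - c.γ / 2 < Real.pi - Real.arccos c.p := by
      have := lt_of_le_of_ne hb.2 t2; linarith
    obtain ⟨a, b, d⟩ := c.cos_strict h1 h2
    exact ⟨0, hb, a, b, by simpa [bsgn] using d⟩
  · have h1 : Real.arccos c.p < θ - c.γ / 2 - Real.pi := by
      have := lt_of_le_of_ne hb.1 (Ne.symm t3); linarith
    have h2 : θ - c.γ / 2 - Real.pi < Real.pi - Real.arccos c.p := by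
      have := lt_of_le_of_ne hb.2 t4; linarith
    obtain ⟨a, b, d⟩ := c.cos_strict h1 h2
    rw [Real.cos_sub_pi] at a b
    rw [Real.sin_sub_pi] at d
    exact ⟨1, hb, by linarith, by linarith, by simpa [bsgn] using d⟩

/-- The dispersion relation: `det (Û₀(ξ) - e^{iθ}) = 0` if and only if
`cos (θ - γ/2) = p cos (ξ + α - γ/2)`. -/
lemma mem_fermi_iff {θ ξ : ℝ} :
    ξ ∈ c.fermi θ ↔ Real.cos (θ - c.γ / 2) = c.p * Real.cos (ξ + c.sh) := by
  set μ : ℂ := cexp (I * θ) with hμ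
  have hdet : (c.Uhat ξ - μ • (1 : Matrix (Fin 2) (Fin 2) ℂ)).det
      = c.ph ^ 2 - μ * (2 * c.ph * c.p * Real.cos (ξ + c.sh)) + μ ^ 2 := by
    have e1 : c.ea = cexp (I * (c.α - c.γ / 2)) := by simp [ea, sh]
    have e2 : c.ea' = cexp (-I * (c.α - c.γ / 2)) := by simp [ea', sh]
    have e3 : cexp (I * (c.β - c.γ / 2)) * cexp (-I * (c.β - c.γ / 2)) = 1 := by
      rw [← Complex.exp_add]; ring_nf; simp
    have e4 := exp_mul_exp_neg ξ
    have e5 := c.ea_mul_ea'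
    have hpq : (c.p : ℂ) ^ 2 + (c.q : ℂ) ^ 2 = 1 := by exact_mod_cast c.sq_add_sq
    have ht := c.trace_eq ξ
    have hph : cexp (I * (c.γ / 2)) = c.ph := rfl
    rw [Matrix.det_fin_two]
    simp only [Uhat, Matrix.sub_apply,
      Matrix.smul_apply, Matrix.of_apply, Matrix.cons_val', Matrix.cons_val_zero,
      Matrix.cons_val_one, smul_eq_mul, Matrix.one_apply_eq, Matrix.cons_val_fin_one]
    simp only [ne_eq, zero_ne_one, one_ne_zero, not_false_eq_true, Matrix.one_apply_ne, mul_zero,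
      sub_zero, mul_one]
    rw [← e1, ← e2, hph]
    linear_combination (c.ph ^ 2 * c.p ^ 2 * c.ea * c.ea' + c.ph ^ 2 * c.q ^ 2
        * (cexp (I * (c.β - c.γ / 2)) * cexp (-I * (c.β - c.γ / 2)))) * e4
      + c.ph ^ 2 * c.p ^ 2 * e5 + c.ph ^ 2 * c.q ^ 2 * e3 + c.ph ^ 2 * hpq - μ * c.ph * c.p * ht
  have hμ2 : μ = c.ph * cexp (I * ((θ - c.γ / 2 : ℝ) : ℂ)) := by
    rw [hμ, ph, ← Complex.exp_add]; push_cast; ring_nf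
  have hsplit : c.ph ^ 2 - μ * (2 * c.ph * c.p * Real.cos (ξ + c.sh)) + μ ^ 2
      = 2 * μ * c.ph * (Real.cos (θ - c.γ / 2) - c.p * Real.cos (ξ + c.sh) : ℝ) := by
    have h1 := exp_add_exp (θ - c.γ / 2)
    have h2 := exp_mul_exp_neg (θ - c.γ / 2)
    rw [hμ2]
    push_cast at h1 h2 ⊢
    linear_combination -c.ph ^ 2 * h2 + c.ph ^ 2 * cexp (I * (θ - c.γ / 2)) * h1
  have hne : 2 * μ * c.ph ≠ 0 :=
    mul_ne_zero (mul_ne_zero two_ne_zero (Complex.exp_ne_zero _)) c.ph_ne_zero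
  change (c.Uhat ξ - μ • (1 : Matrix (Fin 2) (Fin 2) ℂ)).det = 0 ↔ _
  rw [hdet, hsplit, mul_eq_zero, or_iff_right hne, Complex.ofReal_eq_zero, sub_eq_zero]

variable {c} {j : Fin 2} {θ : ℝ}

lemma sin_nonneg_of_mem_band (h : θ ∈ c.band j) :
    0 ≤ ((bsgn j : ℤ) : ℝ) * Real.sin (θ - c.γ / 2) := by
  have h0 := Real.arccos_nonneg c.p
  fin_cases j
  · obtain ⟨h1, h2⟩ := h
    have := Real.sin_nonneg_of_nonneg_of_le_pi (x := θ - c.γ / 2) (by linarith) (by linarith)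
    simpa [bsgn] using this
  · obtain ⟨h1, h2⟩ := h
    have := Real.sin_nonneg_of_nonneg_of_le_pi (x := θ - c.γ / 2 - Real.pi) (by linarith)
      (by linarith)
    rw [Real.sin_sub_pi] at this
    simpa [bsgn] using this

namespace InBand

/-- The interiors of the bands do not meet the other band, as `sin (θ - γ/2)` has opposite signs. -/
lemma eq_of_mem (h : c.InBand j θ) {i : Fin 2} (hi : θ ∈ c.band i) : i = j := by
  have h1 := h.sin_pos
  have h2 := sin_nonneg_of_mem_band hi
  by_contra hij
  fin_cases i <;> fin_cases j <;> simp [bsgn] at h1 h2 hij <;> linarith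

lemma mem_band_iff (h : c.InBand j θ) {i : Fin 2} : θ ∈ c.band i ↔ i = j :=
  ⟨fun hi => h.eq_of_mem hi, fun hi => hi ▸ h.mem⟩

lemma p_mul_cos_kk (h : c.InBand j θ) : c.p * Real.cos (c.kk θ) = Real.cos (θ - c.γ / 2) := by
  have h1 := h.lower
  have h2 := h.upper
  have hp := c.p_pos
  rw [kk, Real.cos_arccos]
  · field_simp
  · rw [le_div_iff₀ hp]; linarith
  · rw [div_le_iff₀ hp]; linarith

lemma sin_kk_pos (h : c.InBand j θ) : 0 < Real.sin (c.kk θ) := by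
  have h1 := h.lower
  have h2 := h.upper
  have hp := c.p_pos
  apply Real.sin_pos_of_pos_of_lt_pi
  · rw [kk, Real.arccos_pos, div_lt_iff₀ hp]; linarith
  · rw [kk]
    refine lt_of_le_of_ne (Real.arccos_le_pi _) fun h3 => ?_
    rw [Real.arccos_eq_pi, div_le_iff₀ hp] at h3
    linarith

lemma p_mul_sin_kk (h : c.InBand j θ) :
    c.p * Real.sin (c.kk θ) = √(c.p ^ 2 - Real.cos (θ - c.γ / 2) ^ 2) := by
  have hp := c.p_pos
  symm
  rw [Real.sqrt_eq_iff_mul_self_eq_of_pos (mul_pos hp h.sin_kk_pos), ← h.p_mul_cos_kk]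
  have := Real.sin_sq_add_cos_sq (c.kk θ)
  linear_combination c.p ^ 2 * this

lemma mem_fermi (h : c.InBand j θ) {ξ : ℝ} :
    ξ ∈ c.fermi θ ↔ ∃ (ρ : ℤˣ) (n : ℤ), ξ = c.kap ρ θ + 2 * Real.pi * n := by
  rw [mem_fermi_iff, ← h.p_mul_cos_kk, mul_right_inj' c.p_pos.ne', Real.cos_eq_cos_iff]
  constructor
  · rintro ⟨n, hn | hn⟩
    · exact ⟨1, n, by simp only [kap]; push_cast; linarith⟩
    · exact ⟨-1, n, by simp only [kap]; push_cast; linarith⟩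
  · rintro ⟨ρ, n, hn⟩
    refine ⟨n, ?_⟩
    rcases Int.units_eq_one_or ρ with rfl | rfl
    · left; rw [hn, kap]; push_cast; ring
    · right; rw [hn, kap]; push_cast; ring

lemma kap_mem_fermi (h : c.InBand j θ) (ρ : ℤˣ) : c.kap ρ θ ∈ c.fermi θ :=
  h.mem_fermi.2 ⟨ρ, 0, by simp⟩

lemma regular_of_fermi (h : c.InBand j θ) {ξ : ℝ} (hξ : ξ ∈ c.fermi θ) : ξ ∈ c.regular := by
  rw [mem_regular_iff, ← (c.mem_fermi_iff).1 hξ]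
  exact ⟨by linarith [h.lower, c.p_le_one], by linarith [h.upper, c.p_le_one]⟩

lemma acs_of_fermi_zero (h : c.InBand 0 θ) {ξ : ℝ} (hξ : ξ ∈ c.fermi θ) :
    c.acs ξ = θ - c.γ / 2 := by
  have h0 := Real.arccos_nonneg c.p
  obtain ⟨h1, h2⟩ := h.mem
  rw [acs, show ξ + c.α - c.γ / 2 = ξ + c.sh by rw [sh]; ring, ← (c.mem_fermi_iff).1 hξ]
  exact Real.arccos_cos (by linarith) (by linarith)

lemma acs_of_fermi_one (h : c.InBand 1 θ) {ξ : ℝ} (hξ : ξ ∈ c.fermi θ) :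
    c.acs ξ = 2 * Real.pi - (θ - c.γ / 2) := by
  have h0 := Real.arccos_nonneg c.p
  obtain ⟨h1, h2⟩ := h.mem
  rw [acs, show ξ + c.α - c.γ / 2 = ξ + c.sh by rw [sh]; ring, ← (c.mem_fermi_iff).1 hξ,
    ← Real.cos_two_pi_sub]
  exact Real.arccos_cos (by linarith) (by linarith)

/-- At the points of `M(θ)` it is the eigenvalue of the band of `θ` that equals `e^{iθ}`. -/
lemma lam_of_fermi (h : c.InBand j θ) {ξ : ℝ} (hξ : ξ ∈ c.fermi θ) :
    c.lam j ξ = cexp (I * θ) := by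
  fin_cases j
  · change cexp (I * (c.γ / 2 + c.acs ξ)) = _
    rw [h.acs_of_fermi_zero hξ]; push_cast; ring_nf
  · change cexp (I * (c.γ - (c.γ / 2 + c.acs ξ))) = _
    rw [h.acs_of_fermi_one hξ, Complex.exp_eq_exp_iff_exists_int]
    exact ⟨-1, by push_cast; ring⟩

/-- The index `ρ` of a point of `M(θ)` is the sign of the group velocity there. -/
lemma slope_kap (h : c.InBand j θ) (ρ : ℤˣ) (n : ℤ) :
    c.slope (c.kap ρ θ + 2 * Real.pi * n) = ((ρ : ℤ) : ℝ) := by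
  have h1 : c.kap ρ θ + 2 * Real.pi * n + c.α - c.γ / 2
      = ((ρ : ℤ) : ℝ) * c.kk θ + n * (2 * Real.pi) := by
    rw [kap, sh]; ring
  rw [slope, h1, Real.sin_add_int_mul_two_pi]
  have h2 := h.sin_kk_pos
  rcases Int.units_eq_one_or ρ with rfl | rfl
  · simp [Real.sign_of_pos h2]
  · simp [Real.sign_of_neg (neg_neg_of_pos h2)]

/-- The points `kap 1 θ` and `kap (-1) θ` are distinct modulo `2π`. -/
lemma kap_injective (h : c.InBand j θ) {ρ σ : ℤˣ} {n m : ℤ}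
    (he : c.kap ρ θ + 2 * Real.pi * n = c.kap σ θ + 2 * Real.pi * m) : ρ = σ := by
  apply units_cast_injective
  rw [← h.slope_kap ρ n, he, h.slope_kap]

end InBand

/-! ### Boundary values of the resolvent -/

variable (c) in
/-- The sign of `sin (θ - γ/2)`. It agrees with `bsgn j` on the band with index `j`, but allows
`R₀(θ ± i0)` to be defined by a formula without reference to a band. -/
def ssgn (θ : ℝ) : ℤˣ := if 0 < Real.sin (θ - c.γ / 2) then 1 else -1

lemma InBand.ssgn_eq (h : c.InBand j θ) : c.ssgn θ = bsgn j := by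
  have h1 := h.sin_pos
  unfold ssgn
  fin_cases j
  · rw [if_pos (by simpa [bsgn] using h1)]; rfl
  · rw [if_neg (by simp [bsgn] at h1; linarith)]; rfl

variable (c) in
/-- The number `e^{iρk(θ)}`, `ρ = ±1`. These are the roots `w` of `w + w⁻¹ = 2 cos (θ - γ/2) / p`,
the limits as `z → θ` of the roots of `w + w⁻¹ = 2 cos (z - γ/2) / p`. -/
def wb (ρ : ℤˣ) (θ : ℝ) : ℂ := cexp (I * ((((ρ : ℤ) : ℝ) * c.kk θ : ℝ) : ℂ))

lemma norm_wb (ρ : ℤˣ) (θ : ℝ) : ‖c.wb ρ θ‖ = 1 := by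
  rw [wb, mul_comm, Complex.norm_exp_ofReal_mul_I]

lemma wb_ne_zero (ρ : ℤˣ) (θ : ℝ) : c.wb ρ θ ≠ 0 := Complex.exp_ne_zero _

lemma wb_inv (ρ : ℤˣ) (θ : ℝ) :
    (c.wb ρ θ)⁻¹ = cexp (-I * ((((ρ : ℤ) : ℝ) * c.kk θ : ℝ) : ℂ)) := by
  rw [wb, ← Complex.exp_neg, neg_mul]

lemma cos_units_mul (ρ : ℤˣ) (x : ℝ) : Real.cos (((ρ : ℤ) : ℝ) * x) = Real.cos x := by
  rcases units_cases ρ with h | h <;> rw [h] <;> simp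

lemma sin_units_mul (ρ : ℤˣ) (x : ℝ) :
    Real.sin (((ρ : ℤ) : ℝ) * x) = ((ρ : ℤ) : ℝ) * Real.sin x := by
  rcases units_cases ρ with h | h <;> rw [h] <;> simp

lemma wb_add_inv (ρ : ℤˣ) (θ : ℝ) : c.wb ρ θ + (c.wb ρ θ)⁻¹ = 2 * Real.cos (c.kk θ) := by
  rw [wb_inv, wb, exp_add_exp, cos_units_mul]

lemma wb_inv_sub (ρ : ℤˣ) (θ : ℝ) :
    (c.wb ρ θ)⁻¹ - c.wb ρ θ = -(2 * I * (((ρ : ℤ) : ℝ) * Real.sin (c.kk θ) : ℝ)) := by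
  rw [← neg_sub, wb_inv, wb, exp_sub_exp, sin_units_mul]

lemma exp_theta (c : Coin) (θ : ℝ) :
    cexp (I * θ) = c.ph * cexp (I * ((θ - c.γ / 2 : ℝ) : ℂ)) := by
  rw [ph, ← Complex.exp_add]; push_cast; ring_nf

lemma InBand.wb_inv_sub_ne (h : c.InBand j θ) (ρ : ℤˣ) : (c.wb ρ θ)⁻¹ - c.wb ρ θ ≠ 0 := by
  rw [wb_inv_sub, neg_ne_zero]
  refine mul_ne_zero (mul_ne_zero two_ne_zero I_ne_zero) ?_
  rw [Complex.ofReal_ne_zero]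
  refine mul_ne_zero ?_ h.sin_kk_pos.ne'
  rcases units_cases ρ with h | h <;> rw [h] <;> norm_num

lemma InBand.wb_root (h : c.InBand j θ) (ρ : ℤˣ) :
    (c.wb ρ θ + (c.wb ρ θ)⁻¹) * (cexp (I * θ) * c.ph * c.p) = c.ph ^ 2 + cexp (I * θ) ^ 2 := by
  have h1 : (c.p : ℂ) * Real.cos (c.kk θ) = Real.cos (θ - c.γ / 2) := by
    exact_mod_cast h.p_mul_cos_kk
  have h2 := exp_add_exp (θ - c.γ / 2)
  have h3 := exp_mul_exp_neg (θ - c.γ / 2)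
  rw [wb_add_inv, c.exp_theta]
  linear_combination 2 * c.ph ^ 2 * cexp (I * ((θ - c.γ / 2 : ℝ) : ℂ)) * h1
    - c.ph ^ 2 * cexp (I * ((θ - c.γ / 2 : ℝ) : ℂ)) * h2 + c.ph ^ 2 * h3

variable (c) in
/-- `cos (z - γ/2) / p` at the spectral parameter `e^{iz} = r e^{iθ}`. -/
def rootQ (θ r : ℝ) : ℂ :=
  ((r + (r : ℂ)⁻¹) * Real.cos (θ - c.γ / 2) + I * ((r - (r : ℂ)⁻¹) * Real.sin (θ - c.γ / 2)))
    / (2 * c.p)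

variable (c) in
/-- The branch `w = Q + iρ √(1 - Q²)` of the solutions of `w + w⁻¹ = 2 Q`, `Q = rootQ θ r`. -/
def rootW (ρ : ℤˣ) (θ r : ℝ) : ℂ :=
  c.rootQ θ r + I * (((ρ : ℤ) : ℝ) : ℂ) * (1 - c.rootQ θ r ^ 2) ^ (2⁻¹ : ℂ)

lemma rootW_mul (ρ : ℤˣ) (θ r : ℝ) : c.rootW ρ θ r *
    (c.rootQ θ r - I * (((ρ : ℤ) : ℝ) : ℂ) * (1 - c.rootQ θ r ^ 2) ^ (2⁻¹ : ℂ)) = 1 := by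
  have h1 : ((1 - c.rootQ θ r ^ 2) ^ (2⁻¹ : ℂ)) ^ 2 = 1 - c.rootQ θ r ^ 2 :=
    Complex.cpow_ofNat_inv_pow _ 2
  have hρ2 : (((ρ : ℤ) : ℝ) : ℂ) * (((ρ : ℤ) : ℝ) : ℂ) = 1 := by exact_mod_cast units_sq ρ
  unfold rootW
  generalize (1 - c.rootQ θ r ^ 2) ^ (2⁻¹ : ℂ) = s at *
  generalize (((ρ : ℤ) : ℝ) : ℂ) = t at *
  linear_combination t ^ 2 * h1 + (1 - c.rootQ θ r ^ 2) * hρ2 - (t * s) ^ 2 * Complex.I_sq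

lemma rootW_ne_zero (ρ : ℤˣ) (θ r : ℝ) : c.rootW ρ θ r ≠ 0 :=
  left_ne_zero_of_mul_eq_one (rootW_mul ρ θ r)

lemma rootW_add_inv (ρ : ℤˣ) (θ r : ℝ) :
    c.rootW ρ θ r + (c.rootW ρ θ r)⁻¹ = 2 * c.rootQ θ r := by
  rw [inv_eq_of_mul_eq_one_right (rootW_mul ρ θ r), rootW]
  ring

lemma InBand.rootQ_one (h : c.InBand j θ) : c.rootQ θ 1 = Real.cos (c.kk θ) := by
  have h1 : (c.p : ℂ) * Real.cos (c.kk θ) = Real.cos (θ - c.γ / 2) := by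
    exact_mod_cast h.p_mul_cos_kk
  have := c.p_ne_zero
  rw [rootQ, ← h1]
  field_simp
  push_cast; ring

lemma InBand.one_sub_rootQ_one (h : c.InBand j θ) :
    1 - c.rootQ θ 1 ^ 2 = (Real.sin (c.kk θ) : ℂ) ^ 2 := by
  have : (Real.sin (c.kk θ) : ℂ) ^ 2 + (Real.cos (c.kk θ) : ℂ) ^ 2 = 1 := by
    exact_mod_cast Real.sin_sq_add_cos_sq (c.kk θ)
  rw [h.rootQ_one]; linear_combination -this

lemma InBand.rootW_one (h : c.InBand j θ) (ρ : ℤˣ) : c.rootW ρ θ 1 = c.wb ρ θ := by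
  rw [rootW, h.one_sub_rootQ_one,
    Complex.sq_cpow_two_inv (by rw [Complex.ofReal_re]; exact h.sin_kk_pos), h.rootQ_one, wb]
  have h1 := exp_add_exp (((ρ : ℤ) : ℝ) * c.kk θ)
  have h2 := exp_sub_exp (((ρ : ℤ) : ℝ) * c.kk θ)
  rw [cos_units_mul] at h1
  rw [sin_units_mul] at h2
  push_cast at h1 h2 ⊢
  linear_combination -(1 / 2 : ℂ) * h1 - (1 / 2 : ℂ) * h2

lemma continuousAt_rootQ (θ : ℝ) : ContinuousAt (c.rootQ θ) 1 := by
  have h2 : ContinuousAt (fun x : ℝ => (x : ℂ)) 1 := Complex.continuous_ofReal.continuousAt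
  have h1 : ContinuousAt (fun x : ℝ => (x : ℂ)⁻¹) 1 := h2.inv₀ (by simp)
  have h3 : ContinuousAt (fun x : ℝ => (x + (x : ℂ)⁻¹) * Real.cos (θ - c.γ / 2)) 1 :=
    (h2.add h1).mul_const _
  have h4 : ContinuousAt (fun x : ℝ => (x - (x : ℂ)⁻¹) * Real.sin (θ - c.γ / 2)) 1 :=
    (h2.sub h1).mul_const _
  exact (h3.add (h4.const_mul I)).div_const (2 * (c.p : ℂ))

lemma InBand.continuousAt_rootW (h : c.InBand j θ) (ρ : ℤˣ) : ContinuousAt (c.rootW ρ θ) 1 := by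
  have hq := continuousAt_rootQ (c := c) θ
  have h0 : 1 - c.rootQ θ 1 ^ 2 ∈ slitPlane := by
    rw [h.one_sub_rootQ_one]
    left
    have : 0 < Real.sin (c.kk θ) ^ 2 := pow_pos h.sin_kk_pos 2
    exact_mod_cast this
  have h1 : ContinuousAt (fun x => (1 - c.rootQ θ x ^ 2) ^ (2⁻¹ : ℂ)) 1 :=
    ContinuousAt.comp (f := fun x => 1 - c.rootQ θ x ^ 2) (g := fun z : ℂ => z ^ (2⁻¹ : ℂ))
      (continuousAt_cpow_const h0) (continuousAt_const.sub (hq.pow 2))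
  exact hq.add (h1.const_mul _)

/-- The branch of the root that lies in the unit disk is determined by the sign of its imaginary
part, since `Im (w + w⁻¹) = (1 - |w|⁻²) Im w` is known. -/
lemma InBand.norm_rootW_lt (h : c.InBand j θ) {τ : ℤˣ} {x : ℝ} (hx : 0 < x)
    (hτ : 0 < ((τ : ℤ) : ℝ) * (1 - x))
    (h1 : 0 < (((τ * bsgn j : ℤˣ) : ℤ) : ℝ) * (c.rootW (τ * bsgn j) θ x).im) :
    ‖c.rootW (τ * bsgn j) θ x‖ < 1 := by
  set ρ : ℤˣ := τ * bsgn j with hρ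
  set W := c.rootW ρ θ x with hW
  have hp := c.p_pos
  have e0 : 0 < ‖W‖ := norm_pos_iff.2 (rootW_ne_zero ρ θ x)
  have e1 : (W + W⁻¹).im = W.im * (1 - (‖W‖ ^ 2)⁻¹) := by
    rw [Complex.add_im, Complex.inv_im, Complex.normSq_eq_norm_sq]
    field_simp
    ring
  have e2 : (W + W⁻¹).im = (x - x⁻¹) * Real.sin (θ - c.γ / 2) / c.p := by
    have h4 : 2 * c.rootQ θ x = (((x + x⁻¹) * Real.cos (θ - c.γ / 2) / c.p : ℝ) : ℂ)
        + (((x - x⁻¹) * Real.sin (θ - c.γ / 2) / c.p : ℝ) : ℂ) * I := by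
      have := c.p_ne_zero
      rw [rootQ]
      push_cast
      field_simp
    rw [hW, rootW_add_inv, h4, Complex.add_im, Complex.ofReal_im, Complex.im_ofReal_mul]
    simp
  have e3 : ((ρ : ℤ) : ℝ) * ((x - x⁻¹) * Real.sin (θ - c.γ / 2) / c.p) < 0 := by
    have h5 : ((ρ : ℤ) : ℝ) = ((τ : ℤ) : ℝ) * ((bsgn j : ℤ) : ℝ) := by
      rw [hρ]; push_cast; ring
    have h6 : x - x⁻¹ = -((1 - x) * ((1 + x) / x)) := by field_simp; ring
    have h7 : ((ρ : ℤ) : ℝ) * ((x - x⁻¹) * Real.sin (θ - c.γ / 2) / c.p)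
        = -((((τ : ℤ) : ℝ) * (1 - x)) * (((bsgn j : ℤ) : ℝ) * Real.sin (θ - c.γ / 2))
          * ((1 + x) / x / c.p)) := by
      rw [h5, h6]; ring
    rw [h7, neg_lt_zero]
    have h8 : 0 < (1 + x) / x / c.p := by positivity
    exact mul_pos (mul_pos hτ h.sin_pos) h8
  rw [← e2, e1, ← mul_assoc] at e3
  have e4 : 1 - (‖W‖ ^ 2)⁻¹ < 0 := by
    by_contra hcon
    exact absurd e3 (not_lt.2 (mul_nonneg h1.le (not_lt.1 hcon)))
  have e6 : 1 < (‖W‖ ^ 2)⁻¹ := by linarith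
  rw [one_lt_inv₀ (by positivity)] at e6
  nlinarith

lemma rootW_root (ρ : ℤˣ) (θ : ℝ) {r : ℝ} (hr : 0 < r) :
    (c.rootW ρ θ r + (c.rootW ρ θ r)⁻¹) * ((r * cexp (I * θ)) * c.ph * c.p)
      = c.ph ^ 2 + (r * cexp (I * θ)) ^ 2 := by
  rw [rootW_add_inv, c.exp_theta]
  have h4 := exp_add_exp (θ - c.γ / 2)
  have h5 := exp_mul_exp_neg (θ - c.γ / 2)
  have h6 := exp_sub_exp (θ - c.γ / 2)
  have h7 := c.p_ne_zero
  have h8 : (r : ℂ) ≠ 0 := by exact_mod_cast hr.ne'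
  have h11 : (r : ℂ) * (r : ℂ)⁻¹ = 1 := mul_inv_cancel₀ h8
  have h10 : 2 * c.rootQ θ r * c.p
      = r * cexp (I * ((θ - c.γ / 2 : ℝ) : ℂ))
        + (r : ℂ)⁻¹ * cexp (-I * ((θ - c.γ / 2 : ℝ) : ℂ)) := by
    have h12 : 2 * c.rootQ θ r * c.p = (r + (r : ℂ)⁻¹) * Real.cos (θ - c.γ / 2)
        + I * ((r - (r : ℂ)⁻¹) * Real.sin (θ - c.γ / 2)) := by
      rw [rootQ]; field_simp
    rw [h12]
    linear_combination -((r : ℂ) + (r : ℂ)⁻¹) / 2 * h4 - ((r : ℂ) - (r : ℂ)⁻¹) / 2 * h6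
  generalize cexp (I * ((θ - c.γ / 2 : ℝ) : ℂ)) = e at *
  generalize cexp (-I * ((θ - c.γ / 2 : ℝ) : ℂ)) = e' at *
  linear_combination (r : ℂ) * c.ph ^ 2 * e * h10
    + c.ph ^ 2 * (r : ℂ) * (r : ℂ)⁻¹ * h5 + c.ph ^ 2 * h11

/-- The root `w` with `|w| < 1` at the spectral parameters `r e^{iθ}`, `r → 1`, converges to
`e^{iρk(θ)}`, where `ρ = τ` in the first band and `ρ = -τ` in the second, and `τ = 1` if the circle
`|e^{iz}| = 1` is approached from the inside. -/
lemma InBand.exists_root (h : c.InBand j θ) (τ : ℤˣ) {ι : Type*} {l : Filter ι} {r : ι → ℝ}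
    (hr : Tendsto r l (𝓝 1)) (hτ : ∀ᶠ i in l, 0 < ((τ : ℤ) : ℝ) * (1 - r i)) :
    ∃ w : ι → ℂ, Tendsto w l (𝓝 (c.wb (τ * bsgn j) θ)) ∧ ∀ᶠ i in l, w i ≠ 0 ∧ ‖w i‖ < 1 ∧
      (w i + (w i)⁻¹) * ((r i * cexp (I * θ)) * c.ph * c.p)
        = c.ph ^ 2 + (r i * cexp (I * θ)) ^ 2 := by
  set ρ : ℤˣ := τ * bsgn j with hρ
  have hWt : Tendsto (fun i => c.rootW ρ θ (r i)) l (𝓝 (c.wb ρ θ)) := by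
    rw [← h.rootW_one]; exact (h.continuousAt_rootW ρ).tendsto.comp hr
  have him : ∀ᶠ i in l, 0 < ((ρ : ℤ) : ℝ) * (c.rootW ρ θ (r i)).im := by
    have h1 : Tendsto (fun i => ((ρ : ℤ) : ℝ) * (c.rootW ρ θ (r i)).im) l
        (𝓝 (((ρ : ℤ) : ℝ) * (c.wb ρ θ).im)) :=
      ((Complex.continuous_im.tendsto _).comp hWt).const_mul _
    have h2 : (c.wb ρ θ).im = ((ρ : ℤ) : ℝ) * Real.sin (c.kk θ) := by
      rw [wb, mul_comm, Complex.exp_ofReal_mul_I_im, sin_units_mul]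
    rw [h2, ← mul_assoc, units_sq, one_mul] at h1
    exact h1.eventually (lt_mem_nhds h.sin_kk_pos)
  refine ⟨fun i => c.rootW ρ θ (r i), hWt, ?_⟩
  filter_upwards [him, hτ, hr.eventually (lt_mem_nhds one_pos)] with i h1 h2 h3
  exact ⟨rootW_ne_zero _ _ _, h.norm_rootW_lt h3 h2 h1, rootW_root ρ θ h3⟩

end Coin

namespace Coin

variable {c : Coin} {j : Fin 2} {θ : ℝ}

variable (c) in
/-- The boundary values `R₀(θ ± i0)`, `τ = ±1`, given by the kernel of the resolvent at the limiting
root `w` on the unit circle. -/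
def Rb (τ : ℤˣ) (θ : ℝ) : BZ →ₗ[ℂ] BstarZ where
  toFun f := ⟨c.resolv (cexp (I * θ)) (c.wb (τ * c.ssgn θ) θ) f,
    mem_BstarZ_of_bounded (norm_resolv_le (norm_wb _ _).le (summable_norm_of_mem_BZ f.2))⟩
  map_add' f g := Subtype.ext <| resolv_add (norm_wb _ _).le (summable_norm_of_mem_BZ f.2)
    (summable_norm_of_mem_BZ g.2)
  map_smul' a _ := Subtype.ext <| resolv_smul a _

lemma coe_Rb (τ : ℤˣ) (θ : ℝ) (f : BZ) :
    (c.Rb τ θ f : ℤ → E) = c.resolv (cexp (I * θ)) (c.wb (τ * c.ssgn θ) θ) f := rfl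

lemma InBand.coe_Rb (h : c.InBand j θ) (τ : ℤˣ) (f : BZ) :
    (c.Rb τ θ f : ℤ → E) = c.resolv (cexp (I * θ)) (c.wb (τ * bsgn j) θ) f := by
  rw [Coin.coe_Rb, h.ssgn_eq]

lemma norm_Rb_le (τ : ℤˣ) (θ : ℝ) (f : BZ) (x : ℤ) : ‖(c.Rb τ θ f : ℤ → E) x‖
    ≤ c.resolvBound (cexp (I * θ)) (c.wb (τ * c.ssgn θ) θ) * ∑' y, ‖(f : ℤ → E) y‖ :=
  norm_resolv_le (norm_wb _ _).le (summable_norm_of_mem_BZ f.2) x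

lemma InBand.U0_Rb (h : c.InBand j θ) (τ : ℤˣ) (f : BZ) :
    c.U0 (c.Rb τ θ f) - cexp (I * θ) • (c.Rb τ θ f : ℤ → E) = f := by
  rw [h.coe_Rb]
  exact resolv_eq (Complex.exp_ne_zero _) (wb_ne_zero _ _) (norm_wb _ _).le (h.wb_inv_sub_ne _)
    (h.wb_root _) (summable_norm_of_mem_BZ f.2)

/-- The limiting absorption principle. The roots `w` converge and the kernels stay bounded by `1`,
so that dominated convergence applies, `f` and `g` being summable. -/
lemma tendsto_pair_R0 (τ : ℤˣ) (hθ : θ ∈ c.J) (f g : BZ) :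
    Tendsto (fun ε : ℝ => pair
      (c.R0 (θ - I * (Real.log (1 - ((τ : ℤ) : ℝ) * ε) : ℝ)) (BZ.toH f) : H) g)
      (𝓝[>] 0) (𝓝 (pair (c.Rb τ θ f) g)) := by
  obtain ⟨j, h⟩ := c.exists_inBand hθ
  have hr : Tendsto (fun ε : ℝ => 1 - ((τ : ℤ) : ℝ) * ε) (𝓝[>] 0) (𝓝 1) := by
    have : ContinuousAt (fun ε : ℝ => 1 - ((τ : ℤ) : ℝ) * ε) 0 := by fun_prop
    have h1 := this.tendsto
    simp only [mul_zero, sub_zero] at h1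
    exact h1.mono_left nhdsWithin_le_nhds
  have hτ : ∀ᶠ ε : ℝ in 𝓝[>] 0, 0 < ((τ : ℤ) : ℝ) * (1 - (1 - ((τ : ℤ) : ℝ) * ε)) := by
    filter_upwards [self_mem_nhdsWithin] with ε hε
    have : ((τ : ℤ) : ℝ) * (1 - (1 - ((τ : ℤ) : ℝ) * ε))
        = (((τ : ℤ) : ℝ) * ((τ : ℤ) : ℝ)) * ε := by ring
    rw [this, units_sq, one_mul]
    exact hε
  obtain ⟨w, hw, hev⟩ := h.exists_root τ hr hτ
  have hf := summable_norm_of_mem_BZ f.2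
  have hμ : Tendsto (fun ε : ℝ => ((1 - ((τ : ℤ) : ℝ) * ε : ℝ) : ℂ) * cexp (I * θ)) (𝓝[>] 0)
      (𝓝 (cexp (I * θ))) := by
    have := ((Complex.continuous_ofReal.tendsto _).comp hr).mul_const (cexp (I * θ))
    simpa only [Function.comp_def, Complex.ofReal_one, one_mul] using this
  have hle : ∀ᶠ ε in 𝓝[>] 0, ‖w ε‖ ≤ 1 := hev.mono fun _ hi => hi.2.1.le
  have hlim := tendsto_pair (summable_norm_of_mem_BZ g.2)
    (eventually_norm_resolv_le (c := c) hμ hw (Complex.exp_ne_zero _) (wb_ne_zero _ _)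
      (h.wb_inv_sub_ne _) hle hf)
    (tendsto_resolv (c := c) hμ hw (Complex.exp_ne_zero _) (wb_ne_zero _ _)
      (h.wb_inv_sub_ne _) hle hf)
  rw [h.coe_Rb]
  refine hlim.congr' ?_
  filter_upwards [hev, hτ, hr.eventually (lt_mem_nhds one_pos)] with ε h1 h2 h3
  have hz : cexp (I * (θ - I * (Real.log (1 - ((τ : ℤ) : ℝ) * ε) : ℝ)))
      = ((1 - ((τ : ℤ) : ℝ) * ε : ℝ) : ℂ) * cexp (I * θ) := by
    have e1 : I * ((θ : ℂ) - I * (Real.log (1 - ((τ : ℤ) : ℝ) * ε) : ℝ))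
        = (Real.log (1 - ((τ : ℤ) : ℝ) * ε) : ℝ) + I * θ := by
      linear_combination -((Real.log (1 - ((τ : ℤ) : ℝ) * ε) : ℝ) : ℂ) * Complex.I_sq
    rw [e1, Complex.exp_add, ← Complex.ofReal_exp, Real.exp_log h3]
  have him : ((θ : ℂ) - I * (Real.log (1 - ((τ : ℤ) : ℝ) * ε) : ℝ)).im ≠ 0 := by
    rw [Complex.sub_im, Complex.ofReal_im, Complex.I_mul_im, Complex.ofReal_re, zero_sub,
      neg_ne_zero]
    have hne : 1 - ((τ : ℤ) : ℝ) * ε ≠ 1 := fun h0 => by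
      rw [h0, sub_self, mul_zero] at h2; exact lt_irrefl _ h2
    exact Real.log_ne_zero_of_pos_of_ne_one h3 hne
  rw [← hz] at h1 ⊢
  rw [R0_toH him h1.1 h1.2.1 h1.2.2 f]

lemma continuous_kk : Continuous c.kk := by
  unfold kk
  exact Real.continuous_arccos.comp (by fun_prop)

lemma continuous_wb (ρ : ℤˣ) : Continuous (c.wb ρ) := by
  have := continuous_kk (c := c)
  unfold wb
  fun_prop

lemma InBand.eventually_ssgn (h : c.InBand j θ) : ∀ᶠ t in 𝓝 θ, c.ssgn t = c.ssgn θ := by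
  have hc : ContinuousAt (fun t => ((bsgn j : ℤ) : ℝ) * Real.sin (t - c.γ / 2)) θ := by fun_prop
  filter_upwards [hc.eventually (lt_mem_nhds h.sin_pos)] with t ht
  rw [h.ssgn_eq, ssgn]
  fin_cases j
  · rw [if_pos (by simpa [bsgn] using ht)]; rfl
  · rw [if_neg (by simp [bsgn] at ht; linarith)]; rfl

lemma continuousOn_pair_Rb (τ : ℤˣ) (f g : BZ) :
    ContinuousOn (fun θ => pair (c.Rb τ θ f) g) c.J := by
  intro θ hθ
  obtain ⟨j, h⟩ := c.exists_inBand hθ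
  apply ContinuousAt.continuousWithinAt
  have hμ : Tendsto (fun t : ℝ => cexp (I * t)) (𝓝 θ) (𝓝 (cexp (I * θ))) :=
    Continuous.tendsto (by fun_prop) θ
  have hw : Tendsto (fun t => c.wb (τ * c.ssgn θ) t) (𝓝 θ) (𝓝 (c.wb (τ * c.ssgn θ) θ)) :=
    (continuous_wb _).tendsto θ
  have hle : ∀ᶠ t in 𝓝 θ, ‖c.wb (τ * c.ssgn θ) t‖ ≤ 1 :=
    Eventually.of_forall fun t => (norm_wb _ _).le
  have hf := summable_norm_of_mem_BZ f.2
  have hlim := tendsto_pair (summable_norm_of_mem_BZ g.2)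
    (eventually_norm_resolv_le (c := c) hμ hw (Complex.exp_ne_zero _) (wb_ne_zero _ _)
      (h.wb_inv_sub_ne _) hle hf)
    (tendsto_resolv (c := c) hμ hw (Complex.exp_ne_zero _) (wb_ne_zero _ _)
      (h.wb_inv_sub_ne _) hle hf)
  refine Tendsto.congr' ?_ hlim
  filter_upwards [h.eventually_ssgn] with t ht
  rw [Coin.coe_Rb, ht]

lemma continuousOn_resolvBound (τ : ℤˣ) :
    ContinuousOn (fun θ : ℝ => c.resolvBound (cexp (I * θ)) (c.wb (τ * c.ssgn θ) θ)) c.J := by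
  intro θ hθ
  obtain ⟨j, h⟩ := c.exists_inBand hθ
  apply ContinuousAt.continuousWithinAt
  have hμ : Tendsto (fun t : ℝ => cexp (I * t)) (𝓝 θ) (𝓝 (cexp (I * θ))) :=
    Continuous.tendsto (by fun_prop) θ
  have hw : Tendsto (fun t => c.wb (τ * c.ssgn θ) t) (𝓝 θ) (𝓝 (c.wb (τ * c.ssgn θ) θ)) :=
    (continuous_wb _).tendsto θ
  refine Tendsto.congr' ?_ (tendsto_resolvBound (c := c) hμ hw (Complex.exp_ne_zero _)
    (wb_ne_zero _ _) (h.wb_inv_sub_ne _))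
  filter_upwards [h.eventually_ssgn] with t ht
  rw [ht]

/-- The bound of `R₀(θ ± i0) : ℓ¹ → ℓ^∞`, which is continuous in `θ`, and `𝓑(ℤ) ⊂ ℓ¹`,
`ℓ^∞ ⊂ 𝓑*(ℤ)` give the uniform bound from `𝓑(ℤ)` to `𝓑*(ℤ)`. -/
lemma exists_bound_Rb {a b : ℝ} (hab : Icc a b ⊆ c.J) : ∃ κ > 0, ∀ τ : ℤˣ, ∀ θ ∈ Icc a b,
    ∀ f : BZ, BstarNorm (c.Rb τ θ f) ≤ κ * Bnorm f := by
  have h : ∀ τ : ℤˣ, ∃ K, 0 ≤ K ∧ ∀ θ ∈ Icc a b,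
      c.resolvBound (cexp (I * θ)) (c.wb (τ * c.ssgn θ) θ) ≤ K := by
    intro τ
    obtain ⟨K, hK⟩ := isCompact_Icc.exists_bound_of_continuousOn
      ((continuousOn_resolvBound (c := c) τ).mono hab)
    exact ⟨|K|, abs_nonneg K, fun θ hθ => (le_abs_self _).trans ((hK θ hθ).trans (le_abs_self K))⟩
  choose K hK0 hK using h
  refine ⟨√3 * ((∑ τ, K τ) * √2) + 1, ?_, fun τ θ hθ f => ?_⟩
  · have := Finset.sum_nonneg fun τ (_ : τ ∈ Finset.univ) => hK0 τ
    positivity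
  · have h1 : K τ ≤ ∑ τ, K τ :=
      Finset.single_le_sum (fun τ _ => hK0 τ) (Finset.mem_univ τ)
    have hS := sum_norm_le_Bnorm f.2
    have hB := Bnorm_nonneg (f : ℤ → E)
    have hS0 : 0 ≤ ∑' y, ‖(f : ℤ → E) y‖ := tsum_nonneg fun _ => norm_nonneg _
    have h2 : ∀ x, ‖(c.Rb τ θ f : ℤ → E) x‖ ≤ (∑ τ, K τ) * (√2 * Bnorm f) := fun x =>
      (norm_Rb_le τ θ f x).trans (mul_le_mul ((hK τ θ hθ).trans h1) hS hS0
        ((hK0 τ).trans h1))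
    calc BstarNorm (c.Rb τ θ f) ≤ √3 * ((∑ τ, K τ) * (√2 * Bnorm f)) :=
          BstarNorm_le_of_bounded h2
      _ = √3 * ((∑ τ, K τ) * √2) * Bnorm f := by ring
      _ ≤ _ := by nlinarith

/-! ### Plane waves -/

/-- The plane wave `x ↦ e^{iκx} v`. -/
def _root_.QW.pw (κ : ℝ) (v : E) (x : ℤ) : E := cexp (I * ((κ * x : ℝ) : ℂ)) • v

lemma _root_.QW.norm_pw (κ : ℝ) (v : E) (x : ℤ) : ‖pw κ v x‖ = ‖v‖ := by
  rw [pw, norm_smul, mul_comm I, Complex.norm_exp_ofReal_mul_I, one_mul]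

lemma _root_.QW.pw_succ (κ : ℝ) (v : E) (x : ℤ) : pw κ v (x + 1) = cexp (I * κ) • pw κ v x := by
  rw [pw, pw, smul_smul, ← Complex.exp_add]; push_cast; ring_nf

lemma _root_.QW.pw_pred (κ : ℝ) (v : E) (x : ℤ) : pw κ v (x - 1) = cexp (-I * κ) • pw κ v x := by
  rw [pw, pw, smul_smul, ← Complex.exp_add]; push_cast; ring_nf

lemma _root_.QW.op_pw (A : E →L[ℂ] E) (κ : ℝ) (v : E) (x : ℤ) : A (pw κ v x) = pw κ (A v) x := by
  rw [pw, pw, map_smul]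

lemma _root_.QW.pw_smul (a : ℂ) (κ : ℝ) (v : E) (x : ℤ) : pw κ (a • v) x = a • pw κ v x := by
  rw [pw, pw, smul_comm]

lemma _root_.QW.pw_add (κ : ℝ) (v w : E) (x : ℤ) : pw κ (v + w) x = pw κ v x + pw κ w x :=
  smul_add _ _ _

lemma _root_.QW.pw_sub (κ : ℝ) (v w : E) (x : ℤ) : pw κ (v - w) x = pw κ v x - pw κ w x :=
  smul_sub _ _ _

lemma _root_.QW.pw_zero (κ : ℝ) (x : ℤ) : pw κ 0 x = 0 := smul_zero _

lemma U0_pw (κ : ℝ) (v : E) : c.U0 (pw κ v) = pw κ (op (c.Uhat κ) v) := by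
  funext x
  rw [U0_apply, pw_succ, pw_pred, map_smul, map_smul, op_pw, op_pw, op_Uhat_apply, pw_add,
    pw_smul, pw_smul]

lemma U0star_pw (κ : ℝ) (v : E) :
    c.U0star (pw κ v) = pw κ (op (c.Uhat κ).conjTranspose v) := by
  funext x
  rw [U0star_apply, pw_succ, pw_pred, map_smul, map_smul, op_pw, op_pw, op_Uhat_conj_apply,
    pw_add, pw_smul, pw_smul]

lemma _root_.QW.sum_units {M : Type*} [AddCommMonoid M] (f : ℤˣ → M) :
    ∑ σ, f σ = f 1 + f (-1) := by
  rw [show (Finset.univ : Finset ℤˣ) = {1, -1} from rfl, Finset.sum_pair (by decide)]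

lemma exp_kap (ρ : ℤˣ) (θ : ℝ) : cexp (I * c.kap ρ θ) = c.wb ρ θ * c.ea' := by
  rw [wb, ea', ← Complex.exp_add, kap]; push_cast; ring_nf

lemma wb_neg (ρ : ℤˣ) (θ : ℝ) : c.wb (-ρ) θ = (c.wb ρ θ)⁻¹ := by
  rw [wb_inv, wb]; push_cast; ring_nf

lemma InBand.exp_kap_ne (h : c.InBand j θ) :
    cexp (I * c.kap 1 θ) - cexp (I * c.kap (-1) θ) ≠ 0 := by
  have h1 := h.wb_inv_sub_ne 1
  rw [exp_kap, exp_kap, wb_neg, ← sub_mul]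
  refine mul_ne_zero ?_ (Complex.exp_ne_zero _)
  rw [← neg_sub, neg_ne_zero]
  exact h1

/-- A second-order recurrence on `ℤ` with vanishing initial values has only the zero solution. -/
lemma _root_.QW.eq_zero_of_recurrence {a a' t : ℂ} (ha : a ≠ 0) (ha' : a' ≠ 0) {y : ℤ → E}
    (hy : ∀ x, t • y x = a • y (x + 1) + a' • y (x - 1)) (h0 : y 0 = 0) (h1 : y 1 = 0) (x : ℤ) :
    y x = 0 := by
  have h : y x = 0 ∧ y (x + 1) = 0 := by
    induction x using Int.induction_on with
    | zero => exact ⟨h0, by simpa using h1⟩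
    | succ n ih =>
      refine ⟨ih.2, ?_⟩
      have h2 := hy (n + 1)
      rw [ih.2, smul_zero, add_sub_cancel_right, ih.1, smul_zero, add_zero] at h2
      exact (smul_eq_zero_iff_right ha).1 h2.symm
    | pred n ih =>
      have h2 := hy (-n)
      rw [ih.1, ih.2, smul_zero, smul_zero, zero_add] at h2
      exact ⟨(smul_eq_zero_iff_right ha').1 h2.symm, by simpa using ih.1⟩
  exact h.1

/-- All solutions of `U₀ u = e^{iθ} u` are superpositions of two plane waves: they satisfy the
scalar recurrence of `U0_add_U0star`, whose solutions are determined by two initial values. -/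
lemma InBand.eq_sum_pw (h : c.InBand j θ) {u : ℤ → E}
    (hu : c.U0 u - cexp (I * θ) • u = 0) :
    ∃ v : ℤˣ → E, (∀ x, u x = ∑ σ, pw (c.kap σ θ) (v σ) x) ∧
      ∀ σ, op (c.Uhat (c.kap σ θ)) (v σ) = cexp (I * θ) • v σ := by
  set μ := cexp (I * θ) with hμ
  have hμ0 : μ ≠ 0 := Complex.exp_ne_zero _
  set d1 := cexp (I * c.kap 1 θ) with hd1
  set d2 := cexp (I * c.kap (-1) θ) with hd2
  have hd : d1 - d2 ≠ 0 := h.exp_kap_ne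
  have hU : c.U0 u = μ • u := sub_eq_zero.1 hu
  have hUs : ∀ x, c.U0star u x = μ⁻¹ • u x := by
    have h1 := c.U0star_U0 u
    rw [hU, U0star_smul] at h1
    intro x
    rw [eq_inv_smul_iff₀ hμ0]
    exact congrFun h1 x
  have hcos : ∀ σ, 2 * (Real.cos (c.kap σ θ + c.sh) : ℂ) = 2 * Real.cos (c.kk θ) := by
    intro σ
    rw [kap, sub_add_cancel, cos_units_mul]
  have hrec : ∀ x, (2 * (Real.cos (c.kk θ) : ℂ)) • u x
      = c.ea • u (x + 1) + c.ea' • u (x - 1) := by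
    intro x
    have h1 := c.U0_add_U0star u x
    have h2 := h.wb_root 1
    rw [wb_add_inv, ← hμ] at h2
    rw [hU, hUs, Pi.smul_apply, smul_smul, ← add_smul] at h1
    have hpp : c.ph * c.p ≠ 0 := mul_ne_zero c.ph_ne_zero c.p_ne_zero
    have h3 : μ + c.ph ^ 2 * μ⁻¹ = c.ph * c.p * (2 * Real.cos (c.kk θ)) := by
      field_simp
      linear_combination -h2
    rw [h3, mul_smul] at h1
    exact smul_right_injective _ hpp h1
  have hpwrec : ∀ σ v x, (2 * (Real.cos (c.kk θ) : ℂ)) • pw (c.kap σ θ) v x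
      = c.ea • pw (c.kap σ θ) v (x + 1) + c.ea' • pw (c.kap σ θ) v (x - 1) := by
    intro σ v x
    rw [pw_succ, pw_pred, smul_smul, smul_smul, ← add_smul, trace_eq, hcos]
  let v1 : E := (d1 - d2)⁻¹ • (u 1 - d2 • u 0)
  let v2 : E := (d1 - d2)⁻¹ • (d1 • u 0 - u 1)
  let v : ℤˣ → E := fun σ => if σ = 1 then v1 else v2
  have hv1 : v 1 = v1 := rfl
  have hv2 : v (-1) = v2 := rfl
  have hpw0 : ∀ κ w, pw κ w 0 = w := fun κ w => by simp [pw]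
  have hpw1 : ∀ κ w, pw κ w 1 = cexp (I * κ) • w := fun κ w => by simp [pw]
  have hsum : ∀ x, u x = ∑ σ, pw (c.kap σ θ) (v σ) x := by
    intro x
    rw [← sub_eq_zero]
    refine eq_zero_of_recurrence (y := fun x => u x - ∑ σ, pw (c.kap σ θ) (v σ) x)
      (t := 2 * (Real.cos (c.kk θ) : ℂ)) (a := c.ea) (a' := c.ea')
      (Complex.exp_ne_zero _) (Complex.exp_ne_zero _) ?_ ?_ ?_ x
    · intro x
      simp only [sum_units, smul_sub, smul_add]
      rw [hrec, hpwrec, hpwrec]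
      abel
    · simp only [sum_units, hpw0, hv1, hv2, v1, v2]
      rw [← smul_add, sub_eq_zero, eq_inv_smul_iff₀ hd]
      module
    · simp only [sum_units, hpw1, hv1, hv2, v1, v2, ← hd1, ← hd2]
      rw [smul_comm d1, smul_comm d2, ← smul_add, sub_eq_zero, eq_inv_smul_iff₀ hd]
      module
  refine ⟨v, hsum, ?_⟩
  -- the coefficients of the two plane waves in `(U₀ - e^{iθ}) u = 0` vanish separately
  let z : ℤˣ → E := fun σ => op (c.Uhat (c.kap σ θ)) (v σ) - μ • v σ
  have hz : ∀ x, pw (c.kap 1 θ) (z 1) x + pw (c.kap (-1) θ) (z (-1)) x = 0 := by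
    intro x
    have hu2 : u = pw (c.kap 1 θ) (v 1) + pw (c.kap (-1) θ) (v (-1)) := by
      funext x; rw [hsum x, sum_units]; rfl
    have h1 := congrFun hu x
    rw [hu2, map_add, U0_pw, U0_pw] at h1
    simp only [z, pw_sub, pw_smul]
    rw [← sub_eq_zero.2 h1]
    simp only [Pi.sub_apply, Pi.add_apply, Pi.smul_apply, Pi.zero_apply, smul_add]
    abel
  have hz0 := hz 0
  have hz1 := hz 1
  rw [hpw0, hpw0] at hz0
  rw [hpw1, hpw1, ← hd1, ← hd2] at hz1
  have hzm : z (-1) = -z 1 := (neg_eq_of_add_eq_zero_right hz0).symm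
  rw [hzm, smul_neg, ← sub_eq_add_neg, ← sub_smul] at hz1
  have hz1' : z 1 = 0 := (smul_eq_zero_iff_right hd).1 hz1
  intro σ
  rw [← sub_eq_zero]
  rcases Int.units_eq_one_or σ with rfl | rfl
  · exact hz1'
  · change z (-1) = 0
    rw [hzm, hz1', neg_zero]

/-! ### Asymptotics at infinity -/

/-- The two ends of `ℤ`, `+∞` for `e = 1` and `-∞` for `e = -1`. -/
def _root_.QW.dirZ (e : ℤˣ) : Filter ℤ := if e = 1 then atTop else atBot

lemma _root_.QW.tendsto_add_dirZ (e : ℤˣ) (n : ℤ) :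
    Tendsto (fun x => x + n) (dirZ e) (dirZ e) := by
  rcases Int.units_eq_one_or e with rfl | rfl
  · exact tendsto_atTop_add_const_right _ _ tendsto_id
  · exact tendsto_atBot_add_const_right _ _ tendsto_id

/-- On the half-line at the end `e` the kernel is the exponential of frequency `kap (e * ρ) θ`. -/
lemma hker_wb_of_nonneg (ρ : ℤˣ) {n : ℤ} (e : ℤˣ) (hn : 0 ≤ (e : ℤ) * n) :
    c.hker (c.wb ρ θ) n = cexp (I * ((c.kap (e * ρ) θ * n : ℝ) : ℂ)) := by
  have h1 : ((n.natAbs : ℕ) : ℝ) = ((e : ℤ) : ℝ) * n := by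
    rcases Int.units_eq_one_or e with rfl | rfl
    · have h2 : (n.natAbs : ℤ) = n := by simp at hn; omega
      have h3 : ((n.natAbs : ℤ) : ℝ) = n := by rw [h2]
      simpa using h3
    · have h2 : (n.natAbs : ℤ) = -n := by simp at hn; omega
      have h3 : ((n.natAbs : ℤ) : ℝ) = -n := by rw [h2]; simp
      simpa using h3
  have h1' : ((n.natAbs : ℕ) : ℂ) = (((e : ℤ) : ℝ) : ℂ) * n := by exact_mod_cast h1
  rw [hker, wb, ← Complex.exp_nat_mul, ← Complex.exp_add, h1', kap]
  push_cast
  ring_nf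

lemma eventually_hker_wb (ρ e : ℤˣ) (y : ℤ) : ∀ᶠ x in dirZ e,
    c.hker (c.wb ρ θ) (x - y) = cexp (I * ((c.kap (e * ρ) θ * (x - y : ℤ) : ℝ) : ℂ)) := by
  have : ∀ᶠ x in dirZ e, 0 ≤ (e : ℤ) * (x - y) := by
    rcases Int.units_eq_one_or e with rfl | rfl
    · filter_upwards [eventually_ge_atTop y] with x hx
      simpa using hx
    · filter_upwards [eventually_le_atBot y] with x hx
      simpa using hx
  filter_upwards [this] with x hx
  exact hker_wb_of_nonneg ρ e hx

lemma _root_.QW.norm_exp_I_real (x : ℝ) : ‖cexp (I * (x : ℂ))‖ = 1 := by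
  rw [mul_comm, Complex.norm_exp_ofReal_mul_I]

/-- The convolution of `f` with the character `e^{iκx}`. -/
lemma _root_.QW.hasSum_pw {f : ℤ → E} (hf : Summable fun x => ‖f x‖) (κ : ℝ) (x : ℤ) :
    HasSum (fun y : ℤ => cexp (I * ((κ * (x - y : ℤ) : ℝ) : ℂ)) • f y)
      (pw κ ((√(2 * Real.pi) : ℂ) • fhat f κ) x) := by
  have hpi : (√(2 * Real.pi) : ℂ) ≠ 0 := by
    have : 0 < √(2 * Real.pi) := by positivity
    exact_mod_cast this.ne'
  have hs : Summable fun y : ℤ => cexp (-I * y * κ) • f y :=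
    Summable.of_norm_bounded hf fun y => by
      rw [norm_smul, show -I * (y : ℂ) * κ = I * ((-(y * κ) : ℝ) : ℂ) by push_cast; ring,
        norm_exp_I_real, one_mul]
  rw [fhat, smul_inv_smul₀ hpi, pw]
  refine (hs.hasSum.const_smul _).congr_fun fun y => ?_
  rw [smul_smul, ← Complex.exp_add]; push_cast; ring_nf

/-- Far out at the end `e` of `ℤ`, the convolution with the kernel becomes the convolution with a
character, a plane wave whose amplitude is a value of the Fourier series. -/
lemma tendsto_green (ρ e : ℤˣ) {f : ℤ → E} (hf : Summable fun x => ‖f x‖) :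
    Tendsto (fun x => c.green (c.wb ρ θ) f x
      - pw (c.kap (e * ρ) θ) ((√(2 * Real.pi) : ℂ) • fhat f (c.kap (e * ρ) θ)) x)
      (dirZ e) (𝓝 0) := by
  have h : ∀ x, c.green (c.wb ρ θ) f x
      - pw (c.kap (e * ρ) θ) ((√(2 * Real.pi) : ℂ) • fhat f (c.kap (e * ρ) θ)) x
      = ∑' y, (c.hker (c.wb ρ θ) (x - y) • f y
        - cexp (I * ((c.kap (e * ρ) θ * (x - y : ℤ) : ℝ) : ℂ)) • f y) := fun x =>
    ((summable_green (norm_wb ρ θ).le hf x).hasSum.sub (hasSum_pw hf _ x)).tsum_eq.symm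
  simp only [h]
  have h0 : (0 : E) = ∑' _ : ℤ, (0 : E) := tsum_zero.symm
  rw [h0]
  refine tendsto_tsum_of_dominated_convergence (hf.mul_left 2) (fun y => ?_)
    (Eventually.of_forall fun x y => ?_)
  · refine tendsto_const_nhds.congr' ?_
    filter_upwards [eventually_hker_wb (c := c) (θ := θ) ρ e y] with x hx
    rw [hx, sub_self]
  · refine (norm_sub_le _ _).trans ?_
    rw [two_mul]
    refine add_le_add (c.norm_hker_smul_le (norm_wb ρ θ).le _ _) ?_
    rw [norm_smul, norm_exp_I_real, one_mul]

/-- The application of `e^{iγ} U₀* - μ` to a plane wave gives the projection on the band. -/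
lemma InBand.op_amplitude (h : c.InBand j θ) (σ : ℤˣ) (v : E) :
    c.ph ^ 2 • op (c.Uhat (c.kap σ θ)).conjTranspose v - cexp (I * θ) • v
      = (c.ph ^ 2 * (cexp (I * θ))⁻¹ - cexp (I * θ)) • c.P j (c.kap σ θ) v := by
  have hf := h.kap_mem_fermi σ
  have hreg := h.regular_of_fermi hf
  have hne := sub_ne_zero.2 (c.lam_ne (j := j) hreg)
  have h1 : c.lam (j + 1) (c.kap σ θ) = c.ph ^ 2 * (cexp (I * θ))⁻¹ := by
    rw [← c.lam_mul' j (c.kap σ θ), h.lam_of_fermi hf]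
    field_simp
  rw [c.ph_sq_op_conj j, ← h1, ← h.lam_of_fermi hf, P_apply c j hreg, smul_smul,
    ← neg_sub (c.lam j _), neg_mul, mul_inv_cancel₀ hne]
  module

lemma InBand.dxi_eq (h : c.InBand j θ) :
    c.dxi θ = ((bsgn j : ℤ) : ℝ) * Real.sin (θ - c.γ / 2) / (c.p * Real.sin (c.kk θ)) := by
  rw [dxi, h.p_mul_sin_kk]
  congr 1
  have := h.sin_pos
  rcases units_cases (bsgn j) with hb | hb <;> rw [hb] at this ⊢
  · rw [one_mul] at this ⊢; exact abs_of_pos this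
  · rw [abs_of_neg (by linarith)]; ring

lemma InBand.dxi_pos (h : c.InBand j θ) : 0 < c.dxi θ := by
  rw [h.dxi_eq]
  exact div_pos h.sin_pos (mul_pos c.p_pos h.sin_kk_pos)

/-- The product of the normalization of `resolv` and of the factor of `InBand.op_amplitude`. -/
lemma InBand.amplitude (h : c.InBand j θ) (τ : ℤˣ) :
    (cexp (I * θ) * c.ph * c.p * ((c.wb (τ * bsgn j) θ)⁻¹ - c.wb (τ * bsgn j) θ))⁻¹
        * (c.ph ^ 2 * (cexp (I * θ))⁻¹ - cexp (I * θ))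
      = ((τ : ℤ) : ℂ) * c.dxi θ * cexp (-I * θ) := by
  have hμ0 : cexp (I * θ) ≠ 0 := Complex.exp_ne_zero _
  have hinv : cexp (-I * θ) = (cexp (I * θ))⁻¹ := by rw [← Complex.exp_neg, neg_mul]
  have hp := c.p_ne_zero
  have hph := c.ph_ne_zero
  have hs : (Real.sin (c.kk θ) : ℂ) ≠ 0 := by exact_mod_cast h.sin_kk_pos.ne'
  have hI := I_ne_zero
  have h1 : c.ph ^ 2 * (cexp (I * θ))⁻¹ - cexp (I * θ)
      = -(2 * I * c.ph * Real.sin (θ - c.γ / 2)) := by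
    have h2 := exp_sub_exp (θ - c.γ / 2)
    have h3 := exp_mul_exp_neg (θ - c.γ / 2)
    have h4 : (cexp (I * ((θ - c.γ / 2 : ℝ) : ℂ)))⁻¹ = cexp (-I * ((θ - c.γ / 2 : ℝ) : ℂ)) :=
      inv_eq_of_mul_eq_one_right h3
    rw [c.exp_theta, mul_inv, h4]
    have h5 : c.ph ^ 2 * c.ph⁻¹ = c.ph := by field_simp
    linear_combination cexp (-I * ((θ - c.γ / 2 : ℝ) : ℂ)) * h5 - c.ph * h2
  have hτ : (((τ : ℤ) : ℝ) : ℂ) * (((τ : ℤ) : ℝ) : ℂ) = 1 := by exact_mod_cast units_sq τ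
  have hb : (((bsgn j : ℤ) : ℝ) : ℂ) * (((bsgn j : ℤ) : ℝ) : ℂ) = 1 := by
    exact_mod_cast units_sq (bsgn j)
  have hτ0 := left_ne_zero_of_mul_eq_one hτ
  have hb0 := left_ne_zero_of_mul_eq_one hb
  rw [h1, wb_inv_sub, h.dxi_eq, hinv]
  push_cast at hτ hb hτ0 hb0 hs ⊢
  generalize Complex.sin (θ - c.γ / 2) = S
  field_simp
  linear_combination (-S * ((bsgn j : ℤ) : ℂ) ^ 2) * hτ - S * hb

/-- The amplitude `τ √(2π) (dξ/dθ) e^{-iθ} P_j(κ) f̂(κ)` of `R₀(θ ± i0) f`, `τ = ±1`, at infinity,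
for the quasi-momentum `κ`. -/
def ampl (c : Coin) (j : Fin 2) (τ : ℤˣ) (θ : ℝ) (f : ℤ → E) (κ : ℝ) : E :=
  (((τ : ℤ) : ℂ) * c.dxi θ * cexp (-I * θ) * √(2 * Real.pi)) • c.P j κ (fhat f κ)

/-- `R₀(θ ± i0) f` is asymptotic to a single plane wave at each end of `ℤ`, with opposite signs of
the group velocity at the two ends. -/
lemma InBand.tendsto_Rb (h : c.InBand j θ) (τ e : ℤˣ) (f : BZ) :
    Tendsto (fun x => (c.Rb τ θ f : ℤ → E) x - pw (c.kap (e * (τ * bsgn j)) θ)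
      (c.ampl j τ θ f (c.kap (e * (τ * bsgn j)) θ)) x) (dirZ e) (𝓝 0) := by
  set ρ := τ * bsgn j with hρ
  set κ := c.kap (e * ρ) θ with hκ
  set V : E := (√(2 * Real.pi) : ℂ) • fhat f κ with hV
  set N := (cexp (I * θ) * c.ph * c.p * ((c.wb ρ θ)⁻¹ - c.wb ρ θ))⁻¹ with hN
  set D : ℤ → E := fun x => c.green (c.wb ρ θ) f x - pw κ V x with hD
  have hD0 : Tendsto D (dirZ e) (𝓝 0) := tendsto_green ρ e (summable_norm_of_mem_BZ f.2)
  have hGD : c.green (c.wb ρ θ) f = D + pw κ V := by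
    funext x; simp [hD]
  have hDs : Tendsto (fun x => c.U0star D x) (dirZ e) (𝓝 0) := by
    simp only [U0star_apply]
    have h1 := hD0.comp (tendsto_add_dirZ e (-1))
    have h2 := hD0.comp (tendsto_add_dirZ e 1)
    have h3 := ((op c.C1.conjTranspose).continuous.tendsto 0).comp h1
    have h4 := ((op c.C2.conjTranspose).continuous.tendsto 0).comp h2
    have h5 := h3.add h4
    simpa only [map_zero, add_zero, Function.comp_def, ← sub_eq_add_neg] using h5
  have hdiff : ∀ x, (c.Rb τ θ f : ℤ → E) x - pw κ (c.ampl j τ θ f κ) x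
      = N • (c.ph ^ 2 • c.U0star D x - cexp (I * θ) • D x) := by
    intro x
    have ha : c.ampl j τ θ f κ = N • (c.ph ^ 2 • op (c.Uhat κ).conjTranspose V
        - cexp (I * θ) • V) := by
      rw [h.op_amplitude, smul_smul, hN, h.amplitude, ampl, hV, map_smul, smul_smul]
    rw [h.coe_Rb, resolv, ha, hGD, U0star_add, U0star_pw]
    simp only [Pi.smul_apply, Pi.sub_apply, Pi.add_apply, pw_smul, pw_sub]
    rw [← hρ, ← hN]
    module
  simp only [hdiff]
  have h6 := ((hDs.const_smul (c.ph ^ 2)).sub (hD0.const_smul (cexp (I * θ)))).const_smul N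
  simpa only [smul_zero, sub_zero] using h6

/-- The jump of the resolvent across the band is a superposition of two plane waves: the kernels for
`w` and `w⁻¹`, `|w| = 1`, add up to a sum of two characters, and the normalizing factors of
`resolv` are opposite. -/
lemma InBand.Rb_sub (h : c.InBand j θ) (f : BZ) (x : ℤ) :
    ((c.Rb 1 θ f : ℤ → E) - c.Rb (-1) θ f) x
      = ∑ σ, pw (c.kap σ θ) (c.ampl j 1 θ f (c.kap σ θ)) x := by
  have hf := summable_norm_of_mem_BZ f.2
  set N := (cexp (I * θ) * c.ph * c.p * ((c.wb (1 * bsgn j) θ)⁻¹ - c.wb (1 * bsgn j) θ))⁻¹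
    with hN
  have hN' : (cexp (I * θ) * c.ph * c.p
      * ((c.wb (-1 * bsgn j) θ)⁻¹ - c.wb (-1 * bsgn j) θ))⁻¹ = -N := by
    rw [hN, ← inv_neg, neg_one_mul, one_mul, wb_neg, inv_inv]
    ring_nf
  let V : ℤˣ → E := fun σ => (√(2 * Real.pi) : ℂ) • fhat f (c.kap σ θ)
  have hG : c.green (c.wb (1 * bsgn j) θ) f + c.green (c.wb (-1 * bsgn j) θ) f
      = pw (c.kap 1 θ) (V 1) + pw (c.kap (-1) θ) (V (-1)) := by
    funext x
    have h1 := (summable_green (c := c) (norm_wb (c := c) (1 * bsgn j) θ).le hf x).hasSum.add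
      (summable_green (c := c) (norm_wb (c := c) (-1 * bsgn j) θ).le hf x).hasSum
    have h2 := (hasSum_pw hf (c.kap 1 θ) x).add (hasSum_pw hf (c.kap (-1) θ) x)
    refine h1.unique (h2.congr_fun fun y => ?_)
    rw [← add_smul, ← add_smul]
    congr 1
    have key : ∀ n : ℤ, c.hker (c.wb 1 θ) n + c.hker (c.wb (-1) θ) n
        = cexp (I * ((c.kap 1 θ * n : ℝ) : ℂ)) + cexp (I * ((c.kap (-1) θ * n : ℝ) : ℂ)) := by
      intro n
      rcases le_total 0 n with hn | hn
      · rw [hker_wb_of_nonneg 1 1 (by simpa using hn),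
          hker_wb_of_nonneg (-1) 1 (by simpa using hn), one_mul, one_mul]
      · rw [hker_wb_of_nonneg 1 (-1) (by simpa using hn),
          hker_wb_of_nonneg (-1) (-1) (by simpa using hn), mul_one, neg_mul_neg, one_mul, add_comm]
    rw [← key]
    rcases Int.units_eq_one_or (bsgn j) with hb | hb <;> rw [hb]
    · rw [mul_one, mul_one]
    · rw [one_mul, neg_mul_neg, one_mul, add_comm]
  have ha : ∀ σ, c.ampl j 1 θ f (c.kap σ θ) = N • (c.ph ^ 2 •
      op (c.Uhat (c.kap σ θ)).conjTranspose (V σ) - cexp (I * θ) • V σ) := by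
    intro σ
    rw [h.op_amplitude, smul_smul, hN, h.amplitude, ampl, map_smul, smul_smul]
  have hfin : (c.Rb 1 θ f : ℤ → E) - c.Rb (-1) θ f
      = N • (c.ph ^ 2 • c.U0star (pw (c.kap 1 θ) (V 1) + pw (c.kap (-1) θ) (V (-1)))
        - cexp (I * θ) • (pw (c.kap 1 θ) (V 1) + pw (c.kap (-1) θ) (V (-1)))) := by
    rw [← hG, U0star_add, h.coe_Rb, h.coe_Rb, resolv, resolv, hN', ← hN]
    module
  rw [hfin, sum_units, ha, ha, U0star_add, U0star_pw, U0star_pw]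
  simp only [Pi.smul_apply, Pi.sub_apply, Pi.add_apply, pw_smul, pw_sub]
  module

end Coin

/-! ### Local Fourier transforms -/

open scoped FourierTransform

/-- The kernel `K(t) = (2π)⁻¹ ∫ e^{-itξ} A(ξ) dξ`. -/
def kerFT (A : ℝ → E →L[ℂ] E) (t : ℝ) : E →L[ℂ] E :=
  ((2 * Real.pi : ℝ) : ℂ)⁻¹ • ∫ ξ : ℝ, cexp (-I * t * ξ) • A ξ

lemma sqrt_inv_mul_self : ((√(2 * Real.pi))⁻¹ : ℂ) * ((√(2 * Real.pi))⁻¹ : ℂ)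
    = ((2 * Real.pi : ℝ) : ℂ)⁻¹ := by
  rw [← mul_inv, ← Complex.ofReal_mul, Real.mul_self_sqrt (by positivity)]

/-- The local Fourier transform is a discrete convolution with `kerFT A`. -/
lemma locFT_eq (A : ℝ → E →L[ℂ] E) (u : ℤ → E) (s : ℝ) :
    locFT A u s = ∑' x : ℤ, kerFT A (s + x) (u x) := by
  rw [locFT, distPair, ← tsum_const_smul'']
  refine tsum_congr fun x => ?_
  rw [kerFT, ← _root_.smul_apply, smul_smul, sqrt_inv_mul_self]
  congr 3
  funext ξ
  rw [smul_smul, ← Complex.exp_add]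
  congr 2
  push_cast; ring

/-- The kernel in the normalization of the Fourier transform `𝓕`. -/
lemma kerFT_eq_fourier (A : ℝ → E →L[ℂ] E) :
    kerFT A = 𝓕 (fun y : ℝ => A (2 * Real.pi * y)) := by
  funext t
  have hpi := Real.pi_pos
  rw [Real.fourier_real_eq_integral_exp_smul]
  have h := Measure.integral_comp_mul_left (fun ξ : ℝ => cexp (-I * t * ξ) • A ξ) (2 * Real.pi)
  have h2 : |(2 * Real.pi)⁻¹| = (2 * Real.pi)⁻¹ := abs_of_pos (by positivity)
  rw [h2] at h
  have h3 : kerFT A t = (2 * Real.pi)⁻¹ • ∫ ξ : ℝ, cexp (-I * t * ξ) • A ξ := by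
    rw [kerFT, ← Complex.ofReal_inv]
    exact (RCLike.real_smul_eq_coe_smul (K := ℂ) (E := E →L[ℂ] E) _ _).symm
  rw [h3, ← h]
  refine integral_congr_ae (Eventually.of_forall fun y => ?_)
  simp only
  congr 2
  push_cast; ring

/-- The Schwartz function `y ↦ A(2πy)` for a smooth compactly supported `A`. -/
lemma exists_schwartz {F : Type*} [NormedAddCommGroup F] [NormedSpace ℝ F] {A : ℝ → F}
    (hA : ContDiff ℝ ∞ A) (hc : HasCompactSupport A) :
    ∃ f : SchwartzMap ℝ F, ⇑f = fun y => A (2 * Real.pi * y) := by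
  have hpi := Real.pi_pos
  have h1 : ContDiff ℝ ∞ fun y => A (2 * Real.pi * y) := hA.comp (by fun_prop)
  have h2 : HasCompactSupport fun y => A (2 * Real.pi * y) :=
    hc.comp_homeomorph (Homeomorph.mulLeft₀ (2 * Real.pi) (by positivity))
  exact ⟨h2.toSchwartzMap h1, rfl⟩

variable {A : ℝ → E →L[ℂ] E}

lemma continuous_kerFT (hA : ContDiff ℝ ∞ A) (hc : HasCompactSupport A) :
    Continuous (kerFT A) := by
  obtain ⟨f, hf⟩ := exists_schwartz hA hc
  rw [kerFT_eq_fourier, ← hf, ← SchwartzMap.fourier_coe]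
  exact (𝓕 f).continuous

/-- The kernel of a smooth compactly supported symbol decays rapidly; quadratic decay suffices. -/
lemma exists_kerFT_bound (hA : ContDiff ℝ ∞ A) (hc : HasCompactSupport A) :
    ∃ C, 0 ≤ C ∧ ∀ t, ‖kerFT A t‖ ≤ C * (1 + t ^ 2)⁻¹ := by
  obtain ⟨f, hf⟩ := exists_schwartz hA hc
  obtain ⟨C0, hC0, h0⟩ := (𝓕 f).decay 0 0
  obtain ⟨C2, hC2, h2⟩ := (𝓕 f).decay 2 0
  refine ⟨C0 + C2, by positivity, fun t => ?_⟩
  have hk : kerFT A t = 𝓕 f t := by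
    rw [kerFT_eq_fourier, ← hf, ← SchwartzMap.fourier_coe]
  have h0' := h0 t
  have h2' := h2 t
  rw [norm_iteratedFDeriv_zero] at h0' h2'
  rw [Real.norm_eq_abs, sq_abs] at h2'
  rw [hk, ← div_eq_mul_inv, le_div_iff₀ (by positivity)]
  linarith

lemma summable_inv_one_add_sq : Summable fun y : ℤ => (1 + (y : ℝ) ^ 2)⁻¹ := by
  have h : Summable fun y : ℤ => 1 / (y : ℝ) ^ 2 := Real.summable_one_div_int_pow.2 (by norm_num)
  refine h.of_norm_bounded_eventually ?_
  filter_upwards [(Set.finite_singleton (0 : ℤ)).compl_mem_cofinite] with y hy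
  have hy0 : (y : ℝ) ≠ 0 := by exact_mod_cast hy
  rw [Real.norm_of_nonneg (by positivity), one_div]
  exact inv_anti₀ (by positivity) (by linarith)

/-- A summable majorant of the kernel, uniform under bounded translations. -/
lemma exists_kerFT_majorant (hA : ContDiff ℝ ∞ A) (hc : HasCompactSupport A) :
    ∃ k : ℤ → ℝ, Summable k ∧ (∀ y, 0 ≤ k y) ∧
      ∀ (y : ℤ) (δ : ℝ), |δ| ≤ 2 → ‖kerFT A (δ + y)‖ ≤ k y := by
  obtain ⟨C, hC, h⟩ := exists_kerFT_bound hA hc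
  refine ⟨fun y => C * 9 * (1 + (y : ℝ) ^ 2)⁻¹, summable_inv_one_add_sq.mul_left _,
    fun y => by positivity, fun y δ hδ => (h _).trans ?_⟩
  change _ ≤ C * 9 * (1 + (y : ℝ) ^ 2)⁻¹
  rw [mul_assoc]
  refine mul_le_mul_of_nonneg_left ?_ hC
  rw [← div_eq_mul_inv, le_div_iff₀ (by positivity), inv_mul_le_iff₀ (by positivity)]
  have h1 : δ ^ 2 ≤ 4 := by
    rw [← sq_abs]; nlinarith [abs_nonneg δ]
  nlinarith [sq_nonneg (2 * δ + y), sq_nonneg (δ + y)]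

lemma abs_sub_ceil_le (s : ℝ) : |s - ⌈s⌉| ≤ 1 := by
  rw [abs_le]
  exact ⟨by linarith [Int.ceil_lt_add_one s], by linarith [Int.le_ceil s]⟩

/-- The convolution recentred at the integer `-n`; with `n = ⌈s⌉` the kernel has the majorant of
`exists_kerFT_majorant` for all `s`. -/
lemma locFT_eq_shift (A : ℝ → E →L[ℂ] E) (u : ℤ → E) (s : ℝ) (n : ℤ) :
    locFT A u s = ∑' y : ℤ, kerFT A (s - n + y) (u (y - n)) := by
  rw [locFT_eq, ← (Equiv.subRight n).tsum_eq]
  refine tsum_congr fun y => ?_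
  rw [Equiv.subRight_apply]
  congr 2
  push_cast; ring

section

variable {u w : ℤ → E} {B C : ℝ}

lemma summable_locFT (hA : ContDiff ℝ ∞ A) (hc : HasCompactSupport A) (hu : ∀ x, ‖u x‖ ≤ B)
    (s : ℝ) : Summable fun x : ℤ => kerFT A (s + x) (u x) := by
  obtain ⟨k, hk, hk0, hle⟩ := exists_kerFT_majorant hA hc
  rw [← (Equiv.subRight ⌈s⌉).summable_iff]
  refine Summable.of_norm_bounded (hk.mul_right B) fun y => ?_
  refine (ContinuousLinearMap.le_opNorm _ _).trans ?_
  refine mul_le_mul ?_ (hu _) (norm_nonneg _) (hk0 y)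
  rw [Equiv.subRight_apply, show s + ((y - ⌈s⌉ : ℤ) : ℝ) = s - ⌈s⌉ + y by push_cast; ring]
  exact hle y _ ((abs_sub_ceil_le s).trans (by norm_num))

lemma norm_kerFT_apply_le {k : ℤ → ℝ} (hk0 : ∀ y, 0 ≤ k y)
    (hle : ∀ (y : ℤ) (δ : ℝ), |δ| ≤ 2 → ‖kerFT A (δ + y)‖ ≤ k y) {δ : ℝ} (hδ : |δ| ≤ 2) (y : ℤ)
    {v : E} (hv : ‖v‖ ≤ B) : ‖kerFT A (δ + y) v‖ ≤ k y * B :=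
  (ContinuousLinearMap.le_opNorm _ _).trans (mul_le_mul (hle y δ hδ) hv (norm_nonneg _) (hk0 y))

lemma exists_locFT_bound (hA : ContDiff ℝ ∞ A) (hc : HasCompactSupport A)
    (hu : ∀ x, ‖u x‖ ≤ B) : ∃ K, ∀ s, ‖locFT A u s‖ ≤ K := by
  obtain ⟨k, hk, hk0, hle⟩ := exists_kerFT_majorant hA hc
  refine ⟨∑' y, k y * B, fun s => ?_⟩
  rw [locFT_eq_shift A u s ⌈s⌉]
  exact tsum_of_norm_bounded (hk.mul_right B).hasSum fun y =>
    norm_kerFT_apply_le hk0 hle ((abs_sub_ceil_le s).trans (by norm_num)) y (hu _)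

lemma continuous_locFT (hA : ContDiff ℝ ∞ A) (hc : HasCompactSupport A)
    (hu : ∀ x, ‖u x‖ ≤ B) : Continuous (locFT A u) := by
  obtain ⟨k, hk, hk0, hle⟩ := exists_kerFT_majorant hA hc
  rw [continuous_iff_continuousAt]
  intro s₀
  have h : locFT A u = fun s => ∑' y : ℤ, kerFT A (s - ⌈s₀⌉ + y) (u (y - ⌈s₀⌉)) := by
    funext s; exact locFT_eq_shift A u s _
  rw [h]
  refine tendsto_tsum_of_dominated_convergence (hk.mul_right B) (fun y => ?_) ?_
  · have h1 : Continuous fun s : ℝ => kerFT A (s - ⌈s₀⌉ + y) (u (y - ⌈s₀⌉)) := by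
      have := continuous_kerFT hA hc
      fun_prop
    exact h1.tendsto s₀
  · filter_upwards [Metric.ball_mem_nhds s₀ one_pos] with s hs y
    refine norm_kerFT_apply_le hk0 hle ?_ y (hu _)
    rw [Metric.mem_ball, Real.dist_eq] at hs
    calc |s - ⌈s₀⌉| = |(s - s₀) + (s₀ - ⌈s₀⌉)| := by ring_nf
      _ ≤ |s - s₀| + |s₀ - ⌈s₀⌉| := abs_add_le _ _
      _ ≤ 2 := by linarith [abs_sub_ceil_le s₀]

/-- A bounded sequence that vanishes at one end of `ℤ` has a local Fourier transform that vanishes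
at the opposite end of `ℝ`. -/
lemma tendsto_locFT_zero (hA : ContDiff ℝ ∞ A) (hc : HasCompactSupport A)
    (hu : ∀ x, ‖u x‖ ≤ B) {l : Filter ℝ} (hl : ∀ y : ℤ, Tendsto (fun s => u (y - ⌈s⌉)) l (𝓝 0)) :
    Tendsto (locFT A u) l (𝓝 0) := by
  obtain ⟨k, hk, hk0, hle⟩ := exists_kerFT_majorant hA hc
  have h : locFT A u = fun s => ∑' y : ℤ, kerFT A (s - ⌈s⌉ + y) (u (y - ⌈s⌉)) := by
    funext s; exact locFT_eq_shift A u s _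
  rw [h, show (0 : E) = ∑' _ : ℤ, (0 : E) from tsum_zero.symm]
  refine tendsto_tsum_of_dominated_convergence (hk.mul_right B) (fun y => ?_)
    (Eventually.of_forall fun s y =>
      norm_kerFT_apply_le hk0 hle ((abs_sub_ceil_le s).trans (by norm_num)) y (hu _))
  refine squeeze_zero_norm (fun s => norm_kerFT_apply_le hk0 hle
    ((abs_sub_ceil_le s).trans (by norm_num)) y le_rfl) ?_
  simpa using ((hl y).norm).const_mul (k y)

/-- Pointwise convergence with a uniform bound is preserved by the local Fourier transform. -/
lemma tendsto_locFT {ι : Type*} {l : Filter ι} {v : ι → ℤ → E} (hA : ContDiff ℝ ∞ A)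
    (hc : HasCompactSupport A) (hv : ∀ᶠ i in l, ∀ x, ‖v i x‖ ≤ B)
    (hlim : ∀ x, Tendsto (fun i => v i x) l (𝓝 (u x))) (s : ℝ) :
    Tendsto (fun i => locFT A (v i) s) l (𝓝 (locFT A u s)) := by
  obtain ⟨k, hk, hk0, hle⟩ := exists_kerFT_majorant hA hc
  simp only [locFT_eq_shift A _ s ⌈s⌉]
  refine tendsto_tsum_of_dominated_convergence (hk.mul_right B) (fun y => ?_) ?_
  · exact ((kerFT A _).continuous.tendsto _).comp (hlim _)
  · filter_upwards [hv] with i hi y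
    exact norm_kerFT_apply_le hk0 hle ((abs_sub_ceil_le s).trans (by norm_num)) y (hi _)

lemma locFT_sub (hA : ContDiff ℝ ∞ A) (hc : HasCompactSupport A) (hu : ∀ x, ‖u x‖ ≤ B)
    (hw : ∀ x, ‖w x‖ ≤ C) (s : ℝ) : locFT A (u - w) s = locFT A u s - locFT A w s := by
  rw [locFT_eq, locFT_eq, locFT_eq,
    ← (summable_locFT hA hc hu s).tsum_sub (summable_locFT hA hc hw s)]
  simp only [Pi.sub_apply, map_sub]

end

lemma kerFT_apply (hA : Continuous A) (hc : HasCompactSupport A) (t : ℝ) (v : E) (i : Fin 2) :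
    (kerFT A t v) i
      = ∫ y : ℝ, cexp (((-2 * Real.pi * y * t : ℝ) : ℂ) * I) * (A (2 * Real.pi * y) v) i := by
  have hpi := Real.pi_pos
  have hint : Integrable (fun y : ℝ => cexp (((-2 * Real.pi * y * t : ℝ) : ℂ) * I) •
      A (2 * Real.pi * y)) := by
    refine Continuous.integrable_of_hasCompactSupport (by fun_prop) ?_
    have h2 : HasCompactSupport fun y => A (2 * Real.pi * y) :=
      hc.comp_homeomorph (Homeomorph.mulLeft₀ (2 * Real.pi) (by positivity))
    refine h2.mono fun y hy h0 => hy ?_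
    change cexp (((-2 * Real.pi * y * t : ℝ) : ℂ) * I) • A (2 * Real.pi * y) = 0
    replace h0 : A (2 * Real.pi * y) = 0 := h0
    ext w : 1
    rw [_root_.smul_apply, h0, _root_.zero_apply, smul_zero]
  rw [kerFT_eq_fourier, Real.fourier_real_eq_integral_exp_smul]
  let L : (E →L[ℂ] E) →L[ℂ] ℂ :=
    (EuclideanSpace.proj (𝕜 := ℂ) i).comp (ContinuousLinearMap.apply ℂ E v)
  exact (L.integral_comp_comm hint).symm

/-- Poisson summation: the local Fourier transform of a plane wave whose quasi-momentum meets the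
support of `A` only once. -/
lemma locFT_pw (hA : ContDiff ℝ ∞ A) (hc : HasCompactSupport A) {κ : ℝ} {v : E} {m : ℤ}
    (hm : ∀ n ≠ m, A (κ + 2 * Real.pi * n) v = 0) (s : ℝ) :
    locFT A (pw κ v) s
      = cexp (-I * s * ((κ + 2 * Real.pi * m : ℝ) : ℂ)) • A (κ + 2 * Real.pi * m) v := by
  have hpi := Real.pi_pos
  have hsum := summable_locFT hA hc (fun x => (norm_pw κ v x).le) s
  ext i
  let a : ℝ → ℂ := fun ξ => cexp (-I * s * ξ) * (A ξ v) i
  have hav : ContDiff ℝ ∞ fun ξ => A ξ v :=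
    ((ContinuousLinearMap.apply ℂ E v).restrictScalars ℝ).contDiff.comp hA
  have ha : ContDiff ℝ ∞ a := by
    have h1 : ContDiff ℝ ∞ fun x : ℝ => (x : ℂ) := Complex.ofRealCLM.contDiff
    have h2 : ContDiff ℝ ∞ fun ξ => (A ξ v) i :=
      ((EuclideanSpace.proj (𝕜 := ℂ) i).restrictScalars ℝ).contDiff.comp hav
    exact (contDiff_const.mul h1).cexp.mul h2
  have hac : HasCompactSupport a := by
    refine hc.mono fun ξ hξ => ?_
    rw [Function.mem_support] at hξ ⊢
    intro h0
    exact hξ (by simp [a, h0])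
  obtain ⟨f, hf⟩ := exists_schwartz ha hac
  have hpois := f.tsum_eq_tsum_fourier (κ / (2 * Real.pi))
  have hL : ∑' n : ℤ, f (κ / (2 * Real.pi) + n) = a (κ + 2 * Real.pi * m) := by
    have h1 : ∀ n : ℤ, f (κ / (2 * Real.pi) + n) = a (κ + 2 * Real.pi * n) := by
      intro n; rw [hf]; simp only
      congr 1; field_simp
    simp only [h1]
    refine tsum_eq_single m fun n hn => ?_
    simp [a, hm n hn]
  have hR : ∀ n : ℤ, (𝓕 f) n * fourier n ((κ / (2 * Real.pi) : ℝ) : UnitAddCircle)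
      = (kerFT A (s + n) (pw κ v n)) i := by
    intro n
    rw [SchwartzMap.fourier_coe, hf, fourier_coe_apply, op_pw, pw, PiLp.smul_apply,
      kerFT_apply hA.continuous hc, smul_eq_mul, mul_comm, Real.fourier_real_eq_integral_exp_smul]
    congr 1
    · congr 1; push_cast; field_simp
    · refine integral_congr_ae (Eventually.of_forall fun y => ?_)
      simp only [a, smul_eq_mul]
      rw [← mul_assoc, ← Complex.exp_add]
      congr 2
      push_cast; ring
  rw [locFT_eq]
  have h3 : (∑' x : ℤ, kerFT A (s + x) (pw κ v x)) i
      = ∑' x : ℤ, (kerFT A (s + x) (pw κ v x)) i :=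
    (EuclideanSpace.proj (𝕜 := ℂ) i).map_tsum hsum
  rw [h3, ← tsum_congr hR, ← hpois, hL]
  rfl

/-- The local Fourier transform of a plane wave is quasi-periodic. -/
lemma locFT_pw_add (A : ℝ → E →L[ℂ] E) (κ : ℝ) (v : E) (s : ℝ) (n : ℤ) :
    locFT A (pw κ v) (s + n) = cexp (-I * ((κ * n : ℝ) : ℂ)) • locFT A (pw κ v) s := by
  rw [locFT_eq_shift A _ (s + n) n, locFT_eq, ← tsum_const_smul'']
  refine tsum_congr fun y => ?_
  rw [add_sub_cancel_right, ← map_smul]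
  congr 1
  rw [pw, pw, smul_smul, ← Complex.exp_add]
  congr 2
  push_cast; ring

/-- The two ends of `ℝ`, `+∞` for `ν = 1` and `-∞` for `ν = -1`. -/
def dirR (ν : ℤˣ) : Filter ℝ := if ν = 1 then atTop else atBot

lemma tendsto_sub_ceil (ν : ℤˣ) (y : ℤ) :
    Tendsto (fun s : ℝ => y - ⌈s⌉) (dirR ν) (dirZ (-ν)) := by
  rcases Int.units_eq_one_or ν with rfl | rfl
  · change Tendsto (fun s : ℝ => y - ⌈s⌉) atTop atBot
    exact tendsto_atBot_add_const_left _ y (tendsto_neg_atTop_atBot.comp tendsto_ceil_atTop)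
  · change Tendsto (fun s : ℝ => y - ⌈s⌉) atBot atTop
    exact tendsto_atTop_add_const_left _ y (tendsto_neg_atBot_atTop.comp tendsto_ceil_atBot)

/-- The asymptotics of the local Fourier transform at one end of `ℝ` depend only on the
asymptotics of the sequence at the opposite end of `ℤ`. -/
lemma tendsto_locFT_sub_sum (hA : ContDiff ℝ ∞ A) (hc : HasCompactSupport A) {u : ℤ → E} {B : ℝ}
    (hu : ∀ x, ‖u x‖ ≤ B) {ν : ℤˣ} {κ : ℤˣ → ℝ} {v : ℤˣ → E}
    (h : Tendsto (fun x => u x - ∑ σ, pw (κ σ) (v σ) x) (dirZ (-ν)) (𝓝 0)) :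
    Tendsto (fun s => locFT A u s - ∑ σ, locFT A (pw (κ σ) (v σ)) s) (dirR ν) (𝓝 0) := by
  have hp : ∀ σ x, ‖pw (κ σ) (v σ) x‖ ≤ ‖v σ‖ := fun σ x => (norm_pw _ _ _).le
  have h1 : ∀ x, ‖(u - pw (κ 1) (v 1)) x‖ ≤ B + ‖v 1‖ := fun x =>
    (norm_sub_le _ _).trans (add_le_add (hu x) (hp 1 x))
  have h2 : ∀ x, ‖(u - pw (κ 1) (v 1) - pw (κ (-1)) (v (-1))) x‖ ≤ B + ‖v 1‖ + ‖v (-1)‖ :=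
    fun x => (norm_sub_le _ _).trans (add_le_add (h1 x) (hp (-1) x))
  have h3 : ∀ s, locFT A u s - ∑ σ, locFT A (pw (κ σ) (v σ)) s
      = locFT A (u - pw (κ 1) (v 1) - pw (κ (-1)) (v (-1))) s := by
    intro s
    rw [locFT_sub hA hc h1 (hp (-1)), locFT_sub hA hc hu (hp 1), sum_units]
    abel
  simp only [h3]
  refine tendsto_locFT_zero hA hc h2 fun y => ?_
  refine (h.comp (tendsto_sub_ceil ν y)).congr fun s => ?_
  rw [Function.comp, sum_units, Pi.sub_apply, Pi.sub_apply]
  abel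

/-! ### Mean squares -/

/-- A bounded function that tends to zero at infinity on `S` has vanishing mean squares over `S`. -/
lemma tendsto_mean_sq {S : Set ℝ} (hS : MeasurableSet S) {F : ℝ → E} {B : ℝ}
    (hB : ∀ s, ‖F s‖ ≤ B) (hF : ∀ ε > 0, ∃ T, ∀ s ∈ S, T < |s| → ‖F s‖ ≤ ε) :
    Tendsto (fun R : ℝ => ENNReal.ofReal R⁻¹ * ∫⁻ s in {s : ℝ | |s| < R ∧ s ∈ S}, ‖F s‖ₑ ^ 2)
      atTop (𝓝 0) := by
  have hB0 : 0 ≤ B := (norm_nonneg _).trans (hB 0)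
  rw [ENNReal.tendsto_nhds_zero]
  intro η hη
  obtain ⟨δ, hδ, hδη⟩ : ∃ δ : ℝ, 0 < δ ∧ ENNReal.ofReal δ ≤ η := by
    obtain ⟨x, hx0, hx⟩ := ENNReal.lt_iff_exists_real_btwn.1 hη
    exact ⟨x, ENNReal.ofReal_pos.1 hx.1, hx.2.le⟩
  obtain ⟨T, hT⟩ := hF (√(δ / 4)) (by positivity)
  have hev : ∀ᶠ R : ℝ in atTop, 2 * |T| * B ^ 2 * R⁻¹ ≤ δ / 2 := by
    have h1 : Tendsto (fun R : ℝ => 2 * |T| * B ^ 2 * R⁻¹) atTop (𝓝 0) := by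
      have h2 := (tendsto_inv_atTop_zero (𝕜 := ℝ)).const_mul (2 * |T| * B ^ 2)
      rwa [mul_zero] at h2
    exact h1.eventually (ge_mem_nhds (by positivity))
  filter_upwards [hev, eventually_gt_atTop 0] with R hR hR0
  refine le_trans ?_ hδη
  have hmeas : MeasurableSet {s : ℝ | |s| < R ∧ s ∈ S} :=
    (measurableSet_lt measurable_norm measurable_const).inter hS
  have hpt : ∀ s ∈ {s : ℝ | |s| < R ∧ s ∈ S}, ‖F s‖ₑ ^ 2
      ≤ ENNReal.ofReal (δ / 4)
        + (Icc (-|T|) |T|).indicator (fun _ => ENNReal.ofReal (B ^ 2)) s := by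
    rintro s ⟨-, hs⟩
    rw [← ofReal_norm, ← ENNReal.ofReal_pow (norm_nonneg _)]
    by_cases hsT : s ∈ Icc (-|T|) |T|
    · rw [indicator_of_mem hsT]
      exact le_add_left (ENNReal.ofReal_le_ofReal (pow_le_pow_left₀ (norm_nonneg _) (hB s) 2))
    · rw [indicator_of_notMem hsT, add_zero]
      refine ENNReal.ofReal_le_ofReal ?_
      have h2 : T < |s| := by
        by_contra hcon
        exact hsT (abs_le.1 ((not_lt.1 hcon).trans (le_abs_self T)))
      calc ‖F s‖ ^ 2 ≤ √(δ / 4) ^ 2 := pow_le_pow_left₀ (norm_nonneg _) (hT s hs h2) 2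
        _ = δ / 4 := Real.sq_sqrt (by positivity)
  have hsub : {s : ℝ | |s| < R ∧ s ∈ S} ⊆ Icc (-R) R := fun s hs => abs_le.1 hs.1.le
  calc ENNReal.ofReal R⁻¹ * ∫⁻ s in {s : ℝ | |s| < R ∧ s ∈ S}, ‖F s‖ₑ ^ 2
      ≤ ENNReal.ofReal R⁻¹ * (ENNReal.ofReal (δ / 4) * ENNReal.ofReal (2 * R)
        + ENNReal.ofReal (B ^ 2) * ENNReal.ofReal (2 * |T|)) := by
        gcongr
        refine (setLIntegral_mono' hmeas hpt).trans ?_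
        rw [lintegral_add_left measurable_const]
        refine add_le_add ?_ ?_
        · rw [setLIntegral_const]
          gcongr
          refine (measure_mono hsub).trans ?_
          rw [Real.volume_Icc]
          exact ENNReal.ofReal_le_ofReal (by linarith)
        · refine (setLIntegral_le_lintegral _ _).trans ?_
          rw [lintegral_indicator measurableSet_Icc, setLIntegral_const, Real.volume_Icc]
          gcongr
          linarith
    _ = ENNReal.ofReal (δ / 2 + 2 * |T| * B ^ 2 * R⁻¹) := by
        rw [← ENNReal.ofReal_mul (by positivity), ← ENNReal.ofReal_mul (by positivity),
          ← ENNReal.ofReal_add (by positivity) (by positivity),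
          ← ENNReal.ofReal_mul (by positivity)]
        congr 1
        field_simp
        ring
    _ ≤ ENNReal.ofReal δ := ENNReal.ofReal_le_ofReal (by linarith)

/-- A bounded function that tends to zero at both ends of `ℝ` is the Fourier transform of an element
of `𝓑₀*(ℝ)`. -/
lemma isB0star_of_tendsto {F : ℝ → E} {B : ℝ} (hB : ∀ s, ‖F s‖ ≤ B)
    (hF : ∀ ν, Tendsto F (dirR ν) (𝓝 0)) : IsB0star F := by
  have hB0 : 0 ≤ B := (norm_nonneg _).trans (hB 0)
  constructor
  · refine lt_of_le_of_lt (b := ENNReal.ofReal (2 * B ^ 2)) ?_ ENNReal.ofReal_lt_top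
    refine iSup_le fun R => ?_
    have hR : 0 < (R : ℝ) := one_pos.trans R.2
    calc ENNReal.ofReal (R : ℝ)⁻¹ * ∫⁻ s in {s : ℝ | |s| < R}, ‖F s‖ₑ ^ 2
        ≤ ENNReal.ofReal (R : ℝ)⁻¹ * (ENNReal.ofReal (B ^ 2) * ENNReal.ofReal (2 * R)) := by
          gcongr
          calc ∫⁻ s in {s : ℝ | |s| < R}, ‖F s‖ₑ ^ 2
              ≤ ∫⁻ _ in {s : ℝ | |s| < R}, ENNReal.ofReal (B ^ 2) := by
                refine lintegral_mono fun s => ?_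
                rw [← ofReal_norm, ← ENNReal.ofReal_pow (norm_nonneg _)]
                exact ENNReal.ofReal_le_ofReal (pow_le_pow_left₀ (norm_nonneg _) (hB s) 2)
            _ ≤ _ := by
                rw [setLIntegral_const]
                gcongr
                have hsub : {s : ℝ | |s| < R} ⊆ Icc (-R : ℝ) R := fun s hs => abs_le.1 (le_of_lt hs)
                refine (measure_mono hsub).trans ?_
                rw [Real.volume_Icc]
                exact ENNReal.ofReal_le_ofReal (by linarith)
      _ = ENNReal.ofReal (2 * B ^ 2) := by
          rw [← ENNReal.ofReal_mul (by positivity), ← ENNReal.ofReal_mul (by positivity)]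
          congr 1
          field_simp
  · have h := tendsto_mean_sq (S := univ) MeasurableSet.univ hB fun ε hε => by
      have h1 : ∀ᶠ s in atTop, ‖F s‖ ≤ ε :=
        ((hF 1).norm.eventually (ge_mem_nhds (by simpa using hε)))
      have h2 : ∀ᶠ s in atBot, ‖F s‖ ≤ ε :=
        ((hF (-1)).norm.eventually (ge_mem_nhds (by simpa using hε)))
      obtain ⟨a, ha⟩ := eventually_atTop.1 h1
      obtain ⟨b, hb⟩ := eventually_atBot.1 h2
      refine ⟨max a (-b), fun s _ hs => ?_⟩
      rcases le_total 0 s with h0 | h0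
      · rw [abs_of_nonneg h0] at hs
        exact ha s ((le_max_left _ _).trans hs.le)
      · rw [abs_of_nonpos h0] at hs
        exact hb s (by linarith [le_max_right a (-b)])
    simpa using h

lemma tendsto_mean_sq_dir {F : ℝ → E} {B : ℝ} (hB : ∀ s, ‖F s‖ ≤ B) {ν : ℤˣ}
    (hF : Tendsto F (dirR ν) (𝓝 0)) :
    Tendsto (fun R : ℝ => ENNReal.ofReal R⁻¹ *
      ∫⁻ s in {s : ℝ | |s| < R ∧ 0 < ((ν : ℤ) : ℝ) * s}, ‖F s‖ₑ ^ 2) atTop (𝓝 0) := by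
  refine tendsto_mean_sq (S := {s : ℝ | 0 < ((ν : ℤ) : ℝ) * s})
    (measurableSet_lt measurable_const (by fun_prop)) hB fun ε hε => ?_
  have h1 : ∀ᶠ s in dirR ν, ‖F s‖ ≤ ε := hF.norm.eventually (ge_mem_nhds (by simpa using hε))
  rcases Int.units_eq_one_or ν with rfl | rfl
  · obtain ⟨a, ha⟩ := eventually_atTop.1 h1
    refine ⟨a, fun s hs hsa => ha s ?_⟩
    have : 0 < s := by simpa using hs
    rw [abs_of_pos this] at hsa
    exact hsa.le
  · obtain ⟨a, ha⟩ := eventually_atBot.1 h1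
    refine ⟨-a, fun s hs hsa => ha s ?_⟩
    have : s < 0 := by simpa using hs
    rw [abs_of_neg this] at hsa
    linarith

lemma exists_threshold {ν : ℤˣ} {p : ℝ → Prop} (h : ∀ᶠ s in dirR ν, p s) :
    ∃ T, 0 ≤ T ∧ ∀ s : ℝ, T < ((ν : ℤ) : ℝ) * s → p s := by
  rcases Int.units_eq_one_or ν with rfl | rfl
  · obtain ⟨a, ha⟩ := eventually_atTop.1 h
    refine ⟨|a|, abs_nonneg a, fun s hs => ha s ?_⟩
    have : |a| < s := by simpa using hs
    exact (le_abs_self a).trans this.le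
  · obtain ⟨a, ha⟩ := eventually_atBot.1 h
    refine ⟨|a|, abs_nonneg a, fun s hs => ha s ?_⟩
    have : |a| < -s := by simpa using hs
    linarith [neg_abs_le a]

/-- The mean square over a half-line does not tend to zero if `‖F(s)‖² + ‖F(s + ν)‖²` stays away
from zero. -/
lemma not_tendsto_mean_sq {F : ℝ → E} (hF : Continuous F) {ν : ℤˣ} {m : ℝ} (hm : 0 < m)
    (h : ∀ᶠ s in dirR ν, m ≤ ‖F s‖ ^ 2 + ‖F (s + ((ν : ℤ) : ℝ))‖ ^ 2) :
    ¬ Tendsto (fun R : ℝ => ENNReal.ofReal R⁻¹ *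
      ∫⁻ s in {s : ℝ | |s| < R ∧ 0 < ((ν : ℤ) : ℝ) * s}, ‖F s‖ₑ ^ 2) atTop (𝓝 0) := by
  intro hlim
  obtain ⟨T, hT0, hT⟩ := exists_threshold h
  set t : ℝ := ((ν : ℤ) : ℝ) with ht
  have htt : t * t = 1 := Coin.units_sq ν
  have ht1 : |t| = 1 := by
    rcases Coin.units_cases ν with h | h <;> rw [ht, h] <;> simp
  let S : ℝ → Set ℝ := fun R => {s : ℝ | |s| < R ∧ 0 < t * s}
  let g : ℝ → ENNReal := fun s => ‖F s‖ₑ ^ 2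
  have hg : Measurable g := (hF.measurable.enorm).pow_const 2
  let Φ : ℝ → ENNReal := fun R => ∫⁻ s in S R, g s
  have hS : ∀ R, MeasurableSet (S R) := fun R =>
    (measurableSet_lt measurable_norm measurable_const).inter
      (measurableSet_lt (g := fun s : ℝ => t * s) measurable_const (by fun_prop))
  have hmono : ∀ R, Φ R ≤ Φ (R + 1) := fun R =>
    lintegral_mono_set fun s hs => ⟨hs.1.trans (by linarith), hs.2⟩
  have hshift : ∀ R, ∫⁻ s in S R, g (s + t) ≤ Φ (R + 1) := by
    intro R
    change _ ≤ ∫⁻ s in S (R + 1), g s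
    rw [← lintegral_indicator (hS R), ← lintegral_indicator (hS (R + 1)),
      ← lintegral_add_right_eq_self ((S (R + 1)).indicator g) t]
    refine lintegral_mono fun s => ?_
    by_cases hs : s ∈ S R
    · have hs' : s + t ∈ S (R + 1) := by
        refine ⟨(abs_add_le _ _).trans_lt (by linarith [hs.1]), ?_⟩
        have := hs.2
        rw [mul_add, htt]
        linarith
      rw [indicator_of_mem hs, indicator_of_mem hs']
    · rw [indicator_of_notMem hs]
      exact zero_le
  have hlow : ∀ R, T < R → ENNReal.ofReal (m * (R - T)) ≤ 2 * Φ (R + 1) := by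
    intro R hR
    have hvol : ENNReal.ofReal (R - T) ≤ volume {s | |s| < R ∧ T < t * s} := by
      rcases Coin.units_cases ν with h1 | h1
      · have hsub : Ioo T R ⊆ {s | |s| < R ∧ T < t * s} := fun s hs => by
          refine ⟨?_, by rw [ht, h1]; linarith [hs.1]⟩
          rw [abs_of_pos (by linarith [hs.1])]; exact hs.2
        refine le_trans ?_ (measure_mono hsub)
        rw [Real.volume_Ioo]
      · have hsub : Ioo (-R) (-T) ⊆ {s | |s| < R ∧ T < t * s} := fun s hs => by
          refine ⟨?_, by rw [ht, h1]; linarith [hs.2]⟩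
          rw [abs_of_neg (by linarith [hs.2])]; linarith [hs.1]
        refine le_trans ?_ (measure_mono hsub)
        rw [Real.volume_Ioo]
        exact ENNReal.ofReal_le_ofReal (by linarith)
    have hmeas : MeasurableSet {s | |s| < R ∧ T < t * s} :=
      (measurableSet_lt measurable_norm measurable_const).inter
        (measurableSet_lt (g := fun s : ℝ => t * s) measurable_const (by fun_prop))
    calc ENNReal.ofReal (m * (R - T)) = ENNReal.ofReal m * ENNReal.ofReal (R - T) :=
          ENNReal.ofReal_mul hm.le
      _ ≤ ∫⁻ _ in {s | |s| < R ∧ T < t * s}, ENNReal.ofReal m := by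
          rw [setLIntegral_const]; gcongr
      _ ≤ ∫⁻ s in {s | |s| < R ∧ T < t * s}, (g s + g (s + t)) := by
          refine setLIntegral_mono' hmeas fun s hs => ?_
          simp only [g]
          rw [← ofReal_norm, ← ofReal_norm,
            ← ENNReal.ofReal_pow (norm_nonneg _), ← ENNReal.ofReal_pow (norm_nonneg _),
            ← ENNReal.ofReal_add (by positivity) (by positivity)]
          exact ENNReal.ofReal_le_ofReal (hT s hs.2)
      _ ≤ ∫⁻ s in S R, (g s + g (s + t)) :=
          lintegral_mono_set fun s hs => ⟨hs.1, hT0.trans_lt hs.2⟩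
      _ = Φ R + ∫⁻ s in S R, g (s + t) := lintegral_add_left hg _
      _ ≤ Φ (R + 1) + Φ (R + 1) := add_le_add (hmono R) (hshift R)
      _ = 2 * Φ (R + 1) := (two_mul _).symm
  -- `2 Φ (R + 1) ≥ m (R - T)`, while the limit makes it at most `m (R + 1) / 4` for large `R`
  have hev := (hlim.comp (tendsto_atTop_add_const_right atTop 1 tendsto_id)).eventually
    (ge_mem_nhds (show (0 : ENNReal) < ENNReal.ofReal (m / 8) by
      rw [ENNReal.ofReal_pos]; positivity))
  obtain ⟨R, hR1, hR2⟩ := (hev.and (eventually_gt_atTop (2 * T + 2))).exists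
  have hR3 : Φ (R + 1) ≤ ENNReal.ofReal (m / 8 * (R + 1)) := by
    have h1 : ENNReal.ofReal (R + 1)⁻¹ * Φ (R + 1) ≤ ENNReal.ofReal (m / 8) := hR1
    have hpos : (0 : ℝ) < R + 1 := by linarith
    calc Φ (R + 1) = ENNReal.ofReal (R + 1) * (ENNReal.ofReal (R + 1)⁻¹ * Φ (R + 1)) := by
          rw [← mul_assoc, ← ENNReal.ofReal_mul hpos.le, mul_inv_cancel₀ hpos.ne',
            ENNReal.ofReal_one, one_mul]
      _ ≤ ENNReal.ofReal (R + 1) * ENNReal.ofReal (m / 8) := by gcongr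
      _ = _ := by rw [← ENNReal.ofReal_mul hpos.le, mul_comm]
  have h4 := hlow R (by linarith)
  have h5 : ENNReal.ofReal (m * (R - T)) ≤ ENNReal.ofReal (2 * (m / 8 * (R + 1))) := by
    refine h4.trans ?_
    rw [ENNReal.ofReal_mul zero_le_two, ENNReal.ofReal_ofNat]
    gcongr
  rw [ENNReal.ofReal_le_ofReal_iff (by nlinarith)] at h5
  nlinarith


/-! ### Wave front sets of asymptotically plane waves -/

namespace IsCutoff

variable {ξ₀ : ℝ} {χ : ℝ → ℂ}

lemma hasCompactSupport (h : IsCutoff ξ₀ χ) : HasCompactSupport χ := by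
  obtain ⟨-, δ, -, hδ⟩ := h
  exact isCompact_Icc.of_isClosed_subset (isClosed_tsupport _) hδ

lemma hasCompactSupport_smul (h : IsCutoff ξ₀ χ) (A : ℝ → E →L[ℂ] E) :
    HasCompactSupport fun ξ => χ ξ • A ξ := by
  refine h.hasCompactSupport.mono fun ξ hξ h0 => hξ ?_
  ext w : 1
  change (χ ξ • A ξ) w = 0
  rw [_root_.smul_apply, h0, zero_smul]

lemma eq_of_ne_zero (h : IsCutoff ξ₀ χ) {ξ : ℝ} {n m : ℤ} (hn : χ (ξ + 2 * Real.pi * n) ≠ 0)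
    (hm : χ (ξ + 2 * Real.pi * m) ≠ 0) : n = m := by
  obtain ⟨-, δ, hδ, hs⟩ := h
  have h1 := hs (subset_tsupport _ hn)
  have h2 := hs (subset_tsupport _ hm)
  have hpi := Real.pi_pos
  have h3 : (n : ℝ) - m < 1 := by
    by_contra hcon
    nlinarith [h1.1, h1.2, h2.1, h2.2]
  have h4 : (m : ℝ) - n < 1 := by
    by_contra hcon
    nlinarith [h1.1, h1.2, h2.1, h2.2]
  have h5 : n - m < 1 := by exact_mod_cast h3
  have h6 : m - n < 1 := by exact_mod_cast h4
  omega

end IsCutoff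

variable {ξ₀ : ℝ} {χ : ℝ → ℂ} {A : ℝ → E →L[ℂ] E}

/-- The local Fourier transform does not see a plane wave whose frequencies in the support of the
cut-off `χ` are annihilated by `A`. -/
lemma locFT_pw_eq_zero (hA : ContDiff ℝ ∞ fun ξ => χ ξ • A ξ) (hχ : IsCutoff ξ₀ χ) {κ : ℝ} {v : E}
    (h : ∀ n : ℤ, χ (κ + 2 * Real.pi * n) ≠ 0 → A (κ + 2 * Real.pi * n) v = 0) (s : ℝ) :
    locFT (fun ξ => χ ξ • A ξ) (pw κ v) s = 0 := by
  have h1 : ∀ n : ℤ, (χ (κ + 2 * Real.pi * n) • A (κ + 2 * Real.pi * n)) v = 0 := by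
    intro n
    rw [_root_.smul_apply]
    by_cases hn : χ (κ + 2 * Real.pi * n) = 0
    · rw [hn, zero_smul]
    · rw [h n hn, smul_zero]
  rw [locFT_pw hA (hχ.hasCompactSupport_smul A) (m := 0) (fun n _ => h1 n), h1, smul_zero]

lemma locFT_pw_of_mem (hA : ContDiff ℝ ∞ fun ξ => χ ξ • A ξ) (hχ : IsCutoff ξ₀ χ) {κ : ℝ} {v : E}
    {m : ℤ} (h : χ (κ + 2 * Real.pi * m) ≠ 0) (s : ℝ) :
    locFT (fun ξ => χ ξ • A ξ) (pw κ v) s = cexp (-I * s * ((κ + 2 * Real.pi * m : ℝ) : ℂ)) •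
      χ (κ + 2 * Real.pi * m) • A (κ + 2 * Real.pi * m) v := by
  have h1 : ∀ n ≠ m, (χ (κ + 2 * Real.pi * n) • A (κ + 2 * Real.pi * n)) v = 0 := by
    intro n hnm
    have hn : χ (κ + 2 * Real.pi * n) = 0 := by
      by_contra hn
      exact hnm (hχ.eq_of_ne_zero hn h)
    rw [_root_.smul_apply, hn, zero_smul]
  rw [locFT_pw hA (hχ.hasCompactSupport_smul A) h1, _root_.smul_apply]

/-- A smooth cut-off function that is `1` at the centre, supported in a given ball. -/
lemma exists_cutoff (ξ : ℝ) {r : ℝ} (hr : 0 < r) (hrπ : r < Real.pi) :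
    ∃ ψ : ℝ → ℂ, IsCutoff ξ ψ ∧ ψ ξ = 1 ∧ tsupport ψ ⊆ Metric.closedBall ξ r := by
  let f : ContDiffBump ξ := ⟨r / 2, r, by positivity, by linarith⟩
  have hsupp : tsupport (fun x => (f x : ℂ)) ⊆ Metric.closedBall ξ r := by
    have h1 : tsupport (fun x => (f x : ℂ)) ⊆ tsupport f :=
      closure_mono fun x hx h0 => hx (by simp only [h0, Complex.ofReal_zero])
    rwa [f.tsupport_eq] at h1
  refine ⟨fun x => (f x : ℂ), ⟨Complex.ofRealCLM.contDiff.comp f.contDiff, r, hrπ, ?_⟩, ?_, hsupp⟩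
  · rwa [Real.closedBall_eq_Icc] at hsupp
  · change ((f ξ : ℝ) : ℂ) = 1
    rw [f.one_of_mem_closedBall (Metric.mem_closedBall_self f.rIn_pos.le), Complex.ofReal_one]

lemma dirR_add (ν : ℤˣ) (a : ℝ) : Tendsto (fun s => s + a) (dirR ν) (dirR ν) := by
  rcases Int.units_eq_one_or ν with rfl | rfl
  · exact tendsto_atTop_add_const_right (atTop : Filter ℝ) a tendsto_id
  · exact tendsto_atBot_add_const_right (atBot : Filter ℝ) a tendsto_id

namespace Coin

variable {c : Coin} {j : Fin 2} {θ : ℝ}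

lemma isClosed_fermi (θ : ℝ) : IsClosed (c.fermi θ) := by
  have : c.fermi θ = {ξ | Real.cos (θ - c.γ / 2) = c.p * Real.cos (ξ + c.sh)} := by
    ext ξ; exact mem_fermi_iff c
  rw [this]
  exact isClosed_eq continuous_const (by fun_prop)

lemma InBand.sin_fermi_ne_zero (h : c.InBand j θ) {ξ : ℝ} (hξ : ξ ∈ c.fermi θ) :
    Real.sin (ξ + c.sh) ≠ 0 := by
  obtain ⟨ρ, n, rfl⟩ := h.mem_fermi.1 hξ
  have h1 := h.slope_kap ρ n
  intro h0
  rw [slope, show c.kap ρ θ + 2 * Real.pi * n + c.α - c.γ / 2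
    = c.kap ρ θ + 2 * Real.pi * n + c.sh by rw [sh]; ring, h0, Real.sign_zero] at h1
  rcases units_cases ρ with h2 | h2 <;> rw [h2] at h1 <;> norm_num at h1

/-- The set `M(θ)` is discrete. -/
lemma InBand.eventually_fermi (h : c.InBand j θ) (ξ : ℝ) :
    ∀ᶠ η in 𝓝 ξ, η ∈ c.fermi θ → η = ξ := by
  by_cases hξ : ξ ∈ c.fermi θ
  · have hd : HasDerivAt (fun η => c.p * Real.cos (η + c.sh)) (c.p * (-Real.sin (ξ + c.sh))) ξ := by
      have h1 := (Real.hasDerivAt_cos (ξ + c.sh)).comp_add_const ξ c.sh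
      exact h1.const_mul c.p
    have hne : c.p * (-Real.sin (ξ + c.sh)) ≠ 0 :=
      mul_ne_zero c.p_pos.ne' (neg_ne_zero.2 (h.sin_fermi_ne_zero hξ))
    have h2 := hd.eventually_ne hne (c := Real.cos (θ - c.γ / 2))
    filter_upwards [eventually_nhdsWithin_iff.1 h2] with η hη hmem
    by_contra hcon
    exact hη hcon ((mem_fermi_iff c).1 hmem).symm
  · filter_upwards [(isClosed_fermi θ).isOpen_compl.mem_nhds hξ] with η hη hmem
    exact absurd hmem hη

/-- A regular point has a neighbourhood of regular points containing no other point of `M(θ)`. -/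
lemma InBand.exists_isolating (h : c.InBand j θ) {ξ : ℝ} (hξ : ξ ∈ c.regular) :
    ∃ r, 0 < r ∧ r < Real.pi ∧ Metric.closedBall ξ r ⊆ c.regular ∧
      ∀ η ∈ Metric.closedBall ξ r, η ∈ c.fermi θ → η = ξ := by
  have h1 : ∀ᶠ η in 𝓝 ξ, η ∈ c.regular ∧ (η ∈ c.fermi θ → η = ξ) :=
    Filter.Eventually.and (c.isOpen_regular.mem_nhds hξ) (h.eventually_fermi ξ)
  obtain ⟨ε, hε, hball⟩ := Metric.eventually_nhds_iff_ball.1 h1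
  have hpi := Real.pi_pos
  have hlt : min (ε / 2) 1 < ε := (min_le_left _ _).trans_lt (by linarith)
  refine ⟨min (ε / 2) 1, by positivity,
    (min_le_right _ _).trans_lt (by linarith [Real.pi_gt_three]),
    fun η hη => (hball η ?_).1, fun η hη => (hball η ?_).2⟩ <;>
  exact (Metric.mem_closedBall.1 hη).trans_lt hlt

/-- If `u` is asymptotic to a sum of two plane waves at one end of `ℤ`, then the wave front set in
the opposite direction consists of the frequencies of the plane waves with non-zero amplitudes. -/
lemma InBand.mem_WFstar_iff (h : c.InBand j θ) {u : ℤ → E} {B : ℝ} (hu : ∀ x, ‖u x‖ ≤ B)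
    {ν : ℤˣ} {v : ℤˣ → E}
    (hlim : Tendsto (fun x => u x - ∑ σ, pw (c.kap σ θ) (v σ) x) (dirZ (-ν)) (𝓝 0))
    {ξ : ℝ} (hξ : ξ ∈ c.regular) (i : Fin 2) :
    (ξ, ν) ∈ WFstar (c.P i) u ↔
      ∃ (σ : ℤˣ) (n : ℤ), ξ = c.kap σ θ + 2 * Real.pi * n ∧ c.P i ξ (v σ) ≠ 0 := by
  constructor
  · contrapose!
    intro hv hWF
    apply hWF
    obtain ⟨r, hr, hrπ, hreg, hiso⟩ := h.exists_isolating hξ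
    obtain ⟨ψ, hψ, hψ1, hsupp⟩ := exists_cutoff ξ hr hrπ
    have hA := c.contDiff_smul_P i hψ.1 (hsupp.trans hreg)
    have hc := hψ.hasCompactSupport_smul (c.P i)
    obtain ⟨K, hK⟩ := exists_locFT_bound hA hc hu
    refine ⟨ψ, hψ, hA, hψ1, tendsto_mean_sq_dir hK ?_⟩
    refine (tendsto_locFT_sub_sum hA hc hu hlim).congr fun s => ?_
    have hz : ∀ σ, locFT (fun ξ => ψ ξ • c.P i ξ) (pw (c.kap σ θ) (v σ)) s = 0 := by
      intro σ
      refine locFT_pw_eq_zero hA hψ (fun n hn => ?_) s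
      have h1 := hiso _ (hsupp (subset_tsupport _ hn)) (h.mem_fermi.2 ⟨σ, n, rfl⟩)
      rw [h1]
      exact hv σ n h1.symm
    rw [Finset.sum_eq_zero fun σ _ => hz σ, sub_zero]
  · rintro ⟨σ, n, hσ, hne⟩ ⟨ψ, hψ, hA, hψ1, hT⟩
    change ψ ξ = 1 at hψ1
    change IsCutoff ξ ψ at hψ
    have hc := hψ.hasCompactSupport_smul (c.P i)
    set F := locFT (fun ξ => ψ ξ • c.P i ξ) u with hF
    set G : ℤˣ → ℝ → E := fun σ => locFT (fun ξ => ψ ξ • c.P i ξ) (pw (c.kap σ θ) (v σ)) with hG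
    have hD := tendsto_locFT_sub_sum hA hc hu hlim
    have hGσ : ∀ s, ‖G σ s‖ = ‖c.P i ξ (v σ)‖ := by
      intro s
      have h1 := locFT_pw_of_mem hA hψ (κ := c.kap σ θ) (v := v σ) (m := n)
        (by rw [← hσ, hψ1]; exact one_ne_zero) s
      rw [← hσ, hψ1, one_smul] at h1
      simp only [hG]
      rw [h1, norm_smul, show -I * (s : ℂ) * (ξ : ℂ) = I * ((-(s * ξ) : ℝ) : ℂ) by push_cast; ring,
        norm_exp_I_real, one_mul]
    -- both plane waves may have frequencies in `supp ψ`; as they are quasi-periodic with different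
    -- multipliers, `F (s + ν) - d (-σ) • F s` removes the one with index `-σ`
    set d : ℤˣ → ℂ := fun ρ => cexp (-I * ((c.kap ρ θ * ((ν : ℤ) : ℝ) : ℝ) : ℂ)) with hd
    have hshift : ∀ ρ s, G ρ (s + ((ν : ℤ) : ℝ)) = d ρ • G ρ s := fun ρ s =>
      locFT_pw_add _ _ _ s (ν : ℤ)
    have hdn : ∀ ρ, ‖d ρ‖ = 1 := by
      intro ρ
      simp only [hd]
      rw [neg_mul, ← mul_neg, ← Complex.ofReal_neg, norm_exp_I_real]
    have hdd : d σ - d (-σ) ≠ 0 := by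
      rw [sub_ne_zero]
      intro heq
      obtain ⟨m, hm⟩ := Complex.exp_eq_exp_iff_exists_int.1 heq
      have h1 : c.kap σ θ * ((ν : ℤ) : ℝ) = c.kap (-σ) θ * ((ν : ℤ) : ℝ) - 2 * Real.pi * m := by
        have h2 : I * ((c.kap σ θ * ((ν : ℤ) : ℝ) : ℝ) : ℂ)
            = I * ((c.kap (-σ) θ * ((ν : ℤ) : ℝ) - 2 * Real.pi * m : ℝ) : ℂ) := by
          push_cast at hm ⊢
          linear_combination -hm
        exact_mod_cast mul_left_cancel₀ I_ne_zero h2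
      have h3 : c.kap σ θ + 2 * Real.pi * (0 : ℤ)
          = c.kap (-σ) θ + 2 * Real.pi * (-((ν : ℤ) * m) : ℤ) := by
        have h4 := units_sq ν
        push_cast
        linear_combination ((ν : ℤ) : ℝ) * h1 + (c.kap (-σ) θ - c.kap σ θ) * h4
      have h5 : ((σ : ℤˣ) : ℤ) = ((-σ : ℤˣ) : ℤ) := by rw [← h.kap_injective h3]
      rcases Int.units_eq_one_or σ with rfl | rfl <;> norm_num at h5
    set K : ℝ := ‖d σ - d (-σ)‖ * ‖c.P i ξ (v σ)‖ with hK
    have hKpos : 0 < K := mul_pos (norm_pos_iff.2 hdd) (norm_pos_iff.2 hne)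
    refine not_tendsto_mean_sq (continuous_locFT hA hc hu) (ν := ν) (m := (K / 2) ^ 2 / 2)
      (by positivity) ?_ hT
    have hD2 : Tendsto (fun s => (F (s + ((ν : ℤ) : ℝ)) - ∑ ρ, G ρ (s + ((ν : ℤ) : ℝ)))
        - d (-σ) • (F s - ∑ ρ, G ρ s)) (dirR ν) (𝓝 0) := by
      have := (hD.comp (dirR_add ν ((ν : ℤ) : ℝ))).sub (hD.const_smul (d (-σ)))
      simpa using this
    have hev := hD2.norm.eventually (ge_mem_nhds (show ‖(0 : E)‖ < K / 2 by
      rw [norm_zero]; positivity))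
    filter_upwards [hev] with s hs
    have hsum : ∀ t, ∑ ρ, G ρ t = G σ t + G (-σ) t := by
      intro t
      rw [sum_units]
      rcases Int.units_eq_one_or σ with rfl | rfl
      · rfl
      · rw [neg_neg, add_comm]
    have hid : (d σ - d (-σ)) • G σ s = F (s + ((ν : ℤ) : ℝ)) - d (-σ) • F s
        - ((F (s + ((ν : ℤ) : ℝ)) - ∑ ρ, G ρ (s + ((ν : ℤ) : ℝ)))
        - d (-σ) • (F s - ∑ ρ, G ρ s)) := by
      rw [hsum, hsum, hshift, hshift]
      module
    have h1 : K ≤ ‖F (s + ((ν : ℤ) : ℝ))‖ + ‖F s‖ + K / 2 := by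
      calc K = ‖(d σ - d (-σ)) • G σ s‖ := by rw [norm_smul, hGσ]
        _ ≤ ‖F (s + ((ν : ℤ) : ℝ)) - d (-σ) • F s‖ + K / 2 := by
            rw [hid]
            exact (norm_sub_le _ _).trans (add_le_add_right hs _)
        _ ≤ _ := by
            gcongr
            refine (norm_sub_le _ _).trans (le_of_eq ?_)
            rw [norm_smul, hdn, one_mul]
    nlinarith [sq_nonneg (‖F (s + ((ν : ℤ) : ℝ))‖ - ‖F s‖), norm_nonneg (F s),
      norm_nonneg (F (s + ((ν : ℤ) : ℝ)))]

/-! ### The radiation condition -/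

lemma _root_.QW.fhat_periodic (f : ℤ → E) (ξ : ℝ) (n : ℤ) :
    fhat f (ξ + 2 * Real.pi * n) = fhat f ξ := by
  unfold fhat
  congr 1
  refine tsum_congr fun x => ?_
  congr 1
  refine Complex.exp_eq_exp_iff_exists_int.2 ⟨-(x * n), ?_⟩
  push_cast
  ring

lemma ampl_periodic (τ : ℤˣ) (θ : ℝ) (f : ℤ → E) (κ : ℝ) (n : ℤ) :
    c.ampl j τ θ f (κ + 2 * Real.pi * n) = c.ampl j τ θ f κ := by
  rw [ampl, ampl, P_periodic, fhat_periodic]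

lemma InBand.P_ampl_ne_zero_iff (h : c.InBand j θ) (τ : ℤˣ) (f : ℤ → E) {ξ : ℝ}
    (hξ : ξ ∈ c.regular) (i : Fin 2) :
    c.P i ξ (c.ampl j τ θ f ξ) ≠ 0 ↔ i = j ∧ c.P i ξ (fhat f ξ) ≠ 0 := by
  have hpi := Real.pi_pos
  rw [ampl, map_smul, smul_ne_zero_iff]
  have h0 : (((τ : ℤ) : ℂ) * c.dxi θ * cexp (-I * θ) * (√(2 * Real.pi) : ℂ)) ≠ 0 := by
    refine mul_ne_zero (mul_ne_zero (mul_ne_zero ?_ ?_) (Complex.exp_ne_zero _)) ?_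
    · exact_mod_cast τ.ne_zero
    · exact_mod_cast h.dxi_pos.ne'
    · rw [Complex.ofReal_ne_zero]; positivity
  by_cases hij : i = j
  · subst hij
    rw [P_P]
    exact ⟨fun h1 => ⟨rfl, h1.2⟩, fun h1 => ⟨h0, h1.2⟩⟩
  · rw [c.P_P_other hij hξ]
    exact ⟨fun h1 => absurd rfl h1.2, fun h1 => absurd h1.1 hij⟩

/-- The amplitudes of the plane waves `kap σ θ`, `σ = ±1`, in the asymptotics of `R₀(θ ± i0) f` at
the end `e` of `ℤ`; only one of the two is present. -/
def outAmpl (c : Coin) (j : Fin 2) (τ : ℤˣ) (θ : ℝ) (f : ℤ → E) (e σ : ℤˣ) : E :=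
  if σ = e * (τ * bsgn j) then c.ampl j τ θ f (c.kap σ θ) else 0

lemma InBand.tendsto_Rb_sub_sum (h : c.InBand j θ) (τ e : ℤˣ) (f : BZ) :
    Tendsto (fun x => (c.Rb τ θ f : ℤ → E) x
      - ∑ σ, pw (c.kap σ θ) (c.outAmpl j τ θ f e σ) x) (dirZ e) (𝓝 0) := by
  refine (h.tendsto_Rb τ e f).congr fun x => ?_
  rw [Finset.sum_eq_single (e * (τ * bsgn j)), outAmpl, if_pos rfl]
  · intro σ _ hσ
    rw [outAmpl, if_neg hσ, pw_zero]
  · intro h1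
    exact absurd (Finset.mem_univ _) h1

/-- The exact wave front sets of `R₀(θ ± i0) f`. -/
lemma InBand.mem_WFstar_Rb (h : c.InBand j θ) (τ : ℤˣ) (f : BZ) {ξ : ℝ} (hξ : ξ ∈ c.regular)
    (ν : ℤˣ) (i : Fin 2) : (ξ, ν) ∈ WFstar (c.P i) (c.Rb τ θ f) ↔
      θ ∈ c.band i ∧ ξ ∈ c.fermi θ ∧ c.P i ξ (fhat f ξ) ≠ 0 ∧
        ((ν : ℤ) : ℝ) = -(((τ * bsgn j : ℤˣ) : ℤ) : ℝ) * c.slope ξ := by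
  rw [h.mem_WFstar_iff (norm_Rb_le τ θ f) (h.tendsto_Rb_sub_sum τ (-ν) f) hξ, h.mem_band_iff]
  constructor
  · rintro ⟨σ, n, hσ, hne⟩
    rw [outAmpl] at hne
    split_ifs at hne with hσ2
    · rw [← ampl_periodic τ θ _ _ n, ← hσ, h.P_ampl_ne_zero_iff τ _ hξ] at hne
      refine ⟨hne.1, h.mem_fermi.2 ⟨σ, n, hσ⟩, hne.2, ?_⟩
      rw [hσ, h.slope_kap, hσ2]
      have h1 := units_sq (τ * bsgn j)
      push_cast at h1 ⊢
      linear_combination -((ν : ℤ) : ℝ) * h1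
    · exact absurd (map_zero _) hne
  · rintro ⟨hij, hf, hne, hν⟩
    obtain ⟨σ, n, hσ⟩ := h.mem_fermi.1 hf
    refine ⟨σ, n, hσ, ?_⟩
    rw [hσ, h.slope_kap] at hν
    have hσ2 : σ = -ν * (τ * bsgn j) := by
      apply units_cast_injective
      have h1 := units_sq (τ * bsgn j)
      push_cast at h1 hν ⊢
      rw [hν]
      linear_combination -((σ : ℤ) : ℝ) * h1
    rw [outAmpl, if_pos hσ2, ← ampl_periodic τ θ _ _ n, ← hσ, h.P_ampl_ne_zero_iff τ _ hξ]
    exact ⟨hij, hne⟩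

lemma InBand.radiation_Rb (h : c.InBand j θ) (τ : ℤˣ) (f : BZ) :
    c.Radiation τ θ (c.Rb τ θ f) := by
  intro ξ hξ d
  constructor <;> intro hd
  · obtain ⟨h1, h2, -, h3⟩ := (h.mem_WFstar_Rb τ f hξ d 0).1 hd
    obtain rfl := h.eq_of_mem h1
    exact ⟨h2, by simpa [bsgn] using h3⟩
  · obtain ⟨h1, h2, -, h3⟩ := (h.mem_WFstar_Rb τ f hξ d 1).1 hd
    obtain rfl := h.eq_of_mem h1
    exact ⟨h2, by simpa [bsgn] using h3⟩

/-- A solution of `(U₀ - e^{iθ})u = f` that satisfies the radiation condition is `R₀(θ ± i0) f`: the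
difference is a sum of two plane waves, each of which has the same amplitude at both ends of `ℤ` and
so contributes to the wave front set in both directions, one of which is excluded. -/
lemma InBand.eq_Rb (h : c.InBand j θ) (τ : ℤˣ) (f : BZ) {u : ℤ → E}
    (hu : c.U0 u - cexp (I * θ) • u = f) (hrad : c.Radiation τ θ u) :
    u = c.Rb τ θ f := by
  have hdiff : c.U0 (u - c.Rb τ θ f) - cexp (I * θ) • (u - (c.Rb τ θ f : ℤ → E)) = 0 := by
    have h1 := h.U0_Rb τ f
    rw [map_sub, smul_sub, sub_sub_sub_comm, hu, h1, sub_self]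
  obtain ⟨v, hv, heig⟩ := h.eq_sum_pw hdiff
  have hx : ∀ x, u x = (c.Rb τ θ f : ℤ → E) x + ∑ σ, pw (c.kap σ θ) (v σ) x := by
    intro x
    rw [← hv, Pi.sub_apply]; abel
  have hbd : ∀ x, ‖u x‖ ≤ c.resolvBound (cexp (I * θ)) (c.wb (τ * c.ssgn θ) θ)
      * ∑' y, ‖(f : ℤ → E) y‖ + ∑ σ, ‖v σ‖ := by
    intro x
    rw [hx]
    refine (norm_add_le _ _).trans (add_le_add (norm_Rb_le τ θ f x) ((norm_sum_le _ _).trans ?_))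
    exact Finset.sum_le_sum fun σ _ => (norm_pw _ _ _).le
  have hv0 : ∀ σ, v σ = 0 := by
    intro σ
    by_contra hne
    have hreg := h.regular_of_fermi (h.kap_mem_fermi σ)
    have hPv : c.P j (c.kap σ θ) (v σ) = v σ :=
      P_eq_self c (by rw [heig, h.lam_of_fermi (h.kap_mem_fermi σ)])
    -- the direction that the radiation condition excludes at the frequency `kap σ θ`
    set ν : ℤˣ := τ * bsgn j * σ with hν
    have hlim : Tendsto (fun x => u x - ∑ ρ, pw (c.kap ρ θ)
        (c.outAmpl j τ θ f (-ν) ρ + v ρ) x) (dirZ (-ν)) (𝓝 0) := by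
      refine (h.tendsto_Rb_sub_sum τ (-ν) f).congr fun x => ?_
      rw [hx]
      simp only [pw_add, Finset.sum_add_distrib]
      abel
    have hout : c.outAmpl j τ θ f (-ν) σ = 0 := by
      rw [outAmpl, if_neg]
      intro heq
      have h1 := congrArg (fun ρ : ℤˣ => ((ρ : ℤ) : ℝ)) heq
      have h2 := units_sq (τ * bsgn j)
      simp only [hν] at h1
      push_cast at h1 h2
      have h3 : ((σ : ℤ) : ℝ) = 0 := by linear_combination (1 / 2) * h1 - ((σ : ℤ) : ℝ) / 2 * h2
      rcases units_cases σ with h4 | h4 <;> rw [h4] at h3 <;> norm_num at h3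
    have hmem : (c.kap σ θ, ν) ∈ WFstar (c.P j) u := by
      rw [h.mem_WFstar_iff hbd hlim hreg]
      refine ⟨σ, 0, by simp, ?_⟩
      rw [hout, zero_add, hPv]
      exact hne
    have hs := h.slope_kap σ 0
    rw [Int.cast_zero, mul_zero, add_zero] at hs
    have hkey : ((ν : ℤ) : ℝ) = -(((τ * bsgn j : ℤˣ) : ℤ) : ℝ) * ((σ : ℤ) : ℝ) := by
      rw [← hs]
      have h1 := hrad _ hreg ν
      fin_cases j
      · simpa [bsgn] using (h1.1 hmem).2
      · simpa [bsgn] using (h1.2 hmem).2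
    rw [hν] at hkey
    push_cast at hkey
    rcases units_cases σ with h4 | h4 <;> rcases units_cases τ with h5 | h5 <;>
      rcases units_cases (bsgn j) with h6 | h6 <;> rw [h4, h5, h6] at hkey <;> norm_num at hkey
  funext x
  rw [hx, Finset.sum_eq_zero fun σ _ => by rw [hv0 σ, pw_zero], add_zero]

/-- Away from `M(θ)` the Fourier series of `R₀(θ ± i0) f` has no singularity. -/
lemma InBand.isB0star_Rb (h : c.InBand j θ) (τ : ℤˣ) (f : BZ) {ξ₀ : ℝ} {χ : ℝ → ℂ}
    (hχ : IsCutoff ξ₀ χ) (hs : tsupport χ ∩ c.fermi θ = ∅) :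
    IsB0star (locFT (fun ξ => χ ξ • (1 : E →L[ℂ] E)) (c.Rb τ θ f)) := by
  have hA : ContDiff ℝ ∞ fun ξ => χ ξ • (1 : E →L[ℂ] E) := hχ.1.smul contDiff_const
  have hc := hχ.hasCompactSupport_smul fun _ => (1 : E →L[ℂ] E)
  obtain ⟨K, hK⟩ := exists_locFT_bound hA hc (norm_Rb_le τ θ f)
  refine isB0star_of_tendsto hK fun ν => ?_
  refine (tendsto_locFT_sub_sum hA hc (norm_Rb_le τ θ f)
    (h.tendsto_Rb_sub_sum τ (-ν) f)).congr fun s => ?_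
  have hz : ∀ σ, locFT (fun ξ => χ ξ • (1 : E →L[ℂ] E))
      (pw (c.kap σ θ) (c.outAmpl j τ θ f (-ν) σ)) s = 0 := by
    intro σ
    refine locFT_pw_eq_zero (A := fun _ => (1 : E →L[ℂ] E)) hA hχ (fun n hn => ?_) s
    have : c.kap σ θ + 2 * Real.pi * n ∈ tsupport χ ∩ c.fermi θ :=
      ⟨subset_tsupport _ hn, h.mem_fermi.2 ⟨σ, n, rfl⟩⟩
    rw [hs] at this
    exact absurd this (notMem_empty _)
  rw [Finset.sum_eq_zero fun σ _ => hz σ, sub_zero]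

end Coin


/-! ### The local Fourier transform of a summable sequence -/

lemma summable_fhat {u : ℤ → E} (hu : Summable fun x => ‖u x‖) (ξ : ℝ) :
    Summable fun x : ℤ => cexp (-I * x * ξ) • u x := by
  refine Summable.of_norm_bounded hu fun x => ?_
  rw [norm_smul, show -I * (x : ℂ) * (ξ : ℂ) = I * ((-(x * ξ) : ℝ) : ℂ) by push_cast; ring,
    norm_exp_I_real, one_mul]

lemma fhat_single (e : E) (ξ : ℝ) :
    fhat (Pi.single 0 e) ξ = ((√(2 * Real.pi))⁻¹ : ℂ) • e := by
  rw [fhat, tsum_eq_single 0]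
  · simp
  · intro x hx
    rw [Pi.single_eq_of_ne hx, smul_zero]

lemma fhat_add {u v : ℤ → E} (hu : Summable fun x => ‖u x‖) (hv : Summable fun x => ‖v x‖)
    (ξ : ℝ) : fhat (u + v) ξ = fhat u ξ + fhat v ξ := by
  simp only [fhat, Pi.add_apply, smul_add]
  rw [(summable_fhat hu ξ).tsum_add (summable_fhat hv ξ), smul_add]

lemma fhat_smul (a : ℂ) (u : ℤ → E) (ξ : ℝ) : fhat (a • u) ξ = a • fhat u ξ := by
  simp only [fhat, Pi.smul_apply, smul_comm _ a]
  rw [tsum_const_smul'', smul_comm]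

lemma fhat_map (A : E →L[ℂ] E) {u : ℤ → E} (hu : Summable fun x => ‖u x‖) (ξ : ℝ) :
    fhat (fun x => A (u x)) ξ = A (fhat u ξ) := by
  rw [fhat, fhat, map_smul, A.map_tsum (summable_fhat hu ξ)]
  simp only [map_smul]

lemma fhat_shift (u : ℤ → E) (n : ℤ) (ξ : ℝ) :
    fhat (fun x => u (x + n)) ξ = cexp (I * (n * ξ)) • fhat u ξ := by
  rw [fhat, fhat, smul_comm, ← tsum_const_smul'' (cexp _), ← (Equiv.addRight n).tsum_eq
    (fun x : ℤ => cexp (I * (n * ξ)) • cexp (-I * x * ξ) • u x)]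
  congr 1
  refine tsum_congr fun x => ?_
  rw [Equiv.coe_addRight, smul_smul, ← Complex.exp_add]
  congr 2
  push_cast; ring

lemma summable_norm_shift (n : ℤ) {u : ℤ → E} (hu : Summable fun x => ‖u x‖) :
    Summable fun x => ‖u (x + n)‖ :=
  ((Equiv.addRight n).summable_iff (f := fun x => ‖u x‖)).2 hu

lemma summable_norm_map_shift (A : E →L[ℂ] E) (n : ℤ) {u : ℤ → E} (hu : Summable fun x => ‖u x‖) :
    Summable fun x => ‖A (u (x + n))‖ := by
  exact Summable.of_nonneg_of_le (fun _ => norm_nonneg _) (fun x => A.le_opNorm _)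
    ((summable_norm_shift n hu).mul_left ‖A‖)

lemma fhat_map_shift_add (A B : E →L[ℂ] E) {u : ℤ → E} (hu : Summable fun x => ‖u x‖) (ξ : ℝ) :
    fhat (fun x => A (u (x + 1)) + B (u (x + (-1)))) ξ
      = cexp (I * ξ) • A (fhat u ξ) + cexp (-I * ξ) • B (fhat u ξ) := by
  have h3 : (fun x => A (u (x + 1)) + B (u (x + (-1))))
      = (fun x => A (u (x + 1))) + fun x => B (u (x + (-1))) := rfl
  rw [h3, fhat_add (summable_norm_map_shift A 1 hu) (summable_norm_map_shift B (-1) hu),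
    fhat_map A (summable_norm_shift 1 hu),
    fhat_map B (summable_norm_shift (-1) hu), fhat_shift, fhat_shift, map_smul, map_smul]
  push_cast
  ring_nf

lemma integral_smul_apply {A : ℝ → E →L[ℂ] E} (hA : Continuous A) (hc : HasCompactSupport A)
    {a : ℝ → ℂ} (ha : Continuous a) (v : E) :
    (∫ ξ, a ξ • A ξ) v = ∫ ξ, a ξ • A ξ v := by
  have hint : Integrable fun ξ => a ξ • A ξ := by
    refine Continuous.integrable_of_hasCompactSupport (by fun_prop) (hc.mono fun y hy h0 => hy ?_)
    change a y • A y = 0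
    ext w : 1
    rw [_root_.smul_apply, h0, _root_.zero_apply, smul_zero]
  exact ((ContinuousLinearMap.apply ℂ E v).integral_comp_comm hint).symm

/-- For summable `u` the distribution `û` is the continuous function `fhat u`. -/
lemma locFT_eq_integral {A : ℝ → E →L[ℂ] E} (hA : Continuous A) (hc : HasCompactSupport A)
    {u : ℤ → E} (hu : Summable fun x => ‖u x‖) (s : ℝ) :
    locFT A u s = ((√(2 * Real.pi))⁻¹ : ℂ) • ∫ ξ : ℝ, cexp (-I * s * ξ) • A ξ (fhat u ξ) := by
  let G : ℤ → ℝ → E := fun x ξ => cexp (-I * s * ξ) • A ξ (cexp (-I * x * ξ) • u x)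
  have hGc : ∀ x, Continuous (G x) := fun x => by
    have : Continuous fun ξ => A ξ (cexp (-I * x * ξ) • u x) := hA.clm_apply (by fun_prop)
    fun_prop
  have hGn : ∀ x ξ, ‖G x ξ‖ ≤ ‖A ξ‖ * ‖u x‖ := by
    intro x ξ
    have h1 : ∀ y : ℝ, ‖cexp (-I * y * ξ)‖ = 1 := fun y => by
      rw [show -I * (y : ℂ) * (ξ : ℂ) = I * ((-(y * ξ) : ℝ) : ℂ) by push_cast; ring,
        norm_exp_I_real]
    have h2 := h1 x
    push_cast at h2
    simp only [G, map_smul, norm_smul, h1, h2, one_mul]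
    exact (A ξ).le_opNorm _
  have hAi : Integrable fun ξ => ‖A ξ‖ :=
    (hA.integrable_of_hasCompactSupport hc).norm
  have hGi : ∀ x, Integrable (G x) := fun x =>
    (hAi.mul_const ‖u x‖).mono' (hGc x).aestronglyMeasurable
      (Eventually.of_forall fun ξ => hGn x ξ)
  have hGs : Summable fun x => ∫ ξ, ‖G x ξ‖ := by
    refine Summable.of_nonneg_of_le (fun x => integral_nonneg fun ξ => norm_nonneg _) (fun x => ?_)
      (hu.mul_left (∫ ξ, ‖A ξ‖))
    rw [← integral_mul_const]
    exact integral_mono (hGi x).norm (hAi.mul_const _) fun ξ => hGn x ξ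
  have hsum := hasSum_integral_of_summable_integral_norm hGi hGs
  rw [locFT, distPair]
  congr 1
  have h1 : ∀ x : ℤ, (((√(2 * Real.pi))⁻¹ : ℂ) •
      ∫ ξ : ℝ, cexp (-I * x * ξ) • cexp (-I * s * ξ) • A ξ) (u x)
      = ((√(2 * Real.pi))⁻¹ : ℂ) • ∫ ξ, G x ξ := by
    intro x
    have h2 : (fun ξ : ℝ => cexp (-I * x * ξ) • cexp (-I * s * ξ) • A ξ)
        = fun ξ : ℝ => (cexp (-I * x * ξ) * cexp (-I * s * ξ)) • A ξ := by
      funext ξ; rw [smul_smul]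
    rw [_root_.smul_apply, h2, integral_smul_apply hA hc (by fun_prop)]
    congr 1
    refine integral_congr_ae (Eventually.of_forall fun ξ => ?_)
    simp only [G, map_smul, smul_smul]
    rw [mul_comm]
  rw [tsum_congr h1, tsum_const_smul'', hsum.tsum_eq, ← integral_smul]
  refine integral_congr_ae (Eventually.of_forall fun ξ => ?_)
  simp only [G]
  rw [fhat, map_smul, (A ξ).map_tsum (summable_fhat hu ξ), smul_comm, tsum_const_smul'']

namespace Coin

variable {c : Coin} {j : Fin 2} {θ : ℝ}

lemma fhat_U0 {u : ℤ → E} (hu : Summable fun x => ‖u x‖) (ξ : ℝ) :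
    fhat (c.U0 u) ξ = op (c.Uhat ξ) (fhat u ξ) := by
  have h1 : c.U0 u = fun x => op c.C1 (u (x + 1)) + op c.C2 (u (x + (-1))) := by
    funext x
    rw [U0_apply, sub_eq_add_neg]
  rw [h1, op_Uhat_apply]
  exact fhat_map_shift_add _ _ hu ξ

lemma continuous_lam (i : Fin 2) : Continuous (c.lam i) := by
  have := c.continuous_acs
  fin_cases i
  · change Continuous fun ξ => cexp (I * (c.γ / 2 + c.acs ξ))
    fun_prop
  · change Continuous fun ξ => cexp (I * (c.γ - (c.γ / 2 + c.acs ξ)))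
    fun_prop

/-- The equation `(U₀ - μ) u = f` is solved in the Fourier representation by division. -/
lemma P_fhat_of_eq {f u : ℤ → E} {μ : ℂ} (hf : Summable fun x => ‖f x‖)
    (hu : Summable fun x => ‖u x‖) (h : c.U0 u - μ • u = f) (i : Fin 2) {ξ : ℝ}
    (hξ : ξ ∈ c.regular) (hμ : c.lam i ξ - μ ≠ 0) :
    c.P i ξ (fhat u ξ) = (c.lam i ξ - μ)⁻¹ • c.P i ξ (fhat f ξ) := by
  have h1 : fhat (c.U0 u) ξ = fhat f ξ + μ • fhat u ξ := by
    have h2 : Summable fun x => ‖(μ • u) x‖ := by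
      simpa only [Pi.smul_apply, norm_smul] using hu.mul_left ‖μ‖
    rw [show c.U0 u = f + μ • u by rw [← h]; abel, fhat_add hf h2, fhat_smul]
  have h2 := congrArg (c.P i ξ) ((fhat_U0 hu ξ).symm.trans h1)
  rw [P_op_Uhat c i hξ, map_add, map_smul, ← sub_eq_iff_eq_add, ← sub_smul] at h2
  rw [← h2, smul_smul, inv_mul_cancel₀ hμ, one_smul]

lemma lam_sub_ne_zero (i : Fin 2) (ξ : ℝ) {μ : ℂ} (hμ : ‖μ‖ ≠ 1) : c.lam i ξ - μ ≠ 0 := by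
  intro h0
  rw [sub_eq_zero] at h0
  exact hμ (by rw [← h0, norm_lam])

/-- The trace of the local Fourier transforms of the columns of the resolvent kernel. The
projections have trace one, so the Fourier transform of the scalar function `χ (λ_i - μ)⁻¹`
remains. -/
lemma sum_locFT_resolv {χ : ℝ → ℂ} {i : Fin 2} (hA : ContDiff ℝ ∞ fun ξ => χ ξ • c.P i ξ)
    {ξ₀ : ℝ} (hχ : IsCutoff ξ₀ χ) (hreg : tsupport χ ⊆ c.regular) {μ w : ℂ} (hμ0 : μ ≠ 0)
    (hμ : ‖μ‖ ≠ 1) (hw0 : w ≠ 0) (hw : ‖w‖ < 1)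
    (hμw : (w + w⁻¹) * (μ * c.ph * c.p) = c.ph ^ 2 + μ ^ 2) (s : ℝ) :
    (√(2 * Real.pi) : ℂ) * ∑ k : Fin 2, locFT (fun ξ => χ ξ • c.P i ξ)
        (c.resolv μ w (Pi.single 0 (EuclideanSpace.single k 1))) s k
      = ((√(2 * Real.pi))⁻¹ : ℂ) * ∫ ξ : ℝ, cexp (-I * s * ξ) * χ ξ * (c.lam i ξ - μ)⁻¹ := by
  have hpi : (√(2 * Real.pi) : ℂ) ≠ 0 := by
    rw [Complex.ofReal_ne_zero]; have := Real.pi_pos; positivity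
  have hw1 : w⁻¹ - w ≠ 0 := by
    intro h0
    have h1 : ‖w⁻¹‖ = ‖w‖ := by rw [sub_eq_zero.1 h0]
    rw [norm_inv] at h1
    have h2 : 0 < ‖w‖ := norm_pos_iff.2 hw0
    have h3 : 1 < ‖w‖⁻¹ := (one_lt_inv₀ h2).2 hw
    linarith
  have hlam : ∀ ξ, c.lam i ξ - μ ≠ 0 := fun ξ => lam_sub_ne_zero i ξ hμ
  have hc := hχ.hasCompactSupport_smul (c.P i)
  have hsingle : ∀ e : E, Summable fun x => ‖(Pi.single 0 e : ℤ → E) x‖ := fun e =>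
    summable_norm_of_mem_BZ (single_mem_BZ e)
  have hA2 : ∀ k : Fin 2, Continuous fun ξ => (χ ξ • c.P i ξ) (EuclideanSpace.single k 1) :=
    fun k => hA.continuous.clm_apply continuous_const
  have hlamc : Continuous fun ξ => (c.lam i ξ - μ)⁻¹ :=
    ((continuous_lam i).sub continuous_const).inv₀ hlam
  let g : Fin 2 → ℝ → ℂ := fun k ξ => cexp (-I * s * ξ) * (c.lam i ξ - μ)⁻¹ *
    ((χ ξ • c.P i ξ) (EuclideanSpace.single k 1)) k
  have hgc : ∀ k, Continuous (g k) := fun k => by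
    have := (EuclideanSpace.proj (𝕜 := ℂ) k).continuous.comp (hA2 k)
    exact (Continuous.mul (by fun_prop) hlamc).mul this
  have hgi : ∀ k, Integrable (g k) := fun k => by
    refine (hgc k).integrable_of_hasCompactSupport (hc.mono fun ξ hξ h0 => hξ ?_)
    replace h0 : χ ξ • c.P i ξ = 0 := h0
    change cexp (-I * s * ξ) * (c.lam i ξ - μ)⁻¹ *
      ((χ ξ • c.P i ξ) (EuclideanSpace.single k 1)) k = 0
    rw [h0]
    simp
  have hk : ∀ k : Fin 2, locFT (fun ξ => χ ξ • c.P i ξ)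
        (c.resolv μ w (Pi.single 0 (EuclideanSpace.single k 1))) s k
      = ((√(2 * Real.pi))⁻¹ : ℂ) * (((√(2 * Real.pi))⁻¹ : ℂ) * ∫ ξ, g k ξ) := by
    intro k
    have hf := hsingle (EuclideanSpace.single k 1)
    have hu := summable_norm_resolv (c := c) (μ := μ) hw hf
    have heq := resolv_eq (c := c) hμ0 hw0 hw.le hw1 hμw hf
    have h1 : ∀ ξ : ℝ, cexp (-I * s * ξ) • (χ ξ • c.P i ξ)
          (fhat (c.resolv μ w (Pi.single 0 (EuclideanSpace.single k 1))) ξ)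
        = (((√(2 * Real.pi))⁻¹ : ℂ) * cexp (-I * s * ξ) * (c.lam i ξ - μ)⁻¹) •
          (χ ξ • c.P i ξ) (EuclideanSpace.single k 1) := by
      intro ξ
      rw [_root_.smul_apply, _root_.smul_apply]
      by_cases hχ0 : χ ξ = 0
      · rw [hχ0, zero_smul, zero_smul, smul_zero, smul_zero]
      · rw [P_fhat_of_eq hf hu heq i (hreg (subset_tsupport _ hχ0)) (hlam ξ), fhat_single,
          map_smul]
        module
    have h2 : Integrable fun ξ : ℝ => (((√(2 * Real.pi))⁻¹ : ℂ) * cexp (-I * s * ξ) *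
        (c.lam i ξ - μ)⁻¹) • (χ ξ • c.P i ξ) (EuclideanSpace.single k 1) := by
      refine Continuous.integrable_of_hasCompactSupport
        ((Continuous.mul (by fun_prop) hlamc).smul (hA2 k)) (hc.mono fun ξ hξ h0 => hξ ?_)
      replace h0 : χ ξ • c.P i ξ = 0 := h0
      simp only [h0, _root_.zero_apply, smul_zero]
    rw [locFT_eq_integral hA.continuous hc hu, PiLp.smul_apply, smul_eq_mul,
      integral_congr_ae (Eventually.of_forall h1)]
    congr 1
    rw [← integral_const_mul]
    refine ((EuclideanSpace.proj (𝕜 := ℂ) k).integral_comp_comm h2).symm.trans ?_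
    refine integral_congr_ae (Eventually.of_forall fun ξ => ?_)
    change (((√(2 * Real.pi))⁻¹ : ℂ) * cexp (-I * s * ξ) * (c.lam i ξ - μ)⁻¹) *
      ((χ ξ • c.P i ξ) (EuclideanSpace.single k 1)) k = _
    simp only [g]
    ring
  rw [Finset.sum_congr rfl fun k _ => hk k, ← Finset.mul_sum, ← Finset.mul_sum,
    ← integral_finsetSum _ fun k _ => hgi k, ← mul_assoc, mul_inv_cancel₀ hpi, one_mul]
  congr 1
  refine integral_congr_ae (Eventually.of_forall fun ξ => ?_)
  simp only [g]
  rw [← Finset.mul_sum]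
  by_cases hχ0 : χ ξ = 0
  · simp [hχ0]
  · have htr := c.trace_P i (hreg (subset_tsupport _ hχ0))
    have h3 : ∑ k : Fin 2, ((χ ξ • c.P i ξ) (EuclideanSpace.single k 1)) k = χ ξ := by
      have h4 : ∑ k : Fin 2, ((χ ξ • c.P i ξ) (EuclideanSpace.single k 1)) k
          = χ ξ * ∑ k : Fin 2, (c.P i ξ (EuclideanSpace.single k 1)) k := by
        rw [Finset.mul_sum]
        rfl
      rw [h4, htr, mul_one]
    rw [h3]; ring

end Coin


/-! ### The singular leading terms -/

/-- The entire function `(1 - e^{-z}) / z`. -/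
def expq : ℂ → ℂ := dslope (fun z => 1 - cexp (-z)) 0

lemma expq_of_ne {z : ℂ} (hz : z ≠ 0) : expq z = (1 - cexp (-z)) / z := by
  rw [expq, dslope_of_ne _ hz, slope_def_field]
  simp

lemma expq_zero : expq 0 = 1 := by
  have h1 : HasDerivAt (fun z : ℂ => 1 - cexp (-z)) 1 0 := by
    have h2 := ((hasDerivAt_neg (0 : ℂ)).cexp).const_sub 1
    simpa using h2
  rw [expq, dslope_same, h1.deriv]

lemma differentiable_expq : Differentiable ℂ expq := by
  rw [← differentiableOn_univ, expq, Complex.differentiableOn_dslope univ_mem]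
  have h1 : Differentiable ℂ fun z : ℂ => 1 - cexp (-z) := by fun_prop
  exact h1.differentiableOn

lemma exp_neg_ne_one {z : ℂ} (hz : |z.im| < 2 * Real.pi) (hz0 : z ≠ 0) : cexp (-z) ≠ 1 := by
  intro h
  obtain ⟨n, hn⟩ := Complex.exp_eq_one_iff.1 h
  have hpi := Real.pi_pos
  have him : z.im = -(n * (2 * Real.pi)) := by
    have := congrArg Complex.im hn
    simp at this
    linarith
  have hn0 : n = 0 := by
    rw [him, abs_neg, abs_mul, abs_of_pos (show (0 : ℝ) < 2 * Real.pi by positivity)] at hz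
    have h1 : |(n : ℝ)| < 1 := by
      by_contra hcon
      nlinarith
    have h2 : |n| < 1 := by exact_mod_cast h1
    exact Int.abs_lt_one_iff.1 h2
  rw [hn0, Int.cast_zero, zero_mul, neg_eq_zero] at hn
  exact hz0 hn

lemma expq_ne_zero {z : ℂ} (hz : |z.im| < 2 * Real.pi) : expq z ≠ 0 := by
  by_cases hz0 : z = 0
  · rw [hz0, expq_zero]; exact one_ne_zero
  · rw [expq_of_ne hz0]
    exact div_ne_zero (sub_ne_zero.2 (exp_neg_ne_one hz hz0).symm) hz0

/-- The function `1/z - 1/(1 - e^{-z})`, extended continuously to `0`. It compares the denominators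
of the leading terms with those of the resolvent of the multiplier. -/
def psi (z : ℂ) : ℂ := dslope expq 0 z / expq z

lemma psi_of_ne {z : ℂ} (hz : |z.im| < 2 * Real.pi) (hz0 : z ≠ 0) :
    psi z = z⁻¹ - (1 - cexp (-z))⁻¹ := by
  have h1 : 1 - cexp (-z) ≠ 0 := sub_ne_zero.2 (exp_neg_ne_one hz hz0).symm
  rw [psi, dslope_of_ne _ hz0, slope_def_field, expq_of_ne hz0, expq_zero]
  field_simp
  ring

lemma continuousOn_psi : ContinuousOn psi {z | |z.im| < 2 * Real.pi} := by
  have h1 : Differentiable ℂ (dslope expq 0) := by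
    rw [← differentiableOn_univ, Complex.differentiableOn_dslope univ_mem]
    exact differentiable_expq.differentiableOn
  exact h1.continuous.continuousOn.div differentiable_expq.continuous.continuousOn
    fun z hz => expq_ne_zero hz

namespace Coin

variable {c : Coin} {j : Fin 2} {θ : ℝ}

/-- The value of `ξ ↦ arccos (p cos (ξ + α - γ/2))` on `M(θ)`, for `θ` in the respective band. -/
def cen (c : Coin) (θ : ℝ) : Fin 2 → ℝ
  | 0 => θ - c.γ / 2
  | 1 => 2 * Real.pi - (θ - c.γ / 2)

/-- The denominator `i (± (a(ξ) - a₀)) ± ε` of the leading terms, up to the factor `-1` that the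
minus sign in front of the second term absorbs. Here `a₀ = cen θ i` is the value of `a` on `M(θ)` if
`θ` is in the band with index `i`. -/
def den (c : Coin) (i : Fin 2) (τ : ℤˣ) (θ ε ξ : ℝ) : ℂ :=
  ((((bsgn i : ℤ) : ℝ) * (c.acs ξ - c.cen θ i) : ℝ) : ℂ) * I + ((((τ : ℤ) : ℝ) * ε : ℝ) : ℂ)

lemma den_re (i : Fin 2) (τ : ℤˣ) (θ ε ξ : ℝ) : (c.den i τ θ ε ξ).re = ((τ : ℤ) : ℝ) * ε := by
  rw [den, Complex.add_re, Complex.re_ofReal_mul, Complex.I_re, Complex.ofReal_re]; ring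

lemma den_im (i : Fin 2) (τ : ℤˣ) (θ ε ξ : ℝ) :
    (c.den i τ θ ε ξ).im = ((bsgn i : ℤ) : ℝ) * (c.acs ξ - c.cen θ i) := by
  rw [den, Complex.add_im, Complex.im_ofReal_mul, Complex.I_im, Complex.ofReal_im]; ring

lemma leading_eq (i : Fin 2) (τ : ℤˣ) (θ ε ξ : ℝ) :
    c.leading τ θ ε i ξ = (c.lam i ξ)⁻¹ * (c.den i τ θ ε ξ)⁻¹ := by
  fin_cases i
  · change cexp (-I * (c.γ / 2)) * cexp (-I * c.acs ξ) /
      (I * (c.acs ξ - θ + c.γ / 2) + ((τ : ℤ) : ℂ) * ε)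
      = (cexp (I * (c.γ / 2 + c.acs ξ)))⁻¹ * _
    rw [← Complex.exp_neg, ← Complex.exp_add, div_eq_mul_inv]
    congr 2
    · ring
    · simp only [den, cen, bsgn]
      push_cast; ring
  · change -(cexp (-I * (c.γ / 2)) * cexp (I * c.acs ξ) /
      (I * (c.acs ξ - 2 * Real.pi + θ - c.γ / 2) - ((τ : ℤ) : ℂ) * ε))
      = (cexp (I * (c.γ - (c.γ / 2 + c.acs ξ))))⁻¹ * _
    rw [← Complex.exp_neg, ← Complex.exp_add, div_eq_mul_inv, ← mul_neg, ← inv_neg]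
    congr 2
    · ring
    · simp only [den, cen, bsgn]
      push_cast; ring

/-- The exponential of the denominator is the ratio of the spectral parameter and the eigenvalue. -/
lemma exp_neg_den (i : Fin 2) (τ : ℤˣ) (θ ε ξ : ℝ) : cexp (-c.den i τ θ ε ξ)
    = (c.lam i ξ)⁻¹ * (((Real.exp (-(((τ : ℤ) : ℝ) * ε)) : ℝ) : ℂ) * cexp (I * θ)) := by
  rw [Complex.ofReal_exp, ← Complex.exp_add]
  fin_cases i
  · change _ = (cexp (I * (c.γ / 2 + c.acs ξ)))⁻¹ * _
    rw [← Complex.exp_neg, ← Complex.exp_add]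
    simp only [den, cen, bsgn]
    congr 1
    push_cast; ring
  · change _ = (cexp (I * (c.γ - (c.γ / 2 + c.acs ξ))))⁻¹ * _
    rw [← Complex.exp_neg, ← Complex.exp_add]
    -- `cen θ 1` contains `2π`
    refine Complex.exp_eq_exp_iff_exists_int.2 ⟨-1, ?_⟩
    simp only [den, cen, bsgn]
    push_cast; ring

lemma InBand.cen_mem (h : c.InBand j θ) (i : Fin 2) : 0 < c.cen θ i ∧ c.cen θ i < 2 * Real.pi := by
  have h0 := Real.arccos_nonneg c.p
  have hpi := Real.pi_pos
  have h1 : 0 < θ - c.γ / 2 ∧ θ - c.γ / 2 < 2 * Real.pi := by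
    have hs := h.sin_pos
    have hm := h.mem
    have h2 : 0 ≤ θ - c.γ / 2 ∧ θ - c.γ / 2 ≤ 2 * Real.pi := by
      fin_cases j <;> obtain ⟨h3, h4⟩ := hm <;> constructor <;> linarith
    refine ⟨lt_of_le_of_ne h2.1 fun he => ?_, lt_of_le_of_ne h2.2 fun he => ?_⟩
    · rw [← he, Real.sin_zero, mul_zero] at hs
      exact lt_irrefl _ hs
    · rw [he, Real.sin_two_pi, mul_zero] at hs
      exact lt_irrefl _ hs
  fin_cases i
  · exact h1
  · change 0 < 2 * Real.pi - (θ - c.γ / 2) ∧ 2 * Real.pi - (θ - c.γ / 2) < 2 * Real.pi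
    constructor <;> linarith [h1.1, h1.2]

/-- The denominators stay away from the poles `2πin`, `n ≠ 0`, of `(1 - e^{-z})⁻¹`. -/
lemma InBand.abs_im_den_lt (h : c.InBand j θ) (i : Fin 2) (τ : ℤˣ) (ε ξ : ℝ) :
    |(c.den i τ θ ε ξ).im| < 2 * Real.pi := by
  have h1 := h.cen_mem i
  have h2 : 0 ≤ c.acs ξ := Real.arccos_nonneg _
  have h3 : c.acs ξ ≤ Real.pi := Real.arccos_le_pi _
  have hpi := Real.pi_pos
  have h4 : |((bsgn i : ℤ) : ℝ)| = 1 := by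
    rcases units_cases (bsgn i) with h | h <;> rw [h] <;> simp
  rw [den_im, abs_mul, h4, one_mul, abs_lt]
  constructor <;> linarith [h1.1, h1.2]

lemma den_ne_zero (i : Fin 2) (τ : ℤˣ) (θ : ℝ) {ε : ℝ} (hε : ε ≠ 0) (ξ : ℝ) :
    c.den i τ θ ε ξ ≠ 0 := by
  intro h0
  have h1 := den_re (c := c) i τ θ ε ξ
  rw [h0, Complex.zero_re] at h1
  rcases units_cases τ with h | h <;> rw [h] at h1 <;> exact hε (by linarith)

/-- The leading term is the scalar resolvent of the eigenvalue, up to a function that is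
continuous down to `ε = 0`. -/
lemma InBand.leading_eq_add (h : c.InBand j θ) (i : Fin 2) (τ : ℤˣ) {ε : ℝ} (hε : ε ≠ 0) (ξ : ℝ) :
    c.leading τ θ ε i ξ
      = (c.lam i ξ - ((Real.exp (-(((τ : ℤ) : ℝ) * ε)) : ℝ) : ℂ) * cexp (I * θ))⁻¹
        + (c.lam i ξ)⁻¹ * psi (c.den i τ θ ε ξ) := by
  rw [leading_eq, psi_of_ne (h.abs_im_den_lt i τ ε ξ) (den_ne_zero i τ θ hε ξ), exp_neg_den]
  set μ := ((Real.exp (-(((τ : ℤ) : ℝ) * ε)) : ℝ) : ℂ) * cexp (I * θ)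
  have h1 := c.lam_ne_zero i ξ
  have h2 : c.lam i ξ - μ = c.lam i ξ * (1 - (c.lam i ξ)⁻¹ * μ) := by field_simp
  rw [h2, mul_inv]
  ring

/-- The Fourier transform of the leading term: the singular part is read off from the resolvent
kernel, the remaining part is continuous. -/
def leadFT (c : Coin) (i : Fin 2) (τ : ℤˣ) (θ : ℝ) (χ : ℝ → ℂ) (s : ℝ) : ℂ :=
  (√(2 * Real.pi) : ℂ) * ∑ k : Fin 2, locFT (fun ξ => χ ξ • c.P i ξ)
      (c.Rb τ θ ⟨Pi.single 0 (EuclideanSpace.single k 1), single_mem_BZ _⟩) s k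
    + ((√(2 * Real.pi))⁻¹ : ℂ) *
      ∫ ξ : ℝ, cexp (-I * s * ξ) * (χ ξ * ((c.lam i ξ)⁻¹ * psi (c.den i τ θ 0 ξ)))

lemma InBand.continuous_psi_den (h : c.InBand j θ) (i : Fin 2) (τ : ℤˣ) :
    Continuous fun x : ℝ × ℝ => (c.lam i x.2)⁻¹ * psi (c.den i τ θ x.1 x.2) := by
  have h1 : Continuous fun x : ℝ × ℝ => c.den i τ θ x.1 x.2 := by
    have := c.continuous_acs
    unfold den
    fun_prop
  have h2 : Continuous fun x : ℝ × ℝ => psi (c.den i τ θ x.1 x.2) :=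
    continuousOn_psi.comp_continuous h1 fun x => h.abs_im_den_lt i τ x.1 x.2
  exact (((continuous_lam i).comp continuous_snd).inv₀ fun x => c.lam_ne_zero i _).mul h2

/-- The limit `ε ↓ 0` of the leading terms exists in the sense of distributions. The spectral
parameter `e^{∓ε} e^{iθ}` is chosen to match the denominator by `exp_neg_den`, so that limiting
absorption for the resolvent kernel gives the singular part. -/
lemma InBand.isLeadingFT (h : c.InBand j θ) (i : Fin 2) (τ : ℤˣ) {ξ₀ : ℝ} {χ : ℝ → ℂ}
    (hχ : IsCutoff ξ₀ χ) (hreg : tsupport χ ⊆ c.regular) :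
    c.IsLeadingFT τ θ i χ (c.leadFT i τ θ χ) := by
  intro s
  have hA := c.contDiff_smul_P i hχ.1 hreg
  have hc := hχ.hasCompactSupport_smul (c.P i)
  set r : ℝ → ℝ := fun ε => Real.exp (-(((τ : ℤ) : ℝ) * ε)) with hr
  have hrc : Tendsto r (𝓝[>] 0) (𝓝 1) := by
    have h1 : Continuous r := by fun_prop
    have h2 := h1.tendsto 0
    simp only [hr, mul_zero, neg_zero, Real.exp_zero] at h2
    exact h2.mono_left nhdsWithin_le_nhds
  have hrτ : ∀ ε > 0, 0 < ((τ : ℤ) : ℝ) * (1 - r ε) := by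
    intro ε hε
    rcases units_cases τ with h1 | h1 <;> simp only [hr, h1]
    · have := Real.exp_lt_one_iff.2 (show -(1 * ε) < 0 by linarith)
      linarith
    · have := Real.one_lt_exp_iff.2 (show 0 < -(-1 * ε) by linarith)
      linarith
  obtain ⟨w, hw, hwe⟩ := h.exists_root τ hrc
    (eventually_nhdsWithin_of_forall fun ε hε => hrτ ε hε)
  have hμ : Tendsto (fun ε => (r ε : ℂ) * cexp (I * θ)) (𝓝[>] 0) (𝓝 (cexp (I * θ))) := by
    have h1 := ((Complex.continuous_ofReal.tendsto 1).comp hrc).mul_const (cexp (I * θ))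
    rwa [Complex.ofReal_one, one_mul] at h1
  have hT : Tendsto (fun ε => (√(2 * Real.pi) : ℂ) * ∑ k : Fin 2, locFT (fun ξ => χ ξ • c.P i ξ)
      (c.resolv (r ε * cexp (I * θ)) (w ε) (Pi.single 0 (EuclideanSpace.single k 1))) s k)
      (𝓝[>] 0) (𝓝 ((√(2 * Real.pi) : ℂ) * ∑ k : Fin 2, locFT (fun ξ => χ ξ • c.P i ξ)
      (c.Rb τ θ ⟨Pi.single 0 (EuclideanSpace.single k 1), single_mem_BZ _⟩) s k)) := by
    refine Tendsto.const_mul _ (tendsto_finsetSum _ fun k _ => ?_)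
    have hf := summable_norm_of_mem_BZ (single_mem_BZ (EuclideanSpace.single k 1))
    have hle : ∀ᶠ ε in 𝓝[>] (0 : ℝ), ‖w ε‖ ≤ 1 := hwe.mono fun ε hε => hε.2.1.le
    have h1 := tendsto_locFT hA hc
      (eventually_norm_resolv_le (c := c) hμ hw (Complex.exp_ne_zero _) (c.wb_ne_zero _ _)
        (h.wb_inv_sub_ne _) hle hf)
      (fun x => tendsto_resolv (c := c) hμ hw (Complex.exp_ne_zero _) (c.wb_ne_zero _ _)
        (h.wb_inv_sub_ne _) hle hf x) s
    rw [h.coe_Rb]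
    exact ((EuclideanSpace.proj (𝕜 := ℂ) k).continuous.tendsto _).comp h1
  have hF : Continuous fun x : ℝ × ℝ => cexp (-I * s * x.2) *
      (χ x.2 * ((c.lam i x.2)⁻¹ * psi (c.den i τ θ x.1 x.2))) := by
    have h1 := h.continuous_psi_den i τ
    have h2 := hχ.1.continuous
    exact Continuous.mul (by fun_prop) (Continuous.mul (by fun_prop) h1)
  have hzero : ∀ ξ, ξ ∉ tsupport χ → χ ξ = 0 := fun ξ hξ => image_eq_zero_of_notMem_tsupport hξ
  have hR : Tendsto (fun ε => ∫ ξ : ℝ, cexp (-I * s * ξ) *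
      (χ ξ * ((c.lam i ξ)⁻¹ * psi (c.den i τ θ ε ξ)))) (𝓝[>] 0)
      (𝓝 (∫ ξ : ℝ, cexp (-I * s * ξ) * (χ ξ * ((c.lam i ξ)⁻¹ * psi (c.den i τ θ 0 ξ))))) := by
    have h1 : ∀ ε : ℝ, (∫ ξ : ℝ, cexp (-I * s * ξ) *
        (χ ξ * ((c.lam i ξ)⁻¹ * psi (c.den i τ θ ε ξ))))
        = ∫ ξ in tsupport χ, cexp (-I * s * ξ) *
          (χ ξ * ((c.lam i ξ)⁻¹ * psi (c.den i τ θ ε ξ))) := by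
      intro ε
      refine (setIntegral_eq_integral_of_forall_compl_eq_zero fun ξ hξ => ?_).symm
      rw [hzero ξ hξ, zero_mul, mul_zero]
    simp only [h1]
    have h2 := continuous_parametric_integral_of_continuous (μ := volume)
      (f := fun ε ξ : ℝ => cexp (-I * s * ξ) *
        (χ ξ * ((c.lam i ξ)⁻¹ * psi (c.den i τ θ ε ξ)))) hF
      (show IsCompact (tsupport χ) from hχ.hasCompactSupport)
    exact (h2.tendsto 0).mono_left nhdsWithin_le_nhds
  refine (hT.add (hR.const_mul ((√(2 * Real.pi))⁻¹ : ℂ))).congr' ?_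
  filter_upwards [hwe, self_mem_nhdsWithin] with ε hε hε0
  have hε0' : ε ≠ 0 := (show (0 : ℝ) < ε from hε0).ne'
  have hrpos : 0 < r ε := Real.exp_pos _
  have hnorm : ‖(r ε : ℂ) * cexp (I * θ)‖ ≠ 1 := by
    rw [norm_mul, norm_exp_I_real, mul_one, Complex.norm_real, Real.norm_of_nonneg hrpos.le]
    intro h1
    have h2 := hrτ ε hε0
    rw [h1, sub_self, mul_zero] at h2
    exact lt_irrefl _ h2
  have hμ0 : (r ε : ℂ) * cexp (I * θ) ≠ 0 :=
    mul_ne_zero (by rw [Complex.ofReal_ne_zero]; exact hrpos.ne') (Complex.exp_ne_zero _)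
  rw [sum_locFT_resolv hA hχ hreg hμ0 hnorm hε.1 hε.2.1 hε.2.2, ← mul_add]
  congr 1
  have hlam : Continuous fun ξ => (c.lam i ξ - (r ε : ℂ) * cexp (I * θ))⁻¹ :=
    ((continuous_lam i).sub continuous_const).inv₀ fun ξ => lam_sub_ne_zero i ξ hnorm
  have hχc := hχ.1.continuous
  have hi1 : Integrable fun ξ : ℝ => cexp (-I * s * ξ) * χ ξ *
      (c.lam i ξ - (r ε : ℂ) * cexp (I * θ))⁻¹ := by
    refine Continuous.integrable_of_hasCompactSupport (Continuous.mul (by fun_prop) hlam)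
      (hχ.hasCompactSupport.mono fun ξ hξ h0 => hξ ?_)
    simp only [h0, mul_zero, zero_mul]
  have hi2 : Integrable fun ξ : ℝ => cexp (-I * s * ξ) *
      (χ ξ * ((c.lam i ξ)⁻¹ * psi (c.den i τ θ ε ξ))) := by
    refine Continuous.integrable_of_hasCompactSupport
      (hF.comp (show Continuous fun ξ : ℝ => (ε, ξ) by fun_prop))
      (hχ.hasCompactSupport.mono fun ξ hξ h0 => hξ ?_)
    simp only [h0, mul_zero, zero_mul]
  rw [← integral_add hi1 hi2]
  refine integral_congr_ae (Eventually.of_forall fun ξ => ?_)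
  simp only
  rw [h.leading_eq_add i τ hε0' ξ]
  simp only [hr]
  ring

/-- The Riemann–Lebesgue lemma at the two ends of `ℝ`. -/
lemma _root_.QW.tendsto_integral_exp_dirR (a : ℝ → ℂ) (ν : ℤˣ) :
    Tendsto (fun s : ℝ => ∫ ξ : ℝ, cexp (-I * s * ξ) * a ξ) (dirR ν) (𝓝 0) := by
  have hpi := Real.pi_pos
  have h1 := Real.tendsto_integral_exp_smul_cocompact a
  have h2 : Tendsto (fun s : ℝ => s * (2 * Real.pi)⁻¹) (dirR ν) (cocompact ℝ) := by
    rcases Int.units_eq_one_or ν with rfl | rfl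
    · exact (tendsto_id.atTop_mul_const (show 0 < (2 * Real.pi)⁻¹ by positivity)).mono_right
        atTop_le_cocompact
    · exact (tendsto_id.atBot_mul_const (show 0 < (2 * Real.pi)⁻¹ by positivity)).mono_right
        atBot_le_cocompact
  refine (h1.comp h2).congr fun s => ?_
  refine integral_congr_ae (Eventually.of_forall fun ξ => ?_)
  simp only [Circle.smul_def, Real.fourierChar_apply, smul_eq_mul]
  congr 2
  push_cast
  field_simp

/-- Near a point of `M(θ)` the local Fourier transform of `R₀(θ ± i0) f` is asymptotic to a multiple
of the amplitude of `f`, with a factor independent of `f`. -/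
lemma InBand.exists_tendsto_locFT_Rb (h : c.InBand j θ) (i : Fin 2) (τ : ℤˣ) {ξ₀ : ℝ} {χ : ℝ → ℂ}
    (hχ : IsCutoff ξ₀ χ) (hreg : tsupport χ ⊆ c.regular) (hξ₀ : ξ₀ ∈ c.fermi θ)
    (hs : tsupport χ ∩ c.fermi θ ⊆ {ξ₀}) (ν : ℤˣ) :
    ∃ b : ℂ, ∀ f : BZ, Tendsto (fun s : ℝ => locFT (fun ξ => χ ξ • c.P i ξ) (c.Rb τ θ f) s
      - (cexp (-I * s * ξ₀) * b) • c.P i ξ₀ (fhat f ξ₀)) (dirR ν) (𝓝 0) := by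
  have hA := c.contDiff_smul_P i hχ.1 hreg
  have hc := hχ.hasCompactSupport_smul (c.P i)
  have hreg₀ := h.regular_of_fermi hξ₀
  obtain ⟨σ, n, hσ⟩ := h.mem_fermi.1 hξ₀
  let b : ℂ := if σ = -ν * (τ * bsgn j) ∧ i = j then
    χ ξ₀ * (((τ : ℤ) : ℂ) * c.dxi θ * cexp (-I * θ) * √(2 * Real.pi)) else 0
  refine ⟨b, fun f => ?_⟩
  refine (tendsto_locFT_sub_sum hA hc (norm_Rb_le τ θ f)
    (h.tendsto_Rb_sub_sum τ (-ν) f)).congr fun s => ?_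
  congr 1
  have hmem : ∀ ρ (m : ℤ), χ (c.kap ρ θ + 2 * Real.pi * m) ≠ 0 →
      c.kap ρ θ + 2 * Real.pi * m = ξ₀ := fun ρ m hm =>
    hs ⟨subset_tsupport _ hm, h.mem_fermi.2 ⟨ρ, m, rfl⟩⟩
  rw [Finset.sum_eq_single σ]
  · have hP : c.P i ξ₀ (c.outAmpl j τ θ f (-ν) σ) = if σ = -ν * (τ * bsgn j) ∧ i = j then
        (((τ : ℤ) : ℂ) * c.dxi θ * cexp (-I * θ) * √(2 * Real.pi)) • c.P i ξ₀ (fhat f ξ₀)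
        else 0 := by
      rw [outAmpl]
      by_cases h1 : σ = -ν * (τ * bsgn j)
      · rw [if_pos h1, ← ampl_periodic τ θ _ _ n, ← hσ, ampl, map_smul]
        by_cases h2 : i = j
        · rw [if_pos ⟨h1, h2⟩, h2, P_P]
        · rw [if_neg fun h3 => h2 h3.2, c.P_P_other h2 hreg₀, smul_zero]
      · rw [if_neg h1, if_neg fun h3 => h1 h3.1, map_zero]
    by_cases hχ0 : χ ξ₀ = 0
    · rw [locFT_pw_eq_zero hA hχ fun m hm => absurd hχ0 (hmem σ m hm ▸ hm)]
      simp only [b, hχ0, zero_mul, ite_self, mul_zero, zero_smul]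
    · rw [locFT_pw_of_mem hA hχ (m := n) (by rwa [← hσ]), ← hσ, hP]
      simp only [b]
      split_ifs
      · rw [smul_smul, smul_smul]; ring_nf
      · simp
  · intro ρ _ hρ
    refine locFT_pw_eq_zero hA hχ (fun m hm => ?_) s
    exact absurd (h.kap_injective ((hmem ρ m hm).trans hσ)) hρ
  · intro h1
    exact absurd (Finset.mem_univ _) h1

/-- The leading asymptotics of `R₀(θ ± i0) f` near a point of `M(θ)`. The factor `b` of
`exists_tendsto_locFT_Rb` does not depend on `f`; taking point masses for `f` and the trace shows
that `leadFT` has the asymptotics `e^{-isξ₀} b` as well. -/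
lemma InBand.isB0star_leading (h : c.InBand j θ) (i : Fin 2) (τ : ℤˣ) {ξ₀ : ℝ} {χ : ℝ → ℂ}
    (hχ : IsCutoff ξ₀ χ) (hreg : tsupport χ ⊆ c.regular) (hξ₀ : ξ₀ ∈ c.fermi θ)
    (hs : tsupport χ ∩ c.fermi θ ⊆ {ξ₀}) (f : BZ) :
    IsB0star fun s => locFT (fun ξ => χ ξ • c.P i ξ) (c.Rb τ θ f) s
      - c.leadFT i τ θ χ s • c.P i ξ₀ (fhat f ξ₀) := by
  have hpi := Real.pi_pos
  have hpi0 : (√(2 * Real.pi) : ℂ) ≠ 0 := by rw [Complex.ofReal_ne_zero]; positivity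
  have hA := c.contDiff_smul_P i hχ.1 hreg
  have hc := hχ.hasCompactSupport_smul (c.P i)
  have hreg₀ := h.regular_of_fermi hξ₀
  let δ : Fin 2 → BZ := fun k => ⟨Pi.single 0 (EuclideanSpace.single k 1), single_mem_BZ _⟩
  let a : ℝ → ℂ := fun ξ => χ ξ * ((c.lam i ξ)⁻¹ * psi (c.den i τ θ 0 ξ))
  have hbd : ∀ g : BZ, ∃ K, ∀ s, ‖locFT (fun ξ => χ ξ • c.P i ξ) (c.Rb τ θ g) s‖ ≤ K :=
    fun g => exists_locFT_bound hA hc (norm_Rb_le τ θ g)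
  choose K hK using hbd
  have hS : ∃ L, ∀ s, ‖c.leadFT i τ θ χ s‖ ≤ L := by
    refine ⟨‖(√(2 * Real.pi) : ℂ)‖ * ∑ k, K (δ k) + ‖((√(2 * Real.pi))⁻¹ : ℂ)‖ * ∫ ξ, ‖a ξ‖,
      fun s => (norm_add_le _ _).trans (add_le_add ?_ ?_)⟩
    · rw [norm_mul]
      refine mul_le_mul_of_nonneg_left ((norm_sum_le _ _).trans ?_) (norm_nonneg _)
      exact Finset.sum_le_sum fun k _ => (PiLp.norm_apply_le _ k).trans (hK (δ k) s)
    · rw [norm_mul]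
      refine mul_le_mul_of_nonneg_left ((norm_integral_le_integral_norm _).trans (le_of_eq ?_))
        (norm_nonneg _)
      refine integral_congr_ae (Eventually.of_forall fun ξ => ?_)
      simp only [a]
      rw [norm_mul, show -I * (s : ℂ) * (ξ : ℂ) = I * ((-(s * ξ) : ℝ) : ℂ) by push_cast; ring,
        norm_exp_I_real, one_mul]
  obtain ⟨L, hL⟩ := hS
  refine isB0star_of_tendsto (B := K f + L * ‖c.P i ξ₀ (fhat f ξ₀)‖) (fun s => ?_) fun ν => ?_
  · refine (norm_sub_le _ _).trans (add_le_add (hK f s) ?_)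
    rw [norm_smul]
    exact mul_le_mul_of_nonneg_right (hL s) (norm_nonneg _)
  obtain ⟨b, hb⟩ := h.exists_tendsto_locFT_Rb i τ hχ hreg hξ₀ hs ν
  have hk : ∀ k, Tendsto (fun s : ℝ => (locFT (fun ξ => χ ξ • c.P i ξ) (c.Rb τ θ (δ k)) s
      - (cexp (-I * s * ξ₀) * b) • c.P i ξ₀ (fhat (δ k) ξ₀)) k) (dirR ν) (𝓝 0) := fun k =>
    ((EuclideanSpace.proj (𝕜 := ℂ) k).continuous.tendsto' 0 0 (map_zero _)).comp (hb (δ k))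
  have hsum := (tendsto_finsetSum Finset.univ fun k _ => hk k).const_mul (√(2 * Real.pi) : ℂ)
  have hRL := (tendsto_integral_exp_dirR a ν).const_mul ((√(2 * Real.pi))⁻¹ : ℂ)
  have hlead : Tendsto (fun s : ℝ => c.leadFT i τ θ χ s - cexp (-I * s * ξ₀) * b)
      (dirR ν) (𝓝 0) := by
    have h1 := hsum.add hRL
    rw [Finset.sum_const_zero, mul_zero, mul_zero, add_zero] at h1
    refine h1.congr fun s => ?_
    have h2 : ∀ k, (locFT (fun ξ => χ ξ • c.P i ξ) (c.Rb τ θ (δ k)) s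
        - (cexp (-I * s * ξ₀) * b) • c.P i ξ₀ (fhat (δ k) ξ₀)) k
        = locFT (fun ξ => χ ξ • c.P i ξ) (c.Rb τ θ (δ k)) s k
          - (cexp (-I * s * ξ₀) * b) * ((√(2 * Real.pi))⁻¹ : ℂ) *
            c.P i ξ₀ (EuclideanSpace.single k 1) k := by
      intro k
      have h3 : fhat (δ k) ξ₀ = ((√(2 * Real.pi))⁻¹ : ℂ) • EuclideanSpace.single k 1 :=
        fhat_single _ _
      rw [h3, map_smul, PiLp.sub_apply, PiLp.smul_apply, PiLp.smul_apply, smul_eq_mul, smul_eq_mul,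
        mul_assoc (_ * b)]
    rw [Finset.sum_congr rfl fun k _ => h2 k, Finset.sum_sub_distrib, ← Finset.mul_sum,
      c.trace_P i hreg₀, leadFT, mul_sub]
    have h4 : (√(2 * Real.pi) : ℂ) * ((√(2 * Real.pi))⁻¹ : ℂ) = 1 := mul_inv_cancel₀ hpi0
    linear_combination (-(cexp (-I * s * ξ₀) * b)) * h4
  have h5 := (hb f).sub (hlead.smul_const (c.P i ξ₀ (fhat f ξ₀)))
  rw [zero_smul, sub_zero] at h5
  refine h5.congr fun s => ?_
  rw [sub_smul]
  abel

end Coin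


/-! ### The Parseval formula and the generalized eigenfunctions -/

/-- The coupling with a plane wave is an evaluation of the Fourier series. -/
lemma pair_pw {g : ℤ → E} (hg : Summable fun x => ‖g x‖) (κ : ℝ) (v : E) :
    pair (pw κ v) g = (√(2 * Real.pi) : ℂ) * inner ℂ (fhat g κ) v := by
  have hpi : (√(2 * Real.pi) : ℂ) ≠ 0 := by
    rw [Complex.ofReal_ne_zero]; have := Real.pi_pos; positivity
  have h1 : ∀ x : ℤ, inner ℂ v (cexp (-I * x * κ) • g x)
      = (starRingEnd ℂ) (inner ℂ (g x) (pw κ v x)) := by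
    intro x
    rw [pw, inner_smul_right, inner_smul_right, map_mul, inner_conj_symm, Coin.conj_exp_I_mul]
    push_cast; ring_nf
  have h2 : inner ℂ v (∑' x : ℤ, cexp (-I * x * κ) • g x) = (starRingEnd ℂ) (pair (pw κ v) g) := by
    rw [pair, Complex.conj_tsum, ← tsum_congr h1]
    exact (innerSL ℂ v).map_tsum (summable_fhat hg κ)
  have h3 : (starRingEnd ℂ) ((√(2 * Real.pi))⁻¹ : ℂ) = ((√(2 * Real.pi))⁻¹ : ℂ) := by
    rw [map_inv₀, Complex.conj_ofReal]
  rw [fhat, inner_smul_left, h3, mul_inv_cancel_left₀ hpi, ← inner_conj_symm, h2,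
    Complex.conj_conj]

lemma pair_sum_pw {ι : Type*} (s : Finset ι) {g : ℤ → E} (hg : Summable fun x => ‖g x‖)
    (κ : ι → ℝ) (v : ι → E) : pair (fun x => ∑ i ∈ s, pw (κ i) (v i) x) g
      = ∑ i ∈ s, (√(2 * Real.pi) : ℂ) * inner ℂ (fhat g (κ i)) (v i) := by
  simp only [← pair_pw hg, pair, inner_sum]
  exact Summable.tsum_finsetSum fun i _ => pair_summable (fun x => (norm_pw _ _ x).le) hg

lemma norm_fhat_le {f : ℤ → E} (hf : Summable fun x => ‖f x‖) (ξ : ℝ) :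
    ‖fhat f ξ‖ ≤ ∑' x, ‖f x‖ := by
  have h1 : (1 : ℝ) ≤ √(2 * Real.pi) := by
    rw [Real.one_le_sqrt]; linarith [Real.pi_gt_three]
  have h2 : ‖∑' x : ℤ, cexp (-I * x * ξ) • f x‖ ≤ ∑' x, ‖f x‖ :=
    tsum_of_norm_bounded hf.hasSum fun x => by
      rw [norm_smul, show -I * (x : ℂ) * (ξ : ℂ) = I * ((-(x * ξ) : ℝ) : ℂ) by push_cast; ring,
        norm_exp_I_real, one_mul]
  rw [fhat, norm_smul, norm_inv, Complex.norm_real, Real.norm_of_nonneg (by positivity)]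
  calc (√(2 * Real.pi))⁻¹ * ‖∑' x : ℤ, cexp (-I * x * ξ) • f x‖
      ≤ 1 * ‖∑' x : ℤ, cexp (-I * x * ξ) • f x‖ :=
        mul_le_mul_of_nonneg_right (inv_le_one_of_one_le₀ h1) (norm_nonneg _)
    _ ≤ _ := by rwa [one_mul]

namespace Coin

variable {c : Coin} {j : Fin 2} {θ : ℝ}

/-- The set `M(θ)` is represented by `kap 1 θ` and `kap (-1) θ`. -/
lemma InBand.sum_M (h : c.InBand j θ) {M : Type*} [AddCommMonoid M] {F : ℝ → M}
    (hF : ∀ (ξ : ℝ) (n : ℤ), F (ξ + 2 * Real.pi * n) = F ξ) :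
    ∑ ξ : c.M θ, F ξ = ∑ σ, F (c.kap σ θ) := by
  have hpi := Real.two_pi_pos
  -- `M(θ)` lies in `[0, 2π)`, so `kap σ θ` is translated there
  let n : ℤˣ → ℤ := fun σ => -⌊c.kap σ θ / (2 * Real.pi)⌋
  have hn : ∀ σ, c.kap σ θ + 2 * Real.pi * n σ ∈ Ico 0 (2 * Real.pi) := by
    intro σ
    have h1 := Int.floor_le (c.kap σ θ / (2 * Real.pi))
    have h2 := Int.lt_floor_add_one (c.kap σ θ / (2 * Real.pi))
    rw [le_div_iff₀ hpi] at h1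
    rw [div_lt_iff₀ hpi] at h2
    simp only [n, mem_Ico]
    push_cast
    constructor <;> nlinarith
  let e : ℤˣ → c.M θ := fun σ =>
    ⟨c.kap σ θ + 2 * Real.pi * n σ, h.mem_fermi.2 ⟨σ, n σ, rfl⟩, hn σ⟩
  symm
  refine Fintype.sum_bijective e ⟨fun σ ρ hσ => ?_, fun ξ => ?_⟩ _ _ fun σ => (hF _ (n σ)).symm
  · exact h.kap_injective (congrArg Subtype.val hσ)
  · obtain ⟨ξ, hξ, hI⟩ := ξ
    obtain ⟨σ, m, rfl⟩ := h.mem_fermi.1 hξ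
    have h1 := hn σ
    have h2 : (m : ℝ) - n σ < 1 := by
      by_contra hcon
      nlinarith [hI.1, hI.2, h1.1, h1.2]
    have h3 : (n σ : ℝ) - m < 1 := by
      by_contra hcon
      nlinarith [hI.1, hI.2, h1.1, h1.2]
    have h4 : m - n σ < 1 := by exact_mod_cast h2
    have h5 : n σ - m < 1 := by exact_mod_cast h3
    have h6 : n σ = m := by omega
    exact ⟨σ, Subtype.ext (by simp only [e, h6])⟩

open Classical in
lemma coe_F0 (f : BZ) (i : Fin 2) (ξ : c.M θ) :
    ((c.F0 θ f i ξ : c.eig i ξ) : E) = if θ ∈ c.band i then c.P i ξ (fhat f ξ) else 0 := by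
  rw [F0, LinearMap.pi_apply, LinearMap.pi_apply]
  split_ifs <;> rfl

lemma InBand.coe_F0_self (h : c.InBand j θ) (f : BZ) (ξ : c.M θ) :
    ((c.F0 θ f j ξ : c.eig j ξ) : E) = c.P j ξ (fhat f ξ) := by
  rw [coe_F0, if_pos h.mem]

lemma InBand.coe_F0_of_ne (h : c.InBand j θ) (f : BZ) {i : Fin 2} (hi : i ≠ j) (ξ : c.M θ) :
    ((c.F0 θ f i ξ : c.eig i ξ) : E) = 0 := by
  rw [coe_F0, if_neg fun h1 => hi (h.eq_of_mem h1)]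

lemma InBand.hInner_F0 (h : c.InBand j θ) (f : BZ) (φ : c.hSpace θ) :
    c.hInner (c.F0 θ f) φ
      = ∑ ξ : c.M θ, (c.dxi θ : ℂ) * inner ℂ (φ j ξ : E) (c.P j ξ (fhat f ξ)) := by
  rw [hInner, Finset.sum_eq_single j]
  · exact Finset.sum_congr rfl fun ξ _ => by rw [h.coe_F0_self]
  · intro i _ hi
    exact Finset.sum_eq_zero fun ξ _ => by rw [h.coe_F0_of_ne f hi, inner_zero_right, mul_zero]
  · intro h1
    exact absurd (Finset.mem_univ _) h1

lemma inner_P_P (i : Fin 2) (ξ : ℝ) (v w : E) :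
    (inner ℂ (c.P i ξ v) (c.P i ξ w) : ℂ) = inner ℂ v (c.P i ξ w) := by
  have h1 := Submodule.inner_starProjection_left_eq_right (c.eig i ξ) v (c.P i ξ w)
  rw [show (c.eig i ξ).starProjection (c.P i ξ w) = c.P i ξ w from c.P_P i ξ w] at h1
  exact h1

/-- The Parseval formula: the jump of the resolvent is a sum of two plane waves by `InBand.Rb_sub`,
and the coupling with a plane wave evaluates the Fourier series. -/
lemma InBand.parseval (h : c.InBand j θ) (f g : BZ) :
    pair ((c.Rb 1 θ f : ℤ → E) - c.Rb (-1) θ f) g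
      = 2 * Real.pi * cexp (-I * θ) * c.hInner (c.F0 θ f) (c.F0 θ g) := by
  have hg := summable_norm_of_mem_BZ g.2
  have hsq : (√(2 * Real.pi) : ℂ) * (√(2 * Real.pi) : ℂ) = 2 * Real.pi := by
    rw [← Complex.ofReal_mul, Real.mul_self_sqrt (by positivity)]
    push_cast; ring
  rw [show ((c.Rb 1 θ f : ℤ → E) - c.Rb (-1) θ f)
    = fun x => ∑ σ, pw (c.kap σ θ) (c.ampl j 1 θ f (c.kap σ θ)) x from funext (h.Rb_sub f),
    pair_sum_pw _ hg, h.hInner_F0]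
  have hF : ∀ (ξ : ℝ) (n : ℤ), (c.dxi θ : ℂ) *
      inner ℂ (c.P j (ξ + 2 * Real.pi * n) (fhat g (ξ + 2 * Real.pi * n)))
        (c.P j (ξ + 2 * Real.pi * n) (fhat f (ξ + 2 * Real.pi * n)))
      = (c.dxi θ : ℂ) * inner ℂ (c.P j ξ (fhat g ξ)) (c.P j ξ (fhat f ξ)) := by
    intro ξ n
    rw [P_periodic, fhat_periodic, fhat_periodic]
  have hsum := h.sum_M (F := fun ξ => (c.dxi θ : ℂ) *
    inner ℂ (c.P j ξ (fhat g ξ)) (c.P j ξ (fhat f ξ))) hF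
  simp only [h.coe_F0_self]
  rw [hsum, Finset.mul_sum]
  refine Finset.sum_congr rfl fun σ _ => ?_
  rw [ampl, inner_smul_right, inner_P_P]
  have h1 : ((((1 : ℤˣ) : ℤ) : ℂ)) = 1 := by simp
  rw [h1]
  linear_combination (c.dxi θ * cexp (-I * θ) *
    inner ℂ (fhat g (c.kap σ θ)) (c.P j (c.kap σ θ) (fhat f (c.kap σ θ)))) * hsq

/-- The boundedness of `𝓕₀(θ)`. -/
lemma InBand.exists_hNorm_F0_le (h : c.InBand j θ) :
    ∃ κ > 0, ∀ f : BZ, c.hNorm (c.F0 θ f) ≤ κ * Bnorm f := by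
  have hd := h.dxi_pos
  set D : ℝ := ∑ _ : Fin 2, ∑ _ : c.M θ, c.dxi θ with hD
  have hD0 : 0 ≤ D := Finset.sum_nonneg fun _ _ => Finset.sum_nonneg fun _ _ => hd.le
  refine ⟨√D * √2 + 1, by positivity, fun f => ?_⟩
  have hB := Bnorm_nonneg (f : ℤ → E)
  have hle : ∀ (i : Fin 2) (ξ : c.M θ), ‖((c.F0 θ f i ξ : c.eig i ξ) : E)‖ ≤ √2 * Bnorm f := by
    intro i ξ
    rw [coe_F0]
    split_ifs
    · exact ((Submodule.norm_starProjection_apply_le _ _).trans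
        (norm_fhat_le (summable_norm_of_mem_BZ f.2) _)).trans (sum_norm_le_Bnorm f.2)
    · rw [norm_zero]; positivity
  have h1 : ∑ i : Fin 2, ∑ ξ : c.M θ, c.dxi θ * ‖((c.F0 θ f i ξ : c.eig i ξ) : E)‖ ^ 2
      ≤ D * (√2 * Bnorm f) ^ 2 := by
    rw [hD, Finset.sum_mul]
    refine Finset.sum_le_sum fun i _ => ?_
    rw [Finset.sum_mul]
    refine Finset.sum_le_sum fun ξ _ => ?_
    exact mul_le_mul_of_nonneg_left (pow_le_pow_left₀ (norm_nonneg _) (hle i ξ) 2) hd.le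
  calc c.hNorm (c.F0 θ f) ≤ √(D * (√2 * Bnorm f) ^ 2) := Real.sqrt_le_sqrt h1
    _ = √D * (√2 * Bnorm f) := by rw [Real.sqrt_mul hD0, Real.sqrt_sq (by positivity)]
    _ ≤ (√D * √2 + 1) * Bnorm f := by nlinarith

/-- The sum of plane waves `(2π)^{-1/2} ∑_{ξ ∈ M(θ)} (dξ/dθ) e^{ixξ} φ_j(ξ)`. -/
def eigenWave (c : Coin) (j : Fin 2) {θ : ℝ} (φ : c.hSpace θ) (x : ℤ) : E :=
  ∑ ξ : c.M θ, pw ξ ((((√(2 * Real.pi))⁻¹ : ℂ) * c.dxi θ) • (φ j ξ : E)) x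

lemma norm_le_hNorm (hd : 0 < c.dxi θ) (φ : c.hSpace θ) (i : Fin 2) (ξ : c.M θ) :
    √(c.dxi θ) * ‖(φ i ξ : E)‖ ≤ c.hNorm φ := by
  rw [hNorm]
  refine Real.le_sqrt_of_sq_le ?_
  rw [mul_pow, Real.sq_sqrt hd.le]
  have h0 : ∀ (i : Fin 2) (ξ : c.M θ), 0 ≤ c.dxi θ * ‖(φ i ξ : E)‖ ^ 2 := fun i ξ => by positivity
  refine le_trans ?_ (Finset.single_le_sum (fun i _ => Finset.sum_nonneg fun ξ _ => h0 i ξ)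
    (Finset.mem_univ i))
  exact Finset.single_le_sum (f := fun ξ : c.M θ => c.dxi θ * ‖(φ i ξ : E)‖ ^ 2)
    (fun ξ _ => h0 i ξ) (Finset.mem_univ ξ)

lemma norm_eigenWave_le (hd : 0 < c.dxi θ) (φ : c.hSpace θ) (x : ℤ) :
    ‖c.eigenWave j φ x‖ ≤ (Fintype.card (c.M θ) * √(c.dxi θ)) * c.hNorm φ := by
  have h1 : (1 : ℝ) ≤ √(2 * Real.pi) := by
    rw [Real.one_le_sqrt]; linarith [Real.pi_gt_three]
  rw [mul_assoc, ← nsmul_eq_mul, ← Finset.card_univ]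
  refine (norm_sum_le _ _).trans (Finset.sum_le_card_nsmul _ _ _ fun ξ _ => ?_)
  rw [norm_pw, norm_smul, norm_mul, norm_inv, Complex.norm_real, Complex.norm_real,
    Real.norm_of_nonneg (Real.sqrt_nonneg _), Real.norm_of_nonneg hd.le]
  have h2 := norm_le_hNorm hd φ j ξ
  have h3 : (√(2 * Real.pi))⁻¹ ≤ 1 := inv_le_one_of_one_le₀ h1
  calc (√(2 * Real.pi))⁻¹ * c.dxi θ * ‖(φ j ξ : E)‖ ≤ 1 * c.dxi θ * ‖(φ j ξ : E)‖ := by gcongr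
    _ = √(c.dxi θ) * (√(c.dxi θ) * ‖(φ j ξ : E)‖) := by
        rw [← mul_assoc, Real.mul_self_sqrt hd.le, one_mul]
    _ ≤ √(c.dxi θ) * c.hNorm φ := mul_le_mul_of_nonneg_left h2 (Real.sqrt_nonneg _)

/-- The adjoint of `𝓕₀(θ)`, for `θ` in the band with index `j`. -/
def F0adj (c : Coin) (j : Fin 2) (θ : ℝ) : c.hSpace θ →ₗ[ℂ] BstarZ where
  toFun φ := ⟨c.eigenWave j φ, mem_BstarZ_of_bounded (B := ∑ ξ : c.M θ,
    ‖(((√(2 * Real.pi))⁻¹ : ℂ) * c.dxi θ) • (φ j ξ : E)‖) fun x =>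
      (norm_sum_le _ _).trans (Finset.sum_le_sum fun ξ _ => (norm_pw _ _ _).le)⟩
  map_add' φ χ := by
    refine Subtype.ext (funext fun x => ?_)
    change c.eigenWave j (φ + χ) x = c.eigenWave j φ x + c.eigenWave j χ x
    simp only [eigenWave, ← Finset.sum_add_distrib, ← pw_add, ← smul_add]
    rfl
  map_smul' a φ := by
    refine Subtype.ext (funext fun x => ?_)
    change c.eigenWave j (a • φ) x = a • c.eigenWave j φ x
    simp only [eigenWave, Finset.smul_sum, ← pw_smul, smul_comm a]
    rfl

lemma coe_F0adj (φ : c.hSpace θ) : (c.F0adj j θ φ : ℤ → E) = c.eigenWave j φ := rfl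

lemma InBand.hInner_F0_eq (h : c.InBand j θ) (f : BZ) (φ : c.hSpace θ) :
    c.hInner (c.F0 θ f) φ = (starRingEnd ℂ) (pair (c.F0adj j θ φ) f) := by
  have hpi : (√(2 * Real.pi) : ℂ) ≠ 0 := by
    rw [Complex.ofReal_ne_zero]; have := Real.pi_pos; positivity
  rw [h.hInner_F0, coe_F0adj, show c.eigenWave j φ = fun x => ∑ ξ : c.M θ, pw ξ
    ((((√(2 * Real.pi))⁻¹ : ℂ) * c.dxi θ) • (φ j ξ : E)) x from rfl,
    pair_sum_pw _ (summable_norm_of_mem_BZ f.2), map_sum]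
  refine Finset.sum_congr rfl fun ξ _ => ?_
  have h1 : (inner ℂ (φ j ξ : E) (c.P j ξ (fhat f ξ)) : ℂ) = inner ℂ (φ j ξ : E) (fhat f ξ) := by
    have h2 := Submodule.inner_starProjection_left_eq_right (c.eig j ξ) (φ j ξ : E) (fhat f ξ)
    rw [Submodule.starProjection_eq_self_iff.2 (φ j ξ).2] at h2
    exact h2.symm
  rw [h1, inner_smul_right, map_mul, map_mul, map_mul, inner_conj_symm, map_inv₀,
    Complex.conj_ofReal, Complex.conj_ofReal]
  field_simp

lemma InBand.U0_eigenWave (h : c.InBand j θ) (φ : c.hSpace θ) :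
    c.U0 (c.eigenWave j φ) = cexp (I * θ) • c.eigenWave j φ := by
  have h1 : c.eigenWave j φ = ∑ ξ : c.M θ,
      pw ξ ((((√(2 * Real.pi))⁻¹ : ℂ) * c.dxi θ) • (φ j ξ : E)) := by
    funext x; rw [eigenWave, Finset.sum_apply]
  rw [h1, map_sum, Finset.smul_sum]
  refine Finset.sum_congr rfl fun ξ _ => ?_
  have h2 : op (c.Uhat ξ) (φ j ξ : E) = cexp (I * θ) • (φ j ξ : E) := by
    rw [(mem_eig c).1 (φ j ξ).2, h.lam_of_fermi ξ.2.1]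
  rw [U0_pw, map_smul, h2, smul_comm]
  funext x
  rw [pw_smul, Pi.smul_apply]

/-- Generalized eigenfunctions of `U₀` are generalized eigenfunctions of `U₀*`, by unitarity. -/
lemma U0star_eq_of_U0_eq {u : ℤ → E} (hu : c.U0 u = cexp (I * θ) • u) :
    c.U0star u = cexp (-I * θ) • u := by
  have h1 := c.U0star_U0 u
  rw [hu, U0star_smul] at h1
  nth_rewrite 2 [← h1]
  rw [smul_smul, exp_neg_mul_exp, one_smul]

lemma InBand.exists_BstarNorm_F0adj_le (h : c.InBand j θ) :
    ∃ κ > 0, ∀ φ : c.hSpace θ, BstarNorm (c.F0adj j θ φ) ≤ κ * c.hNorm φ := by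
  refine ⟨√3 * (Fintype.card (c.M θ) * √(c.dxi θ)) + 1, by positivity, fun φ => ?_⟩
  have h1 : 0 ≤ c.hNorm φ := Real.sqrt_nonneg _
  have h2 := BstarNorm_le_of_bounded (norm_eigenWave_le (j := j) h.dxi_pos φ)
  rw [coe_F0adj]
  linarith

end Coin

end QW
end

theorem theorem3p2 (c : QW.Coin) :
    -- the resolvent `R₀(z) = (U₀ - e^{iz})⁻¹` exists for `z ∈ ℂ ∖ ℝ`
    (∀ z : ℂ, z.im ≠ 0 → IsUnit (c.U0H - cexp (I * z) • (1 : QW.H →L[ℂ] QW.H))) ∧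
    -- `R τ θ` is `R₀(θ ± i0)`, with `τ = ±1`
    ∃ R : ℤˣ → ℝ → (QW.BZ →ₗ[ℂ] QW.BstarZ),
      -- the weak-* limits
      (∀ τ : ℤˣ, ∀ θ ∈ c.J, ∀ f g : QW.BZ,
        Tendsto
          (fun ε : ℝ => QW.pair
            (c.R0 (θ - I * (Real.log (1 - ((τ : ℤ) : ℝ) * ε) : ℝ)) (QW.BZ.toH f) : QW.H) g)
          (𝓝[>] 0) (𝓝 (QW.pair (R τ θ f) g))) ∧
      -- bounds, uniform on compact intervals
      (∀ a b : ℝ, Icc a b ⊆ c.J → ∃ κ > 0, ∀ τ : ℤˣ, ∀ θ ∈ Icc a b, ∀ f : QW.BZ,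
        QW.BstarNorm (R τ θ f) ≤ κ * QW.Bnorm f) ∧
      -- weak-* continuity
      (∀ τ : ℤˣ, ∀ f g : QW.BZ, ContinuousOn (fun θ => QW.pair (R τ θ f) g) c.J) ∧
      -- existence and uniqueness under the radiation condition
      (∀ τ : ℤˣ, ∀ θ ∈ c.J, ∀ f : QW.BZ, ∀ u : QW.BstarZ,
        (c.U0 u - cexp (I * θ) • (u : ℤ → QW.E) = f ∧ c.Radiation τ θ u) ↔ u = R τ θ f) ∧
      -- the exact wave front sets
      (∀ τ : ℤˣ, ∀ θ ∈ c.J, ∀ f : QW.BZ, ∀ ξ ∈ c.regular, ∀ d : ℤˣ,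
        ((ξ, d) ∈ QW.WFstar (c.P 0) (R τ θ f) ↔
          θ ∈ c.band 0 ∧ ξ ∈ c.fermi θ ∧ c.P 0 ξ (QW.fhat f ξ) ≠ 0 ∧
            ((d : ℤ) : ℝ) = -((τ : ℤ) : ℝ) * c.slope ξ) ∧
        ((ξ, d) ∈ QW.WFstar (c.P 1) (R τ θ f) ↔
          θ ∈ c.band 1 ∧ ξ ∈ c.fermi θ ∧ c.P 1 ξ (QW.fhat f ξ) ≠ 0 ∧
            ((d : ℤ) : ℝ) = ((τ : ℤ) : ℝ) * c.slope ξ)) ∧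
      -- the leading terms near the points of `M(θ)`, up to `𝓑₀*`
      (∀ τ : ℤˣ, ∀ θ ∈ c.J, ∀ f : QW.BZ, ∀ j : Fin 2, ∀ ξ₀ ∈ c.fermi θ, ∀ χ : ℝ → ℂ,
        QW.IsCutoff ξ₀ χ → tsupport χ ⊆ c.regular → tsupport χ ∩ c.fermi θ ⊆ {ξ₀} →
        ∃ S : ℝ → ℂ, c.IsLeadingFT τ θ j χ S ∧
          QW.IsB0star fun s =>
            QW.locFT (fun ξ => χ ξ • c.P j ξ) (R τ θ f) s
              - S s • c.P j ξ₀ (QW.fhat f ξ₀)) ∧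
      -- no leading term away from `M(θ)`
      (∀ τ : ℤˣ, ∀ θ ∈ c.J, ∀ f : QW.BZ, ∀ ξ₀ : ℝ, ∀ χ : ℝ → ℂ,
        QW.IsCutoff ξ₀ χ → tsupport χ ∩ c.fermi θ = ∅ →
        QW.IsB0star (QW.locFT (fun ξ => χ ξ • (1 : QW.E →L[ℂ] QW.E)) (R τ θ f))) ∧
      -- the Parseval formula
      (∀ θ ∈ c.J, ∀ f g : QW.BZ,
        QW.pair ((R 1 θ f : ℤ → QW.E) - R (-1) θ f) g
          = 2 * Real.pi * cexp (-I * θ) * c.hInner (c.F0 θ f) (c.F0 θ g)) ∧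
      -- `𝓕₀(θ)`, its adjoint, and the generalized eigenfunctions
      (∀ θ ∈ c.J,
        (∃ κ > 0, ∀ f : QW.BZ, c.hNorm (c.F0 θ f) ≤ κ * QW.Bnorm f) ∧
        ∃ Fadj : c.hSpace θ →ₗ[ℂ] QW.BstarZ,
          (∀ (f : QW.BZ) (φ : c.hSpace θ),
            c.hInner (c.F0 θ f) φ = (starRingEnd ℂ) (QW.pair (Fadj φ) f)) ∧
          (∃ κ > 0, ∀ φ : c.hSpace θ, QW.BstarNorm (Fadj φ) ≤ κ * c.hNorm φ) ∧
          ∀ φ : c.hSpace θ,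
            c.U0 (Fadj φ) - cexp (I * θ) • (Fadj φ : ℤ → QW.E) = 0 ∧
            c.U0star (Fadj φ) - cexp (-I * θ) • (Fadj φ : ℤ → QW.E) = 0) := by
  refine ⟨fun z hz => c.isUnit_U0H_sub hz, c.Rb,
    fun τ θ hθ f g => QW.Coin.tendsto_pair_R0 τ hθ f g,
    fun a b hab => QW.Coin.exists_bound_Rb hab, QW.Coin.continuousOn_pair_Rb,
    ?_, ?_, ?_, ?_, ?_, ?_⟩
  · intro τ θ hθ f u
    obtain ⟨j, h⟩ := c.exists_inBand hθ
    constructor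
    · rintro ⟨hu, hrad⟩
      exact Subtype.ext (h.eq_Rb τ f hu hrad)
    · rintro rfl
      exact ⟨h.U0_Rb τ f, h.radiation_Rb τ f⟩
  · intro τ θ hθ f ξ hξ d
    obtain ⟨j, h⟩ := c.exists_inBand hθ
    constructor
    · rw [h.mem_WFstar_Rb τ f hξ d 0]
      refine and_congr_right fun hb => ?_
      rw [← h.eq_of_mem hb]
      simp [QW.Coin.bsgn]
    · rw [h.mem_WFstar_Rb τ f hξ d 1]
      refine and_congr_right fun hb => ?_
      rw [← h.eq_of_mem hb]
      simp [QW.Coin.bsgn]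
  · intro τ θ hθ f i ξ₀ hξ₀ χ hχ hreg hs
    obtain ⟨j, h⟩ := c.exists_inBand hθ
    exact ⟨c.leadFT i τ θ χ, h.isLeadingFT i τ hχ hreg,
      h.isB0star_leading i τ hχ hreg hξ₀ hs f⟩
  · intro τ θ hθ f ξ₀ χ hχ hs
    obtain ⟨j, h⟩ := c.exists_inBand hθ
    exact h.isB0star_Rb τ f hχ hs
  · intro θ hθ f g
    obtain ⟨j, h⟩ := c.exists_inBand hθ
    exact h.parseval f g
  · intro θ hθ
    obtain ⟨j, h⟩ := c.exists_inBand hθ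
    refine ⟨h.exists_hNorm_F0_le, c.F0adj j θ, h.hInner_F0_eq, h.exists_BstarNorm_F0adj_le,
      fun φ => ?_⟩
    have hU := h.U0_eigenWave φ
    rw [QW.Coin.coe_F0adj]
    exact ⟨sub_eq_zero.2 hU, sub_eq_zero.2 (QW.Coin.U0star_eq_of_U0_eq hU)⟩
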